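/- Let $B$ and $\mathcal A$ be unital complex Banach algebras, and let $(\mathcal A,E,\varepsilon)$ be a Banach $B$-$B$-non-commutative probability space: $\varepsilon:B\otimes B^{\mathrm{op}}\to\mathcal A$ is a unital homomorphism whose restrictions $L_b=\varepsilon(b\otimes 1)$ and $R_b=\varepsilon(1\otimes b)$ are injective and bounded in $b$, and $E:\mathcal A\to B$ is a bounded linear map with $E(L_{b_1}R_{b_2}Z)=b_1E(Z)b_2$ and $E(ZL_b)=E(ZR_b)$ for all $b,b_1,b_2\in B$, $Z\in\mathcal A$. Let $\mathcal A_\ell$ (resp. $\mathcal A_r$) be the algebra of all elements commuting with every $R_b$ (resp. every $L_b$). Let $\kappa^B_\chi$ denote the operator-valued bi-free cumulants, $$\kappa^B_\chi(Z_1,\dots,Z_n)=\sum_{\sigma\in BNC(\chi)}E^B_\sigma(Z_1,\dots,Z_n)\,\mu_{BNC}(\sigma,1_\chi),$$ where $BNC(\chi)$ is the set of bi-non-crossing partitions for $\chi:\{1,\dots,n\}\to\{\ell,r\}$, $\mu_{BNC}$ is its Möbius function, and $E^B$ is the bi-multiplicative moment function with $E^B_{1_\chi}(Z_1,\dots,Z_n)=E(Z_1\cdots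 Z_n)$. Write $\chi_{n,0}$ and $\chi_{0,n}$ for the constant maps with value $\ell$ and $r$. For $X\in\mathcal A_\ell$ and $Y\in\mathcal A_r$ set $$\Phi_{\ell,X}(b)=\sum_{n\ge1}\kappa^B_{\chi_{n,0}}(L_bX,\dots,L_bX),\qquad \Psi_{\ell,X}(b)=\sum_{n\ge1}E((L_bX)^n),$$ $$\Phi_{r,Y}(d)=\sum_{n\ge1}\kappa^B_{\chi_{0,n}}(R_dY,\dots,R_dY),\qquad \Psi_{r,Y}(d)=\sum_{n\ge1}E((R_dY)^n).$$ For a function $F$ near $0\in B$, let $F^{\langle-1\rangle}$ denote its compositional inverse near $0$ (with $F^{\langle -1\rangle}(0)=0$), and let $b^{-1}F^{\langle-1\rangle}(b)$ (resp. $F^{\langle-1\rangle}(d)d^{-1}$) denote the analytic function $\theta$ near $0$ with $F^{\langle-1\rangle}(b)=b\,\theta(b)$ (resp. $F^{\langle-1\rangle}(d)=\theta(d)\,d$). If $E(X)$ is invertible in $B$, then $\Phi_{\ell,X}$ and $\Psi_{\ell,X}$ converge absolutely near $0$, the functions below exist, and for all $b$ in a neighbourhood of $0$ $$b^{-1}\Phi^{\langle-1\rangle}_{\ell,X}(b)=(1+b)\,b^{-1}\Psi^{\langle-1\rangle}_{\ell,X}(b).$$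 If $E(Y)$ is invertible in $B$, then $\Phi_{r,Y}$ and $\Psi_{r,Y}$ converge absolutely near $0$, the functions below exist, and for all $d$ in a neighbourhood of $0$ $$\Phi^{\langle-1\rangle}_{r,Y}(d)\,d^{-1}=\Psi^{\langle-1\rangle}_{r,Y}(d)\,d^{-1}(1+d).$$ That is, the left and right $S$-transforms defined through the cumulant series (left-hand sides) coincide near $0$ with those of Dykema defined through the moment series (right-hand sides). -/

import Mathlib

open Filter Topology
open scoped TensorProduct

/-! ### Bi-non-crossing partitions -/

/-- The two kinds of operators. -/
inductive Side : Type
  | left : Side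
  | right : Side
  deriving DecidableEq

/-- The positions listed in the order `s_χ(1), …, s_χ(n)`: the left positions in increasing order,
followed by the right positions in decreasing order. -/
def chiOrder {n : ℕ} (χ : Fin n → Side) : List (Fin n) :=
  (List.finRange n).filter (fun k => χ k = Side.left) ++
    ((List.finRange n).filter (fun k => χ k = Side.right)).reverse

/-- The strict total order `i ≺_χ j`: left positions come first, in increasing order, and right
positions come afterwards, in decreasing order. -/
def ChiLT {n : ℕ} (χ : Fin n → Side) (i j : Fin n) : Prop :=
  (χ i = Side.left ∧ χ j = Side.left ∧ i < j) ∨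
  (χ i = Side.left ∧ χ j = Side.right) ∨
  (χ i = Side.right ∧ χ j = Side.right ∧ j < i)

instance {n : ℕ} (χ : Fin n → Side) : DecidableRel (ChiLT χ) := fun i j => by
  unfold ChiLT; infer_instance

/-- A partition of `{1, …, n}` is bi-non-crossing with respect to `χ` if it has no crossing in the
order `≺_χ`. -/
def IsBiNonCrossing {n : ℕ} (χ : Fin n → Side)
    (π : Finpartition (Finset.univ : Finset (Fin n))) : Prop :=
  ∀ U ∈ π.parts, ∀ V ∈ π.parts, ∀ u₁ ∈ U, ∀ u₂ ∈ U, ∀ v₁ ∈ V, ∀ v₂ ∈ V,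
    ChiLT χ u₁ v₁ → ChiLT χ v₁ u₂ → ChiLT χ u₂ v₂ → U = V

/-- `BNC(χ)`, ordered by refinement. -/
abbrev BNC {n : ℕ} (χ : Fin n → Side) : Type :=
  {π : Finpartition (Finset.univ : Finset (Fin n)) // IsBiNonCrossing χ π}

noncomputable instance {n : ℕ} (χ : Fin n → Side) : Fintype (BNC χ) :=
  Fintype.ofFinite _

open Classical in
noncomputable instance {n : ℕ} (χ : Fin n → Side) : LocallyFiniteOrder (BNC χ) :=
  Fintype.toLocallyFiniteOrder

/-- The full partition `1_χ`, with one block. -/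
def BNC.full {n : ℕ} (χ : Fin n → Side) : BNC χ :=
  ⟨⊤, fun U hU V hV _ _ _ _ _ _ _ _ _ _ _ => by
    have h1 := Finpartition.parts_top_subset _ hU
    have h2 := Finpartition.parts_top_subset _ hV
    rw [Finset.mem_singleton] at h1 h2
    rw [h1, h2]⟩

open Classical in
/-- The bi-non-crossing Möbius function: the Möbius function of the finite poset `BNC(χ)`. -/
noncomputable def muBNC {n : ℕ} (χ : Fin n → Side) (σ π : BNC χ) : ℂ :=
  IncidenceAlgebra.mu ℂ σ π

/-- The blocks of a partition, listed so that their `≺_χ`-minimal elements decrease. When `π` is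
bi-non-crossing, each block in this list is a `χ`-interval of its union with the later ones. -/
def blockList {n : ℕ} (χ : Fin n → Side)
    (π : Finpartition (Finset.univ : Finset (Fin n))) : List (Finset (Fin n)) :=
  (((chiOrder χ).reverse).filter (fun k => ∀ j ∈ π.part k, ¬ ChiLT χ j k)).map π.part

/-- The `≺_χ`-largest position in the blocks `Q` that precedes all of `V`, if there is one. -/
def predPos {n : ℕ} (χ : Fin n → Side) (V : Finset (Fin n)) (Q : List (Finset (Fin n))) :
    Option (Fin n) :=
  (chiOrder χ).reverse.find? (fun k => (∃ W ∈ Q, k ∈ W) ∧ ∀ v ∈ V, ChiLT χ k v)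

/-! ### `B`-`B`-non-commutative probability spaces -/

/-- A `B`-`B`-non-commutative probability space structure on the unital algebra `A`. -/
structure BBSpace (B A : Type*) [Ring B] [Algebra ℂ B] [Ring A] [Algebra ℂ A] where
  /-- the unital homomorphism `ε : B ⊗ Bᵒᵖ → A` -/
  ε : B ⊗[ℂ] Bᵐᵒᵖ →ₐ[ℂ] A
  /-- the expectation -/
  E : A →ₗ[ℂ] B
  injective_left : Function.Injective (fun b : B => ε (b ⊗ₜ[ℂ] (1 : Bᵐᵒᵖ)))
  injective_right : Function.Injective (fun b : B => ε ((1 : B) ⊗ₜ[ℂ] MulOpposite.op b))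
  E_ε_mul : ∀ (b₁ b₂ : B) (Z : A), E (ε (b₁ ⊗ₜ[ℂ] MulOpposite.op b₂) * Z) = b₁ * E Z * b₂
  E_mul_ε : ∀ (b : B) (Z : A),
    E (Z * ε (b ⊗ₜ[ℂ] (1 : Bᵐᵒᵖ))) = E (Z * ε ((1 : B) ⊗ₜ[ℂ] MulOpposite.op b))

namespace BBSpace

section Algebraic

variable {B A : Type*} [Ring B] [Algebra ℂ B] [Ring A] [Algebra ℂ A] (P : BBSpace B A)

/-- `L_b = ε(b ⊗ 1)`. -/
def L (b : B) : A := P.ε (b ⊗ₜ[ℂ] (1 : Bᵐᵒᵖ))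

/-- `R_b = ε(1 ⊗ b)`; it is anti-multiplicative in `b`. -/
def R (b : B) : A := P.ε ((1 : B) ⊗ₜ[ℂ] MulOpposite.op b)

/-- The left algebra `A_ℓ`: the commutant of all `R_b`. -/
def leftAlg : Subalgebra ℂ A := Subalgebra.centralizer ℂ (Set.range P.R)

/-- The right algebra `A_r`: the commutant of all `L_b`. -/
def rightAlg : Subalgebra ℂ A := Subalgebra.centralizer ℂ (Set.range P.L)

/-- The moment of a single block: `E` of the product of the entries `Z k`, `k ∈ V`, in the natural
order of the positions. -/
def blockMoment {n : ℕ} (V : Finset (Fin n)) (Z : Fin n → A) : B :=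
  P.E (((V.sort (· ≤ ·)).map Z).prod)

/-- The reduction of a list of blocks by bi-multiplicativity. The head `V` is a `χ`-interval, and
its moment `c` is
* multiplied on the left of the rest if nothing in the other blocks precedes `V`;
* multiplied on the right of the rest if nothing in the other blocks follows `V`;
* otherwise inserted at the nearest preceding position `p` of the other blocks, where `Z p` is
  replaced by `Z p * L c` if `p` is a left position and by `R c * Z p` if it is a right one. -/
def momentAux {n : ℕ} (χ : Fin n → Side) : List (Finset (Fin n)) → (Fin n → A) → B
  | [], _ => 1
  | V :: Q, Z =>
    match predPos χ V Q with
    | none => P.blockMoment V Z * momentAux χ Q Z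
    | some p =>
      if ∃ W ∈ Q, ∃ k ∈ W, ∀ v ∈ V, ChiLT χ v k then
        match χ p with
        | Side.left => momentAux χ Q (Function.update Z p (Z p * P.L (P.blockMoment V Z)))
        | Side.right => momentAux χ Q (Function.update Z p (P.R (P.blockMoment V Z) * Z p))
      else momentAux χ Q Z * P.blockMoment V Z

/-- The operator-valued bi-free moment function `E^B_π(Z_1, …, Z_n)`: the bi-multiplicative
function with `E^B_{1_χ}(Z_1, …, Z_n) = E(Z_1 ⋯ Z_n)`. -/
def moment {n : ℕ} (χ : Fin n → Side) (π : BNC χ) (Z : Fin n → A) : B :=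
  P.momentAux χ (blockList χ π.1) Z

open Classical in
/-- The operator-valued bi-free cumulant function
`κ^B_π(Z_1, …, Z_n) = ∑_{σ ≤ π} E^B_σ(Z_1, …, Z_n) μ_BNC(σ, π)`. -/
noncomputable def cumulant {n : ℕ} (χ : Fin n → Side) (π : BNC χ) (Z : Fin n → A) : B :=
  ∑ σ : BNC χ with σ ≤ π, muBNC χ σ π • P.moment χ σ Z

/-- The `n`-th left cumulant `κ^B_{χ_{n,0}}(L_b X, …, L_b X)`. -/
noncomputable def leftCumulantTerm (X : A) (n : ℕ) (b : B) : B :=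
  P.cumulant (fun _ : Fin n => Side.left) (BNC.full _) (fun _ => P.L b * X)

/-- The `n`-th right cumulant `κ^B_{χ_{0,n}}(R_d Y, …, R_d Y)`. -/
noncomputable def rightCumulantTerm (Y : A) (n : ℕ) (d : B) : B :=
  P.cumulant (fun _ : Fin n => Side.right) (BNC.full _) (fun _ => P.R d * Y)

end Algebraic

section Banach

variable {B A : Type*} [NormedRing B] [NormedAlgebra ℂ B] [NormedRing A] [NormedAlgebra ℂ A]
  (P : BBSpace B A)

/-- The boundedness conditions of a Banach `B`-`B`-non-commutative probability space (`A` and `B`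
being Banach algebras): `E`, `b ↦ L_b` and `b ↦ R_b` are bounded. -/
structure IsBanach : Prop where
  bounded_E : ∃ C : ℝ, ∀ Z : A, ‖P.E Z‖ ≤ C * ‖Z‖
  bounded_L : ∃ C : ℝ, ∀ b : B, ‖P.L b‖ ≤ C * ‖b‖
  bounded_R : ∃ C : ℝ, ∀ b : B, ‖P.R b‖ ≤ C * ‖b‖

/-- `Φ_{ℓ,X}(b) = ∑_{n ≥ 1} κ^B_{χ_{n,0}}(L_b X, …, L_b X)`. -/
noncomputable def leftPhi (X : A) (b : B) : B := ∑' n : ℕ, P.leftCumulantTerm X (n + 1) b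

/-- `Φ_{r,Y}(d) = ∑_{n ≥ 1} κ^B_{χ_{0,n}}(R_d Y, …, R_d Y)`. -/
noncomputable def rightPhi (Y : A) (d : B) : B := ∑' n : ℕ, P.rightCumulantTerm Y (n + 1) d

/-- `Ψ_{ℓ,X}(b) = ∑_{n ≥ 1} E((L_b X)^n)`. -/
noncomputable def leftPsi (X : A) (b : B) : B := ∑' n : ℕ, P.E ((P.L b * X) ^ (n + 1))

/-- `Ψ_{r,Y}(d) = ∑_{n ≥ 1} E((R_d Y)^n)`. -/
noncomputable def rightPsi (Y : A) (d : B) : B := ∑' n : ℕ, P.E ((P.R d * Y) ^ (n + 1))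

end Banach

end BBSpace

section Inverses

variable {B : Type*} [NormedRing B] [NormedAlgebra ℂ B]

/-- `G` is the compositional inverse of `F` near zero (as a germ at zero). -/
def IsCompInverse (F G : B → B) : Prop :=
  G 0 = 0 ∧ ContinuousAt G 0 ∧ (∀ᶠ b in 𝓝 (0 : B), F (G b) = b) ∧ ∀ᶠ b in 𝓝 (0 : B), G (F b) = b

/-- `θ` is the analytic function `b ↦ b⁻¹ G(b)` near zero. -/
def IsLeftQuotient (G θ : B → B) : Prop :=
  AnalyticAt ℂ θ 0 ∧ ∀ᶠ b in 𝓝 (0 : B), G b = b * θ b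

/-- `θ` is the analytic function `d ↦ G(d) d⁻¹` near zero. -/
def IsRightQuotient (G θ : B → B) : Prop :=
  AnalyticAt ℂ θ 0 ∧ ∀ᶠ d in 𝓝 (0 : B), G d = θ d * d

end Inverses

namespace BBSpace

variable {B A : Type*} [NormedRing B] [NormedAlgebra ℂ B] [NormedRing A] [NormedAlgebra ℂ A]
  (P : BBSpace B A)

/-- `S` is (near zero) the left `S`-transform `b ↦ b⁻¹ Φ_{ℓ,X}^{⟨-1⟩}(b)` of `X`. -/
def IsLeftSTransform (X : A) (S : B → B) : Prop :=
  ∃ G : B → B, IsCompInverse (P.leftPhi X) G ∧ IsLeftQuotient G S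

/-- `S` is (near zero) the right `S`-transform `d ↦ Φ_{r,Y}^{⟨-1⟩}(d) d⁻¹` of `Y`. -/
def IsRightSTransform (Y : A) (S : B → B) : Prop :=
  ∃ G : B → B, IsCompInverse (P.rightPhi Y) G ∧ IsRightQuotient G S

/-- `S` is (near zero) Dykema's left `S`-transform `b ↦ (1 + b) b⁻¹ Ψ_{ℓ,X}^{⟨-1⟩}(b)`. -/
def IsDykemaLeftSTransform (X : A) (S : B → B) : Prop :=
  ∃ H T : B → B, IsCompInverse (P.leftPsi X) H ∧ IsLeftQuotient H T ∧
    ∀ᶠ b in 𝓝 (0 : B), S b = (1 + b) * T b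

/-- `S` is (near zero) Dykema's right `S`-transform `d ↦ Ψ_{r,Y}^{⟨-1⟩}(d) d⁻¹ (1 + d)`. -/
def IsDykemaRightSTransform (Y : A) (S : B → B) : Prop :=
  ∃ H T : B → B, IsCompInverse (P.rightPsi Y) H ∧ IsRightQuotient H T ∧
    ∀ᶠ d in 𝓝 (0 : B), S d = T d * (1 + d)

end BBSpace

/-! Take the left case. Put `Λ b = L_b X`, `M(b₁,…,bₙ) = E(Λ b₁ ⋯ Λ bₙ)` and `m(b) = (1 + Ψ(b)) b`,
whose coefficients are `M(b₁,…,bₙ₋₁) bₙ`. The linear part of `m` is the identity, so there is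
exactly one series `K` with `Ψ = K ∘ m` (`cumulantSeries`). Once `K` is known to be the series of
`Φ`, the relation `Ψ(b) = Φ((1 + Ψ(b)) b)` at the point `Ψ^{⟨-1⟩}(b)` reads `b = Φ((1 + b)
Ψ^{⟨-1⟩}(b))`. Hence `Φ^{⟨-1⟩}(b) = (1 + b) Ψ^{⟨-1⟩}(b)`, and `b` commutes with `1 + b`
(`exists_isCompInverse`, `eventually_quotient_eq`).

Convergence holds because the moments grow at most geometrically, and inversion and composition of
series preserve a positive radius. Moreover `Ψ(b) = b g(b)` with `g(b) = E(X (1 - L_b X)⁻¹)` and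
`g(0) = E(X)` invertible. So `Ψ` is locally invertible, and `b⁻¹ Ψ^{⟨-1⟩}(b)` is the analytic
function `g(Ψ^{⟨-1⟩}(b))⁻¹`.

The main work is to identify the Möbius-theoretic cumulants with the coefficients of `K`. The moment
`E_π` is computed block by block: the value of a block becomes a factor at the preceding position.
The relation `Ψ = K ∘ m` expands the moment of one block as a sum over the sub-blocks containing its
first position, with a cumulant on the sub-block and the moments of the gaps inserted as factors
(`leftTwist_eq_peelSum`, `rightTwist_eq_peelSum`). Iterating over all blocks writes `E_π` as a sum,
over the non-crossing `τ ≤ π`, of a value that depends on `τ` only (`run_eq_sum_leafValue`,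
`run_eq_of_perm`). Möbius inversion then isolates the value of the full partition, which is a single
cumulant (`cumulant_full_eq`).

The right case is the left one over `Bᵐᵒᵖ`, except for the block expansion, which has to be redone
for the reversed order. -/

/-! ### Insertion programs -/

section Insertions

variable {B : Type*} [Ring B]

/-- The sum over all ways of choosing positions of the list `l`, the first one being among them:
each chosen entry is multiplied on the right by the value of `F` on the entries which separate it
from the next chosen one, and `q` is applied to the resulting list followed by `acc`. -/
def peelSum (F q : List B → B) (l acc : List B) : B :=
  if l = [] then q acc
  else ∑ i : Fin l.length, peelSum F q (l.take i) (l[i] * F (l.drop (i + 1)) :: acc)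
termination_by l.length
decreasing_by simp

@[simp]
lemma peelSum_nil (F q : List B → B) (acc : List B) : peelSum F q [] acc = q acc := by
  rw [peelSum]; simp

lemma peelSum_of_ne_nil (F q : List B → B) {l : List B} (hl : l ≠ []) (acc : List B) :
    peelSum F q l acc =
      ∑ i : Fin l.length, peelSum F q (l.take i) (l[i] * F (l.drop (i + 1)) :: acc) := by
  rw [peelSum]; simp [hl]

/-- The instruction to evaluate a block and to insert the result after the position `pos`. The
block consists of the positions `fixed`, which stay in one block, and of the positions `free`
before them, which may still be split off. -/
structure Insertion where
  /-- positions which may be split off -/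
  free : List ℕ
  /-- positions which stay in the block -/
  fixed : List ℕ
  /-- the position after which the value is inserted -/
  pos : ℕ

namespace Insertion

/-- All positions of the block of an insertion. -/
def carrier (I : Insertion) : List ℕ := I.free ++ I.fixed

/-- The value inserted by an insertion. -/
def weight (F q : List B → B) (I : Insertion) (b : ℕ → B) : B :=
  peelSum F q (I.free.map b) (I.fixed.map b)

/-- The effect of an insertion on the entries. -/
def step (F q : List B → B) (I : Insertion) (b : ℕ → B) : ℕ → B :=
  Function.update b I.pos (b I.pos * I.weight F q b)

/-- The effect of a list of insertions on the entries. -/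
def run (F q : List B → B) : List Insertion → (ℕ → B) → ℕ → B
  | [], b => b
  | I :: L, b => run F q L (I.step F q b)

/-- `x` is a position of one of the blocks. -/
def Supp (L : List Insertion) (x : ℕ) : Prop := ∃ I ∈ L, x ∈ I.carrier

/-- The block of `I` is an interval of its union with the later blocks, and its value is inserted
directly before it. -/
structure Fits (I : Insertion) (L : List Insertion) : Prop where
  ne_nil : I.carrier ≠ []
  sorted : I.carrier.Pairwise (· < ·)
  pos_lt : ∀ v ∈ I.carrier, I.pos < v
  pos_mem : I.pos = 0 ∨ Supp L I.pos
  convex : ∀ x, Supp L x → x ≤ I.pos ∨ ∀ v ∈ I.carrier, v < x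

/-- Each block fits the later ones. -/
def Valid : List Insertion → Prop
  | [] => True
  | I :: L => I.Fits L ∧ Valid L

/-- All blocks are final. -/
def Leaf (L : List Insertion) : Prop := ∀ I ∈ L, I.free = []

@[simp] lemma supp_nil (x : ℕ) : ¬ Supp [] x := by simp [Supp]

@[simp] lemma supp_cons (I : Insertion) (L : List Insertion) (x : ℕ) :
    Supp (I :: L) x ↔ x ∈ I.carrier ∨ Supp L x := by simp [Supp]

@[simp] lemma supp_append (L L' : List Insertion) (x : ℕ) :
    Supp (L ++ L') x ↔ Supp L x ∨ Supp L' x := by simp [Supp, or_and_right, exists_or]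

lemma Fits.congr {I : Insertion} {L L' : List Insertion} (h : I.Fits L)
    (hL : ∀ x, Supp L x ↔ Supp L' x) : I.Fits L' :=
  ⟨h.ne_nil, h.sorted, h.pos_lt, by simpa [hL] using h.pos_mem,
    fun x hx => h.convex x ((hL x).2 hx)⟩

lemma Fits.notMem {I : Insertion} {L : List Insertion} (h : I.Fits L) {x : ℕ}
    (hx : x = 0 ∨ Supp L x) : x ∉ I.carrier := by
  intro hI
  have h1 := h.pos_lt x hI
  rcases hx with rfl | hx
  · omega
  · rcases h.convex x hx with h2 | h2
    · omega
    · exact lt_irrefl _ (h2 x hI)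

lemma leaf_cons {I : Insertion} {L : List Insertion} :
    Leaf (I :: L) ↔ I.free = [] ∧ Leaf L := by simp [Leaf]

lemma leaf_append {L L' : List Insertion} : Leaf (L ++ L') ↔ Leaf L ∧ Leaf L' := by
  simp [Leaf, or_imp, forall_and]

lemma Leaf.supp_iff {L : List Insertion} (hL : Leaf L) (x : ℕ) :
    Supp L x ↔ ∃ W ∈ L.map fixed, x ∈ W := by
  simp only [Supp, List.mem_map, exists_exists_and_eq_and]
  refine exists_congr fun I => and_congr_right fun hI => ?_
  simp [carrier, hL I hI]

variable {F q : List B → B}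

lemma weight_congr (I : Insertion) {b b' : ℕ → B} (h : ∀ x ∈ I.carrier, b x = b' x) :
    I.weight F q b = I.weight F q b' := by
  unfold weight
  congr 1 <;> refine List.map_congr_left fun x hx => h x ?_ <;> simp [carrier, hx]

lemma run_append (L L' : List Insertion) (b : ℕ → B) :
    run F q (L ++ L') b = run F q L' (run F q L b) := by
  induction L generalizing b with
  | nil => rfl
  | cons I L ih => exact ih _

lemma Valid.of_append {L L' : List Insertion} (h : Valid (L ++ L')) : Valid L' := by
  induction L with
  | nil => exact h
  | cons I L ih => exact ih h.2

/-- An insertion reads only its own block and its target, and the target is `0` or lies in a later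
block. Entries of blocks already evaluated are therefore never read again. -/
lemma run_congr {L : List Insertion} (hL : Valid L) {b b' : ℕ → B}
    (h : ∀ x, x = 0 ∨ Supp L x → b x = b' x) : run F q L b 0 = run F q L b' 0 := by
  induction L generalizing b b' with
  | nil => exact h 0 (Or.inl rfl)
  | cons I L ih =>
    refine ih hL.2 fun x hx => ?_
    have hw : I.weight F q b = I.weight F q b' :=
      weight_congr I fun x hx => h x (by simp [hx])
    unfold step
    by_cases hxp : x = I.pos
    · subst hxp
      rw [Function.update_self, Function.update_self, hw, h _ (by simp; tauto)]
    · rw [Function.update_of_ne hxp, Function.update_of_ne hxp, h x (by simp; tauto)]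

/-- Right linearity of a function of lists in the last entry. -/
def RightLinear (q : List B → B) : Prop :=
  ∀ (l : List B) (x c : B), q (l ++ [x * c]) = q (l ++ [x]) * c

lemma RightLinear.map_update (hq : RightLinear q) {W : List ℕ} (hW : W.Pairwise (· < ·)) {w : ℕ}
    (hw : w ∈ W) (hmax : ∀ v ∈ W, v ≤ w) (b : ℕ → B) (c : B) :
    q (W.map (Function.update b w (b w * c))) = q (W.map b) * c := by
  obtain ⟨l, l', rfl⟩ := List.append_of_mem hw
  have hl' : l' = [] := by
    rcases l' with _ | ⟨y, l'⟩
    · rfl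
    · have h1 := hmax y (by simp)
      rw [List.pairwise_append] at hW
      have h2 := (List.pairwise_cons.1 hW.2.1).1 y (by simp)
      omega
  subst hl'
  have hl : ∀ x ∈ l, x ≠ w := fun x hx => by
    rw [List.pairwise_append] at hW
    exact (hW.2.2 x hx w (by simp)).ne
  have h1 : l.map (Function.update b w (b w * c)) = l.map b :=
    List.map_congr_left fun x hx => Function.update_of_ne (hl x hx) _ _
  simp only [List.map_append, h1, List.map_cons, List.map_nil, Function.update_self]
  exact hq _ _ _

@[simp]
lemma weight_fixed (V : List ℕ) (p : ℕ) (b : ℕ → B) :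
    (Insertion.mk [] V p).weight F q b = q (V.map b) := by simp [weight]

lemma carrier_fixed (V : List ℕ) (p : ℕ) : (Insertion.mk [] V p).carrier = V := rfl

lemma map_update_of_notMem {α : Type*} {W : List ℕ} {w : ℕ} (hw : w ∉ W) (b : ℕ → α) (c : α) :
    W.map (Function.update b w c) = W.map b :=
  List.map_congr_left fun _ hx => Function.update_of_ne (ne_of_mem_of_not_mem hx hw) _ _

/-- A block which is an interval of the union of all blocks may be evaluated first. -/
lemma exists_run_eq_step (hq : RightLinear q) {V : List ℕ} {p r : ℕ} {A L : List Insertion}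
    (hA : Valid (A ++ ⟨[], V, r⟩ :: L)) (hleaf : Leaf (A ++ L))
    (hV : (Insertion.mk [] V p).Fits (A ++ L)) (b : ℕ → B) :
    ∃ C, Valid C ∧ Leaf C ∧ C.map fixed = (A ++ L).map fixed ∧
      run F q (A ++ ⟨[], V, r⟩ :: L) b 0 = run F q C ((Insertion.mk [] V p).step F q b) 0 := by
  induction A generalizing b p with
  | nil =>
    refine ⟨L, hA.2, hleaf, rfl, ?_⟩
    have hr := hA.1
    obtain ⟨v, hv⟩ := List.exists_mem_of_ne_nil _ hV.ne_nil
    have hpv := hV.pos_lt v hv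
    have hrv := hr.pos_lt v hv
    -- Both are the nearest position before `V` among `0` and the positions of `L`.
    have : r = p := by
      have h1 := hV.pos_mem
      have h2 := hr.pos_mem
      have h3 := hV.convex r
      have h4 := hr.convex p
      simp only at h1 h2 h3 h4 hpv hrv
      apply le_antisymm
      · rcases h2 with h2 | h2
        · omega
        · rcases h3 h2 with h | h
          · exact h
          · have := h v hv; omega
      · rcases h1 with h1 | h1
        · omega
        · rcases h4 h1 with h | h
          · exact h
          · have := h v hv; omega
    subst this
    rfl
  | cons I A ih =>
    obtain ⟨Ifree, U, s⟩ := I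
    obtain ⟨hfree, hleaf'⟩ := leaf_cons.1 hleaf
    simp only at hfree
    subst hfree
    rw [List.cons_append] at hA hV
    replace hleaf' : Leaf (A ++ L) := hleaf'
    have hU := hA.1
    have hVne := hV.ne_nil
    have hUne := hU.ne_nil
    have hVsorted := hV.sorted
    have hUsorted := hU.sorted
    obtain ⟨v, hv⟩ := List.exists_mem_of_ne_nil _ hV.ne_nil
    obtain ⟨u, hu⟩ := List.exists_mem_of_ne_nil _ hU.ne_nil
    have hVlt := hV.pos_lt
    have hUlt := hU.pos_lt
    have hUV : ∀ x, Supp (A ++ ⟨[], V, r⟩ :: L) x ↔ x ∈ V ∨ Supp (A ++ L) x := fun x => by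
      simp only [supp_append, supp_cons, carrier_fixed]; tauto
    have hVmem : p = 0 ∨ p ∈ U ∨ Supp (A ++ L) p :=
      hV.pos_mem.imp id (supp_cons _ _ _).1
    have hUmem : s = 0 ∨ s ∈ V ∨ Supp (A ++ L) s := by simpa only [hUV] using hU.pos_mem
    have hVc1 : ∀ x ∈ U, x ≤ p ∨ ∀ v ∈ V, v < x := fun x hx => hV.convex x (by simp [hx, carrier])
    have hVc2 : ∀ x, Supp (A ++ L) x → x ≤ p ∨ ∀ v ∈ V, v < x := fun x hx =>
      hV.convex x ((supp_cons _ _ _).2 (Or.inr hx))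
    have hUc1 : ∀ x ∈ V, x ≤ s ∨ ∀ u ∈ U, u < x := fun x hx => hU.convex x ((hUV x).2 (Or.inl hx))
    have hUc2 : ∀ x, Supp (A ++ L) x → x ≤ s ∨ ∀ u ∈ U, u < x := fun x hx =>
      hU.convex x ((hUV x).2 (Or.inr hx))
    have hsupp : ∀ C, Leaf C → C.map fixed = (A ++ L).map fixed →
        ∀ x, Supp C x ↔ Supp (A ++ L) x := fun C hCl hCm x => by
      rw [hCl.supp_iff, hleaf'.supp_iff, hCm]
    simp only [carrier_fixed] at hv hu hVlt hUlt hVne hUne hVsorted hUsorted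
    clear hUV
    by_cases hpU : p ∈ U
    · -- `V` directly follows the last position of `U`
      have hsp := hUlt p hpU
      have hsV : s ∉ V := fun h => by have := hVlt s h; omega
      have hUV : ∀ x ∈ V, ∀ y ∈ U, y < x := fun x hx y hy => by
        rcases hUc1 x hx with h | h
        · have := hVlt x hx; omega
        · exact h y hy
      -- Once `U` has been evaluated, the position before `V` is the one before `U`. Right linearity
      -- identifies inserting `q(U)` and then `q(V)` at `s` with inserting the value of `U` whose
      -- last entry carries the factor `q(V)`.
      have hfit : (Insertion.mk [] V s).Fits (A ++ L) := by
        refine ⟨hVne, hVsorted, fun x hx => ?_, ?_, fun x hx => ?_⟩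
        · have := hVlt x hx; simp only; omega
        · simp only; tauto
        · rcases hUc2 x hx with h | h
          · exact Or.inl h
          · rcases hVc2 x hx with h' | h'
            · have := h p hpU; omega
            · exact Or.inr h'
      obtain ⟨C, hC, hCl, hCm, hrun⟩ := ih hA.2 hleaf' hfit (Insertion.step F q ⟨[], U, s⟩ b)
      replace hsupp := hsupp C hCl hCm
      have hUC : (Insertion.mk [] U s).Fits C := by
        refine ⟨hUne, hUsorted, hUlt, ?_, fun x hx => ?_⟩
        · simp only [hsupp]; tauto
        · rw [hsupp] at hx; exact hUc2 x hx
      refine ⟨⟨[], U, s⟩ :: C, ⟨hUC, hC⟩, leaf_cons.2 ⟨rfl, hCl⟩, by simp [hCm], ?_⟩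
      refine hrun.trans (run_congr hC fun x hx => ?_)
      have hxU := hUC.notMem hx
      rw [carrier_fixed] at hxU
      have hxp : x ≠ p := fun h => hxU (h ▸ hpU)
      simp only [step, weight_fixed]
      rw [map_update_of_notMem hsV, hq.map_update hUsorted hpU]
      · by_cases hxs : x = s
        · subst hxs
          simp [hxp, mul_assoc]
        · simp [hxs, hxp]
      · intro y hy
        rcases hVc1 y hy with h | h
        · exact h
        · have := h v hv; have := hUV v hv y hy; omega
    · by_cases hsV : s ∈ V
      · -- `U` directly follows the last position of `V`
        have hps := hVlt s hsV
        have hfit : (Insertion.mk [] V p).Fits (A ++ L) := by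
          refine ⟨hVne, hVsorted, hVlt, ?_, fun x hx => ?_⟩
          · simp only; tauto
          · exact hVc2 x hx
        obtain ⟨C, hC, hCl, hCm, hrun⟩ := ih hA.2 hleaf' hfit (Insertion.step F q ⟨[], U, s⟩ b)
        replace hsupp := hsupp C hCl hCm
        have hUC : (Insertion.mk [] U p).Fits C := by
          refine ⟨hUne, hUsorted, fun x hx => ?_, ?_, fun x hx => ?_⟩
          · have := hUlt x hx; simp only; omega
          · simp only [hsupp]; tauto
          · rw [hsupp] at hx
            rcases hUc2 x hx with h | h
            · rcases hVc2 x hx with h' | h'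
              · exact Or.inl h'
              · have := h' s hsV; omega
            · exact Or.inr h
        refine ⟨⟨[], U, p⟩ :: C, ⟨hUC, hC⟩, leaf_cons.2 ⟨rfl, hCl⟩, by simp [hCm], ?_⟩
        refine hrun.trans (run_congr hC fun x hx => ?_)
        have hxV : x ≠ s := fun h => by
          subst h
          rcases hx with hx | hx
          · omega
          · exact hfit.notMem (Or.inr ((hsupp x).1 hx)) hsV
        have hps' : p ≠ s := by omega
        simp only [step, weight_fixed]
        rw [map_update_of_notMem hpU, hq.map_update hVsorted hsV]
        · by_cases hxs : x = p
          · subst hxs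
            simp [hps', mul_assoc]
          · simp [hxs, hxV]
        · intro y hy
          rcases hUc1 y hy with h | h
          · exact h
          · have h1 := h u hu
            have h2 := hUlt u hu
            rcases hVc1 u hu with h' | h'
            · omega
            · have := h' y hy; omega
      -- If the two targets coincided, `U` and `V` would each have to lie entirely after the other.
      -- With distinct targets outside both blocks, the two insertions commute.
      · have hsp : s ≠ p := by
          rintro rfl
          have h1 := hVlt v hv
          have h2 := hUlt u hu
          rcases hUc1 v hv with h | h
          · omega
          · rcases hVc1 u hu with h' | h'
            · omega
            · have := h u hu; have := h' v hv; omega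
        have hfit : (Insertion.mk [] V p).Fits (A ++ L) := by
          refine ⟨hVne, hVsorted, hVlt, ?_, fun x hx => ?_⟩
          · simp only; tauto
          · exact hVc2 x hx
        obtain ⟨C, hC, hCl, hCm, hrun⟩ := ih hA.2 hleaf' hfit (Insertion.step F q ⟨[], U, s⟩ b)
        replace hsupp := hsupp C hCl hCm
        have hUC : (Insertion.mk [] U s).Fits C := by
          refine ⟨hUne, hUsorted, hUlt, ?_, fun x hx => ?_⟩
          · simp only [hsupp]; tauto
          · rw [hsupp] at hx; exact hUc2 x hx
        refine ⟨⟨[], U, s⟩ :: C, ⟨hUC, hC⟩, leaf_cons.2 ⟨rfl, hCl⟩, by simp [hCm], ?_⟩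
        refine hrun.trans ?_
        show _ = run F q C _ 0
        simp only [step, weight_fixed]
        rw [map_update_of_notMem hpU, map_update_of_notMem hsV, Function.update_of_ne hsp,
          Function.update_of_ne hsp.symm, Function.update_comm hsp]

/-- The result of a list of insertions depends only on the blocks. -/
lemma run_eq_of_perm (hq : RightLinear q) {L L' : List Insertion} (hL : Valid L) (hL' : Valid L')
    (hl : Leaf L) (hl' : Leaf L') (h : (L.map fixed).Perm (L'.map fixed)) (b : ℕ → B) :
    run F q L b 0 = run F q L' b 0 := by
  induction L' generalizing L b with
  | nil =>
    have : L = [] := by simpa using h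
    rw [this]
  | cons I L' ih =>
    obtain ⟨Ifree, V, p⟩ := I
    obtain ⟨hfree, hl''⟩ := leaf_cons.1 hl'
    simp only at hfree
    subst hfree
    have hmem : V ∈ L.map fixed := h.mem_iff.2 (by simp)
    obtain ⟨⟨Jf, W, r⟩, hJ, rfl⟩ := List.mem_map.1 hmem
    obtain ⟨A, D, rfl⟩ := List.append_of_mem hJ
    obtain ⟨hlA, hlD⟩ := leaf_append.1 hl
    obtain ⟨hJf, hlD'⟩ := leaf_cons.1 hlD
    simp only at hJf
    subst hJf
    have hperm : ((A ++ D).map fixed).Perm (L'.map fixed) := by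
      simp only [List.map_append, List.map_cons] at h ⊢
      exact List.Perm.cons_inv (List.perm_middle.symm.trans h)
    have hlAD : Leaf (A ++ D) := leaf_append.2 ⟨hlA, hlD'⟩
    have hfit : (Insertion.mk [] W p).Fits (A ++ D) := hL'.1.congr fun x => by
      rw [hlAD.supp_iff, hl''.supp_iff]
      simp only [hperm.mem_iff]
    obtain ⟨C, hC, hCl, hCm, hrun⟩ := exists_run_eq_step (F := F) hq hL hlAD hfit b
    exact hrun.trans (ih hC hL'.2 hCl hl'' (hCm ▸ hperm) _)

end Insertion

end Insertions

/-! ### Splitting the blocks of an insertion program -/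

section Refinement

variable {B : Type*} [Ring B]

/-- The set `σ` is a non-crossing partition of `{1, …, n}`. -/
structure NonCrossing (n : ℕ) (σ : Finset (Finset ℕ)) : Prop where
  nonempty : ∀ U ∈ σ, U.Nonempty
  cover : ∀ x, x ∈ Finset.Icc 1 n ↔ ∃ U ∈ σ, x ∈ U
  disjoint : ∀ U ∈ σ, ∀ V ∈ σ, ∀ x ∈ U, x ∈ V → U = V
  noncrossing : ∀ U ∈ σ, ∀ V ∈ σ, ∀ u₁ ∈ U, ∀ u₂ ∈ U, ∀ v₁ ∈ V, ∀ v₂ ∈ V,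
    u₁ < v₁ → v₁ < u₂ → u₂ < v₂ → U = V

open Classical in
/-- The non-crossing partitions of `{1, …, n}`. -/
noncomputable def ncFamilies (n : ℕ) : Finset (Finset (Finset ℕ)) :=
  (Finset.Icc 1 n).powerset.powerset.filter (NonCrossing n)

lemma mem_ncFamilies {n : ℕ} {σ : Finset (Finset ℕ)} : σ ∈ ncFamilies n ↔ NonCrossing n σ := by
  simp only [ncFamilies, Finset.mem_filter, Finset.mem_powerset, and_iff_right_iff_imp]
  intro h U hU
  rw [Finset.mem_powerset]
  exact fun x hx => (h.cover x).2 ⟨U, hU, hx⟩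

/-- Additivity of a function of lists in each entry. -/
def AdditiveInEntries (q : List B → B) : Prop :=
  ∀ (l₁ : List B) (x y : B) (l₂ : List B),
    q (l₁ ++ (x + y) :: l₂) = q (l₁ ++ x :: l₂) + q (l₁ ++ y :: l₂)

namespace Insertion

/-- The partition `σ` is finer than the one into `I.carrier` and its complement, and the block of
`σ` which contains the first element of `I.carrier` contains `I.fixed`. -/
structure Compat (σ : Finset (Finset ℕ)) (I : Insertion) : Prop where
  block : ∃ U ∈ σ, (∀ w ∈ I.fixed, w ∈ U) ∧ (∀ u ∈ U, u ∈ I.carrier) ∧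
    ∃ u ∈ U, ∀ v ∈ I.carrier, u ≤ v
  saturated : ∀ U ∈ σ, ∀ x ∈ U, x ∈ I.carrier → ∀ y ∈ U, y ∈ I.carrier

/-- Declare `I.free[i]` to be the last free position of the final block. -/
def split (I : Insertion) (i : Fin I.free.length) : List Insertion :=
  (if I.free.drop (i + 1) = [] then [] else [⟨I.free.drop (i + 1), [], I.free[i]⟩]) ++
    [⟨I.free.take i, I.free[i] :: I.fixed, I.pos⟩]

variable {F q : List B → B}

lemma split_eq_self (I : Insertion) (i : Fin I.free.length) :
    I.carrier = I.free.take i ++ I.free[i] :: I.free.drop (i + 1) ++ I.fixed := by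
  have := List.take_append_drop i I.free
  rw [List.drop_eq_getElem_cons i.2] at this
  rw [carrier]
  congr 1
  exact this.symm

lemma supp_split (I : Insertion) (i : Fin I.free.length) (x : ℕ) :
    Supp (I.split i) x ↔ x ∈ I.carrier := by
  rw [split_eq_self I i, split]
  generalize I.free.take i = v
  generalize I.free.drop (i + 1) = u
  by_cases h : u = []
  · simp [h, carrier]
  · simp only [h, if_false, List.cons_append, List.nil_append, supp_cons, carrier, supp_nil,
      List.append_nil, List.mem_append, List.mem_cons]
    tauto

/-- The free positions after `I.free[i]` lie between it and `I.fixed`, so they form an interval that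
can be evaluated first, with its value inserted right after `I.free[i]`. Removing positions from a
block does not disturb its fit with the later blocks. -/
lemma Fits.valid_split_append {I : Insertion} {L : List Insertion} (hI : I.Fits L) (hL : Valid L)
    (i : Fin I.free.length) : Valid (I.split i ++ L) := by
  have hc := split_eq_self I i
  have hs := hI.sorted
  have hp := hI.pos_lt
  have hm := hI.pos_mem
  have hx := hI.convex
  obtain ⟨S, W, p⟩ := I
  simp only at hc i hm hx hp
  set v := S.take i
  set z := S[i]
  set u := S.drop (i + 1)
  rw [hc] at hs hp hx
  have hzp : p < z := hp z (by simp)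
  have hvz : ∀ x ∈ v, x < z := by
    simp only [List.append_assoc, List.pairwise_append] at hs
    exact fun x hx => hs.2.2 x hx z (by simp)
  have hz : ∀ x ∈ u ++ W, z < x := by
    simp only [List.append_assoc, List.cons_append, List.pairwise_append, List.pairwise_cons] at hs
    intro x hx
    exact hs.2.1.1 x (by simpa using hx)
  have huW : ∀ x ∈ u, ∀ w ∈ W, x < w := by
    rw [List.pairwise_append] at hs
    exact fun x hx w hw => hs.2.2 x (by simp [hx]) w hw
  have hvzW : (Insertion.mk v (z :: W) p).Fits L := by
    refine ⟨by simp [carrier], ?_, fun x hx => hp x ?_, hm, fun x hxL => ?_⟩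
    · simp only [carrier, List.append_assoc, List.cons_append, List.pairwise_append,
        List.pairwise_cons] at hs ⊢
      refine ⟨hs.1, ⟨fun x hx => hz x (by simp [hx]), hs.2.1.2.2.1⟩, fun x hx y hy => ?_⟩
      exact hs.2.2 x hx y (by simp at hy ⊢; tauto)
    · simp [carrier] at hx ⊢; tauto
    · rcases hx x hxL with h | h
      · exact Or.inl h
      · exact Or.inr fun y hy => h y (by simp [carrier] at hy ⊢; tauto)
  unfold split
  simp only
  split_ifs with hu
  · exact ⟨hvzW, hL⟩
  · refine ⟨⟨by simpa [carrier] using hu, ?_, fun x hx => ?_, ?_, fun x hx' => ?_⟩, hvzW, hL⟩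
    · simp only [carrier, List.append_nil, List.append_assoc, List.cons_append,
        List.pairwise_append, List.pairwise_cons] at hs ⊢
      exact hs.2.1.2.1
    · simp only [carrier, List.append_nil] at hx
      exact hz x (List.mem_append_left _ hx)
    · right
      simp [carrier]
    · replace hx' : Supp (⟨v, z :: W, p⟩ :: L) x := hx'
      simp only [supp_cons, carrier, List.mem_append,
        List.mem_cons] at hx'
      simp only [carrier, List.append_nil]
      rcases hx' with (h | rfl | h) | h
      · exact Or.inl (hvz x h).le
      · exact Or.inl le_rfl
      · exact Or.inr fun y hy => huW y hy x h
      · rcases hx x h with h' | h'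
        · left; change x ≤ z; omega
        · exact Or.inr fun y hy => h' y (by simp [u, hy])

/-- The value of a block is the sum over the choices of the last free position of the final
block. -/
lemma weight_eq_sum {I : Insertion} (hI : I.free ≠ []) (hs : I.carrier.Pairwise (· < ·))
    (b : ℕ → B) :
    I.weight F q b = ∑ i : Fin I.free.length,
      (Insertion.mk (I.free.take i) (I.free[i] :: I.fixed) I.pos).weight F q
        (Function.update b I.free[i] (b I.free[i] * F ((I.free.drop (i + 1)).map b))) := by
  unfold weight
  rw [peelSum_of_ne_nil _ _ (by simpa using hI)]
  refine Fintype.sum_equiv (finCongr (by simp)) _ _ fun i => ?_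
  have hi : (i : ℕ) < I.free.length := by simpa using i.2
  rw [split_eq_self I ⟨i, hi⟩] at hs
  have hv : I.free[(i : ℕ)] ∉ I.free.take i := fun h => by
    simp only [List.append_assoc, List.pairwise_append] at hs
    exact lt_irrefl _ (hs.2.2 _ h _ (List.mem_append_left _ List.mem_cons_self))
  have hW : I.free[(i : ℕ)] ∉ I.fixed := fun h => by
    simp only [List.pairwise_append] at hs
    exact lt_irrefl _ (hs.2.2 _ (List.mem_append_right _ List.mem_cons_self) _ h)
  simp [map_update_of_notMem hv, map_update_of_notMem hW, List.map_drop, List.map_take]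

/-- An empty gap receives no insertion, which is harmless because `F [] = 1`. A nonempty gap is
entirely free, so by `hFq` its weight is `F` of its entries. -/
lemma run_split (hF : F [] = 1) (hFq : ∀ l, l ≠ [] → F l = peelSum F q l []) (I : Insertion)
    (i : Fin I.free.length) (b : ℕ → B) :
    run F q (I.split i) b =
      (Insertion.mk (I.free.take i) (I.free[i] :: I.fixed) I.pos).step F q
        (Function.update b I.free[i] (b I.free[i] * F ((I.free.drop (i + 1)).map b))) := by
  unfold split
  split_ifs with hu
  · simp [run, hu, hF]
  · simp only [List.cons_append, List.nil_append, run]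
    congr 1
    rw [step]
    congr 2
    rw [weight, hFq _ (by simpa using hu)]
    simp

/-- Each entry enters the result linearly: it is read once, by `q` on its own block or as the output
at `0`, possibly after factors were attached to it on the right. All blocks are final because
additivity is assumed for `q` only, not for the weight of an unexpanded block. -/
lemma run_update_add (hq : AdditiveInEntries q) {L : List Insertion} (hL : Valid L)
    (hl : Leaf L) {p : ℕ} (hp : p = 0 ∨ Supp L p) (b : ℕ → B) (x y : B) :
    run F q L (Function.update b p (x + y)) 0 =
      run F q L (Function.update b p x) 0 + run F q L (Function.update b p y) 0 := by
  induction L generalizing b p x y with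
  | nil =>
    have : p = 0 := by simpa using hp
    subst this
    simp [run]
  | cons I L ih =>
    obtain ⟨If, V, s⟩ := I
    obtain ⟨hIf, hl'⟩ := leaf_cons.1 hl
    simp only at hIf
    subst hIf
    have hfit := hL.1
    simp only [run, step, weight_fixed]
    by_cases hpV : p ∈ V
    · have hps : s ≠ p := (hfit.pos_lt p hpV).ne
      have hpL : ∀ z, z = 0 ∨ Supp L z → z ≠ p := fun z hz h => hfit.notMem hz (h ▸ hpV)
      -- Once the block of `p` is evaluated, the entry at `p` matters only through the inserted
      -- value.
      have key : ∀ x, run F q L (Function.update (Function.update b p x) s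
          (b s * q (V.map (Function.update b p x)))) 0 =
          run F q L (Function.update b s (b s * q (V.map (Function.update b p x)))) 0 := by
        refine fun x => run_congr hL.2 fun z hz => ?_
        by_cases hzs : z = s
        · subst hzs; simp
        · simp [hzs, hpL z hz]
      simp only [Function.update_of_ne hps, key]
      rw [← ih hL.2 hl' hfit.pos_mem]
      congr 2
      rw [← mul_add]
      congr 1
      have hs := hfit.sorted
      rw [carrier_fixed] at hs
      obtain ⟨l, l', rfl⟩ := List.append_of_mem hpV
      rw [List.pairwise_append, List.pairwise_cons] at hs
      have h1 : p ∉ l := fun h => lt_irrefl _ (hs.2.2 p h p (by simp))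
      have h2 : p ∉ l' := fun h => lt_irrefl _ (hs.2.1.1 p h)
      simp only [List.map_append, List.map_cons, map_update_of_notMem h1,
        map_update_of_notMem h2, Function.update_self]
      exact hq _ _ _ _
    · have hp' : p = 0 ∨ Supp L p := by
        simpa [carrier_fixed, hpV] using hp
      simp only [map_update_of_notMem hpV]
      by_cases hps : p = s
      · subst hps
        simp only [Function.update_self, Function.update_idem, add_mul]
        exact ih hL.2 hl' hp' b _ _
      · have hsp : s ≠ p := Ne.symm hps
        simp only [Function.update_of_ne hsp, Function.update_comm hps]
        exact ih hL.2 hl' hp' _ _ _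

lemma run_update_sum (hq : AdditiveInEntries q) {L : List Insertion} (hL : Valid L)
    (hl : Leaf L) {p : ℕ} (hp : p = 0 ∨ Supp L p) (b : ℕ → B) {ι : Type*} (s : Finset ι)
    (f : ι → B) :
    run F q L (Function.update b p (∑ i ∈ s, f i)) 0 =
      ∑ i ∈ s, run F q L (Function.update b p (f i)) 0 :=
  map_sum (AddMonoidHom.mk' (fun x => run F q L (Function.update b p x) 0)
    (run_update_add hq hL hl hp b)) f s

/-- Expansion of the first block of a list all of whose other blocks are final. -/
lemma run_cons_eq_sum (hF : F [] = 1) (hFq : ∀ l, l ≠ [] → F l = peelSum F q l [])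
    (hq : AdditiveInEntries q) {I : Insertion} {L : List Insertion} (hI : I.Fits L) (hL : Valid L)
    (hl : Leaf L) (hfree : I.free ≠ []) (b : ℕ → B) :
    run F q (I :: L) b 0 = ∑ i : Fin I.free.length, run F q (I.split i ++ L) b 0 := by
  rw [run, step, weight_eq_sum hfree hI.sorted, Finset.mul_sum,
    run_update_sum hq hL hl hI.pos_mem]
  refine Finset.sum_congr rfl fun i _ => ?_
  rw [run_append, run_split hF hFq]
  refine run_congr hL fun x hx => ?_
  have hmem : I.free[i] ∈ I.carrier := List.mem_append_left _ (List.getElem_mem _)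
  have hpos := hI.pos_lt _ hmem
  have hx' : x ≠ I.free[i] := fun h => hI.notMem hx (h ▸ hmem)
  rw [step]
  by_cases hxp : x = I.pos
  · subst hxp
    rw [Function.update_self, Function.update_self, Function.update_of_ne hx']
  · rw [Function.update_of_ne hxp, Function.update_of_ne hxp, Function.update_of_ne hx']

end Insertion

end Refinement

/-! ### Each compatible partition selects exactly one split -/

section RefinementTheorem

variable {B : Type*} [Ring B]

namespace Insertion

variable {F q : List B → B} {n : ℕ} {σ : Finset (Finset ℕ)}

lemma Compat.of_split {I : Insertion} (hs : I.carrier.Pairwise (· < ·)) (i : Fin I.free.length)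
    (h : ∀ J ∈ I.split i, Compat σ J) : Compat σ I := by
  have hc := split_eq_self I i
  have h1 : Compat σ ⟨I.free.take i, I.free[i] :: I.fixed, I.pos⟩ := h _ (by simp [split])
  have h2 : ∀ U ∈ σ, ∀ x ∈ U, x ∈ I.free.drop (i + 1) → ∀ y ∈ U, y ∈ I.free.drop (i + 1) := by
    intro U hU x hx hxu y hy
    have h3 : Compat σ ⟨I.free.drop (i + 1), [], I.free[i]⟩ := by
      refine h _ ?_
      have : I.free.drop (i + 1) ≠ [] := List.ne_nil_of_mem hxu
      simp [split, this]
    simpa [carrier] using h3.saturated U hU x hx (by simpa [carrier] using hxu) y hy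
  obtain ⟨U, hU, hWU, hUW, t, ht, htmin⟩ := h1.block
  have h4 := h1.saturated
  simp only [carrier] at hUW htmin h4
  rw [hc] at hs
  generalize I.free.take i = v at *
  generalize I.free.drop (i + 1) = u at *
  generalize hz : I.free[i] = z at *
  refine ⟨⟨U, hU, fun w hw => hWU w (List.mem_cons_of_mem _ hw), fun x hx => ?_, t, ht, ?_⟩, ?_⟩
  · rw [hc]
    have := hUW x hx
    simp only [List.mem_append, List.mem_cons] at this ⊢
    tauto
  · rw [hc]
    intro y hy
    by_cases hyu : y ∈ u
    · have h5 := htmin z (by simp)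
      simp only [List.append_assoc, List.cons_append, List.pairwise_append,
        List.pairwise_cons] at hs
      have := hs.2.1.1 y (by simp [hyu])
      omega
    · refine htmin y ?_
      simp only [List.mem_append, List.mem_cons] at hy ⊢
      tauto
  · intro V hV x hx hxc y hy
    rw [hc] at hxc ⊢
    by_cases hxu : x ∈ u
    · have := h2 V hV x hx hxu y hy
      simp [this]
    · have := h4 V hV x hx (by
        simp only [List.mem_append, List.mem_cons] at hxc ⊢
        tauto) y hy
      simp only [List.mem_append, List.mem_cons] at this ⊢
      tauto

/-- The block `U` of `σ` through the first position of `I` has to become the final block, so `i`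
must be the index of the last free position in `U`. Non-crossing is what makes the gap after it a
union of blocks of `σ`. -/
lemma Compat.exists_split (hσ : NonCrossing n σ) {I : Insertion}
    (hs : I.carrier.Pairwise (· < ·)) (hI : I.free ≠ [])
    (hn : ∀ x ∈ I.carrier, x ∈ Finset.Icc 1 n) (h : Compat σ I) :
    ∃ i : Fin I.free.length, (∀ J ∈ I.split i, Compat σ J) ∧
      ∀ j : Fin I.free.length, (∀ J ∈ I.split j, Compat σ J) → j = i := by
  classical
  obtain ⟨U, hU, hWU, hUc, t, htU, htmin⟩ := h.block
  have hsf : I.free.Pairwise (· < ·) := (List.pairwise_append.1 hs).1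
  have hmono : ∀ i j : Fin I.free.length, i < j → I.free[i] < I.free[j] := fun i j hij =>
    List.pairwise_iff_getElem.1 hsf i j i.2 j.2 hij
  -- the first free position belongs to `U`
  have hlen : 0 < I.free.length := List.length_pos_iff.2 hI
  have hhead : t = I.free[0] := by
    have h0 : I.free[0] ∈ I.carrier := List.mem_append_left _ (List.getElem_mem _)
    refine le_antisymm (htmin _ h0) ?_
    obtain ⟨y, l, hl⟩ : ∃ y l, I.free = y :: l := List.exists_cons_of_ne_nil hI
    have htc := hUc t htU
    have hs' := hs
    rw [carrier, hl, List.cons_append] at htc hs'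
    rcases List.mem_cons.1 htc with rfl | h'
    · simp [hl]
    · simpa [hl] using ((List.pairwise_cons.1 hs').1 t h').le
  let T : Finset (Fin I.free.length) := Finset.univ.filter fun i => I.free[i] ∈ U
  have hT : T.Nonempty := ⟨⟨0, hlen⟩, by simpa [T, ← hhead] using htU⟩
  set i := T.max' hT with hi
  have hiU : I.free[i] ∈ U := (Finset.mem_filter.1 (T.max'_mem hT)).2
  have himax : ∀ j : Fin I.free.length, I.free[j] ∈ U → j ≤ i := fun j hj =>
    T.le_max' j (by simpa [T] using hj)
  have hc := split_eq_self I i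
  have hu : ∀ x ∈ I.free.drop (i + 1), x ∉ U := by
    intro x hx hxU
    obtain ⟨k, hk, rfl⟩ := List.mem_iff_getElem.1 hx
    rw [List.getElem_drop] at hxU
    have hk' : (i : ℕ) + 1 + k < I.free.length := by rw [List.length_drop] at hk; omega
    have := himax ⟨i + 1 + k, hk'⟩ hxU
    rw [Fin.le_def] at this
    simp only at this
    omega
  refine ⟨i, ?_, ?_⟩
  · have hsat := h.saturated
    -- positions in order
    have hs' := hs
    rw [hc] at hs' hUc htmin hsat
    have hfixed : (∀ x ∈ I.free.take i, x < I.free[i]) ∧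
        (∀ x ∈ I.free.drop (i + 1), I.free[i] < x) ∧
        (∀ x ∈ I.free.drop (i + 1), x ∉ I.free.take i ∧ x ≠ I.free[i] ∧ x ∉ I.fixed) := by
      generalize I.free.take i = v at *
      generalize I.free.drop (i + 1) = u at *
      generalize I.free[i] = z at *
      simp only [List.append_assoc, List.cons_append, List.pairwise_append,
        List.pairwise_cons] at hs'
      refine ⟨fun x hx => hs'.2.2 x hx z (by simp), fun x hx => hs'.2.1.1 x (by simp [hx]),
        fun x hx => ⟨fun h => ?_, fun h => ?_, fun h => ?_⟩⟩
      · exact lt_irrefl _ (hs'.2.2 x h x (by simp [hx]))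
      · exact lt_irrefl _ (h ▸ hs'.2.1.1 x (by simp [hx]))
      · exact lt_irrefl _ (hs'.2.1.2.2.2 x hx x h)
    obtain ⟨hv, hzu, hdisj⟩ := hfixed
    -- A block containing `x` in the gap and `y` among the earlier free positions would cross `U`,
    -- since `t < y < I.free[i] < x` with `t` and `I.free[i]` in `U`.
    have hgap : ∀ V ∈ σ, ∀ x ∈ V, x ∈ I.free.drop (i + 1) → ∀ y ∈ V, y ∈ I.free.drop (i + 1) := by
      intro V hV x hx hxu y hy
      have hVU : V ≠ U := fun h => hu x hxu (h ▸ hx)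
      have hyU : y ∉ U := fun h => hVU (hσ.disjoint V hV U hU y hy h)
      have hyc := hsat V hV x hx (List.mem_append_left _
        (List.mem_append_right _ (List.mem_cons_of_mem _ hxu))) y hy
      have hxz := hzu x hxu
      simp only [List.mem_append, List.mem_cons] at hyc
      rcases hyc with (hyv | rfl | hyu) | hyW
      · exfalso
        have h1 := htmin y (List.mem_append_left _ (List.mem_append_left _ hyv))
        have h2 := hv y hyv
        have h3 : t ≠ y := fun h => hyU (h ▸ htU)
        exact hVU (hσ.noncrossing U hU V hV t htU _ hiU y hy x hx (by omega) h2 hxz).symm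
      · exact absurd hiU hyU
      · exact hyu
      · exact absurd (hWU y hyW) hyU
    have hmain : Compat σ ⟨I.free.take i, I.free[i] :: I.fixed, I.pos⟩ := by
      refine ⟨⟨U, hU, ?_, fun x hx => ?_, t, htU, fun y hy => htmin y ?_⟩, ?_⟩
      · intro w hw
        rcases List.mem_cons.1 hw with rfl | hw
        · exact hiU
        · exact hWU w hw
      · have h1 := hUc x hx
        have h2 : x ∉ I.free.drop (i + 1) := fun h => hu x h hx
        simp only [carrier, List.mem_append, List.mem_cons] at h1 ⊢
        tauto
      · simp only [carrier, List.mem_append, List.mem_cons] at hy ⊢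
        tauto
      · intro V hV x hx hxc y hy
        have h1 := hsat V hV x hx (by
          simp only [carrier, List.mem_append, List.mem_cons] at hxc ⊢
          tauto) y hy
        have h2 : y ∉ I.free.drop (i + 1) := fun h => by
          have h3 := hdisj x (hgap V hV y hy h x hx)
          simp only [carrier, List.mem_append, List.mem_cons] at hxc
          tauto
        simp only [carrier, List.mem_append, List.mem_cons] at h1 ⊢
        tauto
    intro J hJ
    unfold split at hJ
    split_ifs at hJ with hnil
    · simp only [List.nil_append, List.mem_singleton] at hJ
      exact hJ ▸ hmain
    · simp only [List.cons_append, List.nil_append, List.mem_cons, List.not_mem_nil,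
        or_false] at hJ
      rcases hJ with rfl | rfl
      · obtain ⟨x, l, hxl⟩ := List.exists_cons_of_ne_nil hnil
        have hxu : x ∈ I.free.drop (i + 1) := by simp [hxl]
        have hxn : x ∈ Finset.Icc 1 n := by
          refine hn x ?_
          rw [hc]
          exact List.mem_append_left _ (List.mem_append_right _ (List.mem_cons_of_mem _ hxu))
        obtain ⟨V, hV, hxV⟩ := (hσ.cover x).1 hxn
        refine ⟨⟨V, hV, by simp, fun y hy => ?_, x, hxV, fun y hy => ?_⟩, ?_⟩
        · simpa [carrier] using hgap V hV x hxV hxu y hy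
        · simp only [carrier, List.append_nil, hxl] at hy
          have h5 : (x :: l).Pairwise (· < ·) := hxl ▸ hsf.drop
          rcases List.mem_cons.1 hy with rfl | hy
          · exact le_rfl
          · exact ((List.pairwise_cons.1 h5).1 y hy).le
        · simpa [carrier] using hgap
      · exact hmain
  · intro j hj
    have h1 : Compat σ ⟨I.free.take j, I.free[j] :: I.fixed, I.pos⟩ := hj _ (by simp [split])
    obtain ⟨V, hV, hWV, hVc, s, hsV, hsmin⟩ := h1.block
    simp only [carrier] at hVc hsmin
    -- The final blocks of the two splits share the smallest position of `I`, so they are the same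
    -- block of `σ`. If `j < i`, the position `I.free[i]` of this block would have been split off
    -- into the gap.
    have hst : s = t := by
      refine le_antisymm (hsmin t ?_) (htmin s ?_)
      · rw [hhead]
        rcases Nat.eq_zero_or_pos (j : ℕ) with h0 | h0
        · simp [h0]
        · refine List.mem_append_left _ (List.mem_iff_getElem.2 ⟨0, ?_, ?_⟩)
          · rw [List.length_take]; omega
          · rw [List.getElem_take]
      · have h2 := hVc s hsV
        rw [split_eq_self I j]
        simp only [List.mem_append, List.mem_cons] at h2 ⊢
        tauto
    have hVU : V = U := hσ.disjoint V hV U hU t (hst ▸ hsV) htU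
    subst hVU
    refine le_antisymm (himax j (hWV _ (by simp))) (le_of_not_gt fun hji => ?_)
    have h2 := hVc _ hiU
    rcases List.mem_append.1 h2 with h3 | h3
    · obtain ⟨k, hk, hk'⟩ := List.mem_iff_getElem.1 h3
      rw [List.length_take] at hk
      rw [List.getElem_take] at hk'
      have hkl : k < I.free.length := by omega
      have := hmono ⟨k, hkl⟩ i (by rw [Fin.lt_def] at hji ⊢; simp only; omega)
      exact this.ne hk'
    · rcases List.mem_cons.1 h3 with h3 | h3
      · exact (hmono j i hji).ne' h3
      · exact lt_irrefl _ ((List.pairwise_append.1 hs).2.2 _ (List.getElem_mem i.2) _ h3)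

end Insertion

end RefinementTheorem

/-! ### Values of non-crossing partitions and expansion of a program over them -/

section LeafValue

variable {B : Type*} [Ring B]

namespace Insertion

variable {F q : List B → B} {n : ℕ} {σ : Finset (Finset ℕ)}

/-- The set of the blocks of a list of insertions. -/
def blockSet (L : List Insertion) : Finset (Finset ℕ) := (L.map fun I => I.carrier.toFinset).toFinset

lemma mem_blockSet {L : List Insertion} {U : Finset ℕ} :
    U ∈ blockSet L ↔ ∃ I ∈ L, I.carrier.toFinset = U := by simp [blockSet]

lemma Leaf.carrier_eq {L : List Insertion} (hl : Leaf L) {I : Insertion} (hI : I ∈ L) :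
    I.carrier = I.fixed := by simp [carrier, hl I hI]

lemma Valid.fits_of_mem {L : List Insertion} (hL : Valid L) {I : Insertion} (hI : I ∈ L) :
    I.carrier ≠ [] ∧ I.carrier.Pairwise (· < ·) := by
  induction L with
  | nil => simp at hI
  | cons J L ih =>
    rcases List.mem_cons.1 hI with rfl | hI
    · exact ⟨hL.1.ne_nil, hL.1.sorted⟩
    · exact ih hL.2 hI

/-- Two blocks are equal, or one of them lies in a gap of the other one. -/
lemma Valid.separated {L : List Insertion} (hL : Valid L) {I J : Insertion} (hI : I ∈ L)
    (hJ : J ∈ L) : I = J ∨ (∀ x ∈ J.carrier, (∀ v ∈ I.carrier, x < v) ∨ ∀ v ∈ I.carrier, v < x) ∨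
      ∀ x ∈ I.carrier, (∀ v ∈ J.carrier, x < v) ∨ ∀ v ∈ J.carrier, v < x := by
  have key : ∀ {K : Insertion} {L : List Insertion}, K.Fits L → ∀ {J}, J ∈ L →
      ∀ x ∈ J.carrier, (∀ v ∈ K.carrier, x < v) ∨ ∀ v ∈ K.carrier, v < x := by
    intro K L hK J hJ x hx
    rcases hK.convex x ⟨J, hJ, hx⟩ with h | h
    · exact Or.inl fun v hv => h.trans_lt (hK.pos_lt v hv)
    · exact Or.inr h
  induction L with
  | nil => simp at hI
  | cons K L ih =>
    rcases List.mem_cons.1 hI with hI' | hI' <;> rcases List.mem_cons.1 hJ with hJ' | hJ'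
    · exact Or.inl (hI'.trans hJ'.symm)
    · exact Or.inr (Or.inl (hI' ▸ key hL.1 hJ'))
    · exact Or.inr (Or.inr (hJ' ▸ key hL.1 hI'))
    · exact ih hL.2 hI' hJ'

lemma Valid.nonCrossing_blockSet {L : List Insertion} (hL : Valid L)
    (hn : ∀ x, x ∈ Finset.Icc 1 n ↔ Supp L x) : NonCrossing n (blockSet L) := by
  refine ⟨?_, ?_, ?_, ?_⟩
  · intro U hU
    obtain ⟨I, hI, rfl⟩ := mem_blockSet.1 hU
    simpa using (hL.fits_of_mem hI).1
  · intro x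
    rw [hn, Supp]
    simp [mem_blockSet]
  · intro U hU V hV x hx hx'
    obtain ⟨I, hI, rfl⟩ := mem_blockSet.1 hU
    obtain ⟨J, hJ, rfl⟩ := mem_blockSet.1 hV
    rw [List.mem_toFinset] at hx hx'
    rcases hL.separated hI hJ with rfl | h | h
    · rfl
    · rcases h x hx' with h | h <;> exact absurd (h x hx) (lt_irrefl _)
    · rcases h x hx with h | h <;> exact absurd (h x hx') (lt_irrefl _)
  · intro U hU V hV u₁ h1 u₂ h2 v₁ h3 v₂ h4 h12 h23 h34
    obtain ⟨I, hI, rfl⟩ := mem_blockSet.1 hU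
    obtain ⟨J, hJ, rfl⟩ := mem_blockSet.1 hV
    rw [List.mem_toFinset] at h1 h2 h3 h4
    rcases hL.separated hI hJ with rfl | h | h
    · rfl
    · rcases h v₁ h3 with h | h
      · have := h u₁ h1; omega
      · have := h u₂ h2; omega
    · rcases h u₂ h2 with h | h
      · have := h v₁ h3; omega
      · have := h v₂ h4; omega

lemma Valid.nodup_map_fixed {L : List Insertion} (hL : Valid L) (hl : Leaf L) :
    (L.map fixed).Nodup := by
  induction L with
  | nil => simp
  | cons I L ih =>
    obtain ⟨hI, hl'⟩ := leaf_cons.1 hl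
    rw [List.map_cons, List.nodup_cons]
    refine ⟨fun h => ?_, ih hL.2 hl'⟩
    have hc : I.carrier = I.fixed := by simp [carrier, hI]
    obtain ⟨x, hx⟩ := List.exists_mem_of_ne_nil _ hL.1.ne_nil
    exact hL.1.notMem (Or.inr ((hl'.supp_iff x).2 ⟨_, h, hc ▸ hx⟩)) hx

lemma run_eq_of_blockSet_eq (hq : RightLinear q) {L L' : List Insertion} (hL : Valid L)
    (hL' : Valid L') (hl : Leaf L) (hl' : Leaf L') (h : blockSet L = blockSet L') (b : ℕ → B) :
    run F q L b 0 = run F q L' b 0 := by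
  have key : ∀ {L L' : List Insertion}, Valid L → Valid L' → Leaf L → Leaf L' →
      blockSet L = blockSet L' → ∀ W, W ∈ L.map fixed → W ∈ L'.map fixed := by
    intro L L' hL hL' hl hl' h W hW
    obtain ⟨I, hI, rfl⟩ := List.mem_map.1 hW
    obtain ⟨J, hJ, hJI⟩ := mem_blockSet.1 (h ▸ mem_blockSet.2 ⟨I, hI, rfl⟩)
    refine List.mem_map.2 ⟨J, hJ, ?_⟩
    rw [← hl.carrier_eq hI, ← hl'.carrier_eq hJ]
    refine (hL'.fits_of_mem hJ).2.eq_of_mem_iff (hL.fits_of_mem hI).2 fun a => ?_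
    simpa using congrArg (a ∈ ·) hJI
  refine run_eq_of_perm hq hL hL' hl hl' ?_ b
  rw [List.perm_ext_iff_of_nodup (hL.nodup_map_fixed hl) (hL'.nodup_map_fixed hl')]
  exact fun W => ⟨key hL hL' hl hl' h W, key hL' hL hl' hl h.symm W⟩

open Classical in
/-- The value of a non-crossing partition: the result of any list of insertions with these
blocks. -/
noncomputable def leafValue (F q : List B → B) (b : ℕ → B) (σ : Finset (Finset ℕ)) : B :=
  if h : ∃ L, Valid L ∧ Leaf L ∧ blockSet L = σ then run F q h.choose b 0 else 0

lemma leafValue_blockSet (hq : RightLinear q) {L : List Insertion} (hL : Valid L) (hl : Leaf L)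
    (b : ℕ → B) : leafValue F q b (blockSet L) = run F q L b 0 := by
  have h : ∃ L', Valid L' ∧ Leaf L' ∧ blockSet L' = blockSet L := ⟨L, hL, hl, rfl⟩
  rw [leafValue, dif_pos h]
  have hs := h.choose_spec
  exact run_eq_of_blockSet_eq hq hs.1 hL hs.2.1 hl hs.2.2 b

/-- With nothing left free, compatibility sandwiches a block of `σ` between `fixed` and `carrier`,
so every carrier is a block of `σ`. The carriers cover `{1, …, n}`, which leaves no room for further
blocks. -/
lemma Leaf.compat_iff {L : List Insertion} (hL : Valid L) (hl : Leaf L)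
    (hn : ∀ x, x ∈ Finset.Icc 1 n ↔ Supp L x) (hσ : NonCrossing n σ) :
    (∀ I ∈ L, Compat σ I) ↔ σ = blockSet L := by
  constructor
  · intro h
    have h1 : ∀ I ∈ L, I.carrier.toFinset ∈ σ := by
      intro I hI
      obtain ⟨U, hU, hWU, hUW, -⟩ := (h I hI).block
      have : I.carrier.toFinset = U := by
        ext x
        rw [List.mem_toFinset]
        refine ⟨fun hx => hWU x (hl.carrier_eq hI ▸ hx), hUW x⟩
      exact this ▸ hU
    ext U
    rw [mem_blockSet]
    constructor
    · intro hU
      obtain ⟨x, hx⟩ := hσ.nonempty U hU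
      obtain ⟨I, hI, hxI⟩ := (hn x).1 ((hσ.cover x).2 ⟨U, hU, hx⟩)
      exact ⟨I, hI, hσ.disjoint _ (h1 I hI) U hU x (by simpa using hxI) hx⟩
    · rintro ⟨I, hI, rfl⟩
      exact h1 I hI
  · rintro rfl I hI
    have hmem : I.carrier.toFinset ∈ blockSet L := mem_blockSet.2 ⟨I, hI, rfl⟩
    obtain ⟨hne, hs⟩ := hL.fits_of_mem hI
    refine ⟨⟨_, hmem, fun w hw => ?_, fun u hu => by simpa using hu, ?_⟩, ?_⟩
    · simpa [hl.carrier_eq hI] using hw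
    · obtain ⟨y, l, hyl⟩ := List.exists_cons_of_ne_nil hne
      refine ⟨y, by simp [hyl], fun v hv => ?_⟩
      rw [hyl] at hv hs
      rcases List.mem_cons.1 hv with rfl | hv
      · exact le_rfl
      · exact ((List.pairwise_cons.1 hs).1 v hv).le
    · intro U hU x hx hxI y hy
      have := hσ.disjoint U hU _ hmem x hx (by simpa using hxI)
      rw [this] at hy
      simpa using hy

/-- The number of free positions. -/
def freeCount (L : List Insertion) : ℕ := (L.map fun I => I.free.length).sum

lemma freeCount_split_lt (I : Insertion) (i : Fin I.free.length) :
    freeCount (I.split i) < I.free.length := by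
  unfold split freeCount
  split_ifs with h
  · simp
  · simp; omega

/-- Choosing the last block that is not final leaves a final tail, the situation in which
`run_cons_eq_sum` applies. -/
lemma exists_eq_append_of_not_leaf {L : List Insertion} (h : ¬ Leaf L) :
    ∃ A I D, L = A ++ I :: D ∧ I.free ≠ [] ∧ Leaf D := by
  induction L with
  | nil => exact absurd (by simp [Leaf]) h
  | cons I L ih =>
    by_cases hL : Leaf L
    · exact ⟨[], I, L, rfl, fun hI => h (leaf_cons.2 ⟨hI, hL⟩), hL⟩
    · obtain ⟨A, J, D, rfl, h1, h2⟩ := ih hL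
      exact ⟨I :: A, J, D, rfl, h1, h2⟩

lemma Valid.append_congr {A L L' : List Insertion} (h : Valid (A ++ L)) (hL' : Valid L')
    (hs : ∀ x, Supp L x ↔ Supp L' x) : Valid (A ++ L') := by
  induction A with
  | nil => exact hL'
  | cons I A ih =>
    exact ⟨Fits.congr (L := A ++ L) (L' := A ++ L') h.1 fun x => by
      rw [supp_append, supp_append, hs], ih h.2⟩

open Classical in
/-- The result of a list of insertions is the sum of the values of all non-crossing partitions
which are compatible with it. -/
theorem run_eq_sum_leafValue (hF : F [] = 1) (hFq : ∀ l, l ≠ [] → F l = peelSum F q l [])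
    (hq : AdditiveInEntries q) (hq' : RightLinear q) {L : List Insertion} (hL : Valid L)
    (hn : ∀ x, x ∈ Finset.Icc 1 n ↔ Supp L x) (b : ℕ → B) :
    run F q L b 0 =
      ∑ σ ∈ ncFamilies n, if ∀ I ∈ L, Compat σ I then leafValue F q b σ else 0 := by
  -- Each split turns exactly one free position into a fixed one, so `freeCount` drops.
  induction hk : freeCount L using Nat.strong_induction_on generalizing L with
  | _ k ih =>
    by_cases hl : Leaf L
    · rw [Finset.sum_eq_single (blockSet L)]
      · have hnc := hL.nonCrossing_blockSet hn
        rw [if_pos ((Leaf.compat_iff hL hl hn hnc).2 rfl), leafValue_blockSet hq' hL hl]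
      · intro σ hσ hne
        rw [if_neg]
        rwa [Leaf.compat_iff hL hl hn (mem_ncFamilies.1 hσ)]
      · exact fun h => absurd (mem_ncFamilies.2 (hL.nonCrossing_blockSet hn)) h
    · obtain ⟨A, I, D, rfl, hI, hD⟩ := exists_eq_append_of_not_leaf hl
      have hID := hL.of_append
      have hfit := hID.1
      have hsplit := fun i => hfit.valid_split_append hID.2 i
      have hsupp : ∀ i x, Supp (I :: D) x ↔ Supp (I.split i ++ D) x := fun i x => by
        rw [supp_cons, supp_append, supp_split]
      have hmemI : ∀ x ∈ I.carrier, x ∈ Finset.Icc 1 n := fun x hx => by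
        rw [hn]; simp [hx]
      have hstep : ∀ i, run F q (A ++ (I.split i ++ D)) b 0 =
          ∑ σ ∈ ncFamilies n, if ∀ J ∈ A ++ (I.split i ++ D), Compat σ J
            then leafValue F q b σ else 0 := fun i => by
        refine ih _ ?_ (hL.append_congr (hsplit i) (hsupp i)) (fun x => ?_) rfl
        · have := freeCount_split_lt I i
          simp only [freeCount, List.map_append, List.sum_append, List.map_cons,
            List.sum_cons] at this hk ⊢
          omega
        · rw [hn, supp_append, supp_append, hsupp i]
      rw [run_append, run_cons_eq_sum hF hFq hq hfit hID.2 hD hI]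
      simp only [← run_append, hstep]
      -- For fixed `σ`, exactly one split of `I` is compatible with `σ` if `I` is, and none
      -- otherwise; the inner sum has at most one nonzero term.
      rw [Finset.sum_comm]
      refine Finset.sum_congr rfl fun σ hσ => ?_
      have hσ' := mem_ncFamilies.1 hσ
      by_cases hc : ∀ J ∈ A ++ I :: D, Compat σ J
      · rw [if_pos hc]
        obtain ⟨i, hi, hiu⟩ := Compat.exists_split hσ' hfit.sorted hI hmemI (hc I (by simp))
        rw [Finset.sum_eq_single i]
        · rw [if_pos]
          intro J hJ
          simp only [List.mem_append] at hJ
          rcases hJ with hJ | hJ | hJ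
          · exact hc J (by simp [hJ])
          · exact hi J hJ
          · exact hc J (by simp [hJ])
        · intro j _ hj
          rw [if_neg]
          exact fun h => hj (hiu j fun J hJ => h J (by simp [hJ]))
        · simp
      · rw [if_neg hc]
        refine Finset.sum_eq_zero fun i _ => ?_
        rw [if_neg]
        refine fun h => hc fun J hJ => ?_
        simp only [List.mem_append, List.mem_cons] at hJ
        rcases hJ with hJ | rfl | hJ
        · exact h J (by simp [hJ])
        · exact Compat.of_split hfit.sorted i fun K hK => h K (by simp [hK])
        · exact h J (by simp [hJ])

end Insertion

end LeafValue

/-! ### From the blocks of a bi-non-crossing partition to an insertion program -/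

section BlockList

/-- An enumeration of the positions by `1, …, n` which is increasing for the order `≺_χ`. -/
structure IsRank {n : ℕ} (χ : Fin n → Side) (ρ : Fin n → ℕ) : Prop where
  injective : Function.Injective ρ
  range : ∀ x, x ∈ Finset.Icc 1 n ↔ ∃ i, ρ i = x
  lt_iff : ∀ i j, ChiLT χ i j ↔ ρ i < ρ j
  sorted : (chiOrder χ).Pairwise fun i j => ρ i < ρ j
  mem : ∀ i, i ∈ chiOrder χ

variable {n : ℕ} {χ : Fin n → Side} {ρ : Fin n → ℕ}

lemma IsRank.pos (hρ : IsRank χ ρ) (i : Fin n) : 1 ≤ ρ i :=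
  (Finset.mem_Icc.1 ((hρ.range _).2 ⟨i, rfl⟩)).1

/-- The ranks of the elements of a block, in increasing order. -/
def posList (ρ : Fin n → ℕ) (V : Finset (Fin n)) : List ℕ := (V.image ρ).sort (· ≤ ·)

lemma mem_posList {V : Finset (Fin n)} {x : ℕ} : x ∈ posList ρ V ↔ ∃ v ∈ V, ρ v = x := by
  simp [posList]

lemma pairwise_posList (V : Finset (Fin n)) : (posList ρ V).Pairwise (· < ·) :=
  (Finset.sortedLT_sort _).pairwise

lemma toFinset_posList (V : Finset (Fin n)) : (posList ρ V).toFinset = V.image ρ := by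
  ext x; simp [posList]

/-- The list of insertions which evaluates a list of blocks. -/
def insertionList (χ : Fin n → Side) (ρ : Fin n → ℕ) : List (Finset (Fin n)) → List Insertion
  | [] => []
  | V :: Q => ⟨posList ρ V, [], (predPos χ V Q).elim 0 ρ⟩ :: insertionList χ ρ Q

lemma supp_insertionList (Q : List (Finset (Fin n))) (x : ℕ) :
    Insertion.Supp (insertionList χ ρ Q) x ↔ ∃ V ∈ Q, ∃ v ∈ V, ρ v = x := by
  induction Q with
  | nil => simp [insertionList]
  | cons V Q ih => simp [insertionList, Insertion.carrier, mem_posList, ih]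

/-- Blocks of `π` listed such that each one is preceded by an element of each later one. -/
structure MinDecreasing (π : Finpartition (Finset.univ : Finset (Fin n))) (ρ : Fin n → ℕ)
    (Q : List (Finset (Fin n))) : Prop where
  mem : ∀ V ∈ Q, V ∈ π.parts
  pairwise : Q.Pairwise fun V U => ∃ u ∈ U, ∀ v ∈ V, ρ u < ρ v

variable {π : Finpartition (Finset.univ : Finset (Fin n))}

lemma MinDecreasing.tail {V : Finset (Fin n)} {Q : List (Finset (Fin n))}
    (h : MinDecreasing π ρ (V :: Q)) : MinDecreasing π ρ Q :=
  ⟨fun U hU => h.mem U (List.mem_cons_of_mem _ hU), (List.pairwise_cons.1 h.pairwise).2⟩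

lemma predPos_eq_some (hρ : IsRank χ ρ) {V : Finset (Fin n)} {Q : List (Finset (Fin n))}
    {p : Fin n} (h : predPos χ V Q = some p) :
    (∃ W ∈ Q, p ∈ W) ∧ (∀ v ∈ V, ρ p < ρ v) ∧
      ∀ W ∈ Q, ∀ k ∈ W, (∀ v ∈ V, ρ k < ρ v) → ρ k ≤ ρ p := by
  rw [predPos, List.find?_eq_some_iff_append] at h
  obtain ⟨hp, as, bs, heq, has⟩ := h
  simp only [decide_eq_true_eq, hρ.lt_iff] at hp
  refine ⟨hp.1, hp.2, fun W hW k hk hkV => ?_⟩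
  have hmem : k ∈ (chiOrder χ).reverse := List.mem_reverse.2 (hρ.mem k)
  have hs : ((chiOrder χ).reverse).Pairwise fun i j => ρ j < ρ i :=
    List.pairwise_reverse.2 hρ.sorted
  rw [heq] at hmem hs
  rw [List.pairwise_append, List.pairwise_cons] at hs
  rcases List.mem_append.1 hmem with hk' | hk'
  · have := has k hk'
    simp only [Bool.not_eq_true', decide_eq_false_iff_not, hρ.lt_iff] at this
    exact absurd ⟨⟨W, hW, hk⟩, hkV⟩ this
  · rcases List.mem_cons.1 hk' with rfl | hk'
    · exact le_rfl
    · exact (hs.2.1.1 k hk').le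

/-- Every later block contains an element before `V`, so only the last block can lack a predecessor.
In the branch of `momentAux` that multiplies on the left, the remaining factor is therefore `1`. -/
lemma predPos_eq_none (hρ : IsRank χ ρ) {V : Finset (Fin n)} {Q : List (Finset (Fin n))}
    (hQ : MinDecreasing π ρ (V :: Q)) (h : predPos χ V Q = none) : Q = [] := by
  rcases Q with _ | ⟨U, Q⟩
  · rfl
  · exfalso
    rw [predPos, List.find?_eq_none] at h
    obtain ⟨u, hu, huV⟩ := (List.pairwise_cons.1 hQ.pairwise).1 U (by simp)
    refine h u (List.mem_reverse.2 (hρ.mem u)) ?_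
    simp only [decide_eq_true_eq, hρ.lt_iff]
    exact ⟨⟨U, by simp, hu⟩, huV⟩

/-- An element `k` of `U` strictly between `v₀` and `v` in `V` would give the crossing `u < v₀ < k <
v`, where `u ∈ U` precedes all of `V`. -/
lemma MinDecreasing.convex (hρ : IsRank χ ρ) (hπ : IsBiNonCrossing χ π) {V : Finset (Fin n)}
    {Q : List (Finset (Fin n))} (hQ : MinDecreasing π ρ (V :: Q)) {U : Finset (Fin n)}
    (hU : U ∈ Q) {k : Fin n} (hk : k ∈ U) : (∀ v ∈ V, ρ k < ρ v) ∨ ∀ v ∈ V, ρ v < ρ k := by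
  obtain ⟨u, hu, huV⟩ := (List.pairwise_cons.1 hQ.pairwise).1 U hU
  have hVp := hQ.mem V (by simp)
  have hUp := hQ.mem U (by simp [hU])
  have hne : U ≠ V := fun h => lt_irrefl _ (huV u (h ▸ hu))
  have hkV : k ∉ V := fun h => hne (π.eq_of_mem_parts hUp hVp hk h)
  by_contra! hcon
  obtain ⟨⟨v₀, hv₀, h1⟩, v, hv, h2⟩ := hcon
  have h1' : ρ v₀ < ρ k := lt_of_le_of_ne h1 fun h => hkV (hρ.injective h ▸ hv₀)
  have h2' : ρ k < ρ v := lt_of_le_of_ne h2 fun h => hkV (hρ.injective h ▸ hv)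
  refine hne (hπ U hUp V hVp u hu k hk v₀ hv₀ v hv ?_ ?_ ?_) <;> rw [hρ.lt_iff]
  · exact huV v₀ hv₀
  · exact h1'
  · exact h2'

lemma MinDecreasing.valid (hρ : IsRank χ ρ) (hπ : IsBiNonCrossing χ π)
    {Q : List (Finset (Fin n))} (hQ : MinDecreasing π ρ Q) :
    Insertion.Valid (insertionList χ ρ Q) := by
  induction Q with
  | nil => exact trivial
  | cons V Q ih =>
    refine ⟨?_, ih hQ.tail⟩
    obtain ⟨v₁, hv₁⟩ := π.nonempty_of_mem_parts (hQ.mem V (by simp))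
    refine ⟨?_, ?_, ?_, ?_, ?_⟩
    · simp only [Insertion.carrier, List.append_nil]
      exact List.ne_nil_of_mem (mem_posList.2 ⟨v₁, hv₁, rfl⟩)
    · simpa [Insertion.carrier] using pairwise_posList V
    · simp only [Insertion.carrier, List.append_nil, mem_posList]
      rintro _ ⟨v, hv, rfl⟩
      cases hp : predPos χ V Q with
      | none => exact hρ.pos v
      | some p => simpa using (predPos_eq_some hρ hp).2.1 v hv
    · rw [supp_insertionList]
      cases hp : predPos χ V Q with
      | none => simp
      | some p =>
        obtain ⟨W, hW, hpW⟩ := (predPos_eq_some hρ hp).1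
        exact Or.inr ⟨W, hW, p, hpW, rfl⟩
    · intro x hx
      rw [supp_insertionList] at hx
      obtain ⟨U, hU, k, hk, rfl⟩ := hx
      simp only [Insertion.carrier, List.append_nil, mem_posList]
      rcases hQ.convex hρ hπ hU hk with h | h
      · left
        cases hp : predPos χ V Q with
        | none =>
          rw [predPos_eq_none hρ hQ hp] at hU
          simp at hU
        | some p => exact (predPos_eq_some hρ hp).2.2 U hU k hk h
      · right
        rintro _ ⟨v, hv, rfl⟩
        exact h v hv

lemma minDecreasing_blockList (hρ : IsRank χ ρ) : MinDecreasing π ρ (blockList χ π) := by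
  refine ⟨fun V hV => ?_, ?_⟩
  · rw [blockList, List.mem_map] at hV
    obtain ⟨k, -, rfl⟩ := hV
    exact π.part_mem.2 (Finset.mem_univ k)
  · rw [blockList, List.pairwise_map]
    have hs : ((chiOrder χ).reverse).Pairwise fun i j => ρ j < ρ i :=
      List.pairwise_reverse.2 hρ.sorted
    refine (hs.filter _).imp_of_mem fun {a b} ha hb hab => ?_
    simp only [List.mem_filter, decide_eq_true_eq, hρ.lt_iff] at ha
    exact ⟨b, π.mem_part (Finset.mem_univ b), fun v hv => hab.trans_le (not_lt.1 (ha.2 v hv))⟩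

lemma mem_blockList (hρ : IsRank χ ρ) {V : Finset (Fin n)} :
    V ∈ blockList χ π ↔ V ∈ π.parts := by
  refine ⟨(minDecreasing_blockList hρ).mem V, fun hV => ?_⟩
  obtain ⟨k, hk, hmin⟩ := Finset.exists_min_image V ρ (π.nonempty_of_mem_parts hV)
  rw [blockList, List.mem_map]
  have hpart := π.part_eq_of_mem hV hk
  refine ⟨k, ?_, hpart⟩
  simp only [List.mem_filter, List.mem_reverse, hρ.mem, true_and, decide_eq_true_eq, hρ.lt_iff,
    hpart, not_lt]
  exact hmin

end BlockList

/-! ### Bi-non-crossing partitions as non-crossing partitions of the ranks -/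

section Families

variable {n : ℕ} {χ : Fin n → Side} {ρ : Fin n → ℕ}

/-- The partition of `{1, …, n}` which corresponds to `π`. -/
def rankFamily (ρ : Fin n → ℕ) (π : Finpartition (Finset.univ : Finset (Fin n))) :
    Finset (Finset ℕ) := π.parts.image fun U => U.image ρ

lemma nonCrossing_rankFamily (hρ : IsRank χ ρ) (π : BNC χ) :
    NonCrossing n (rankFamily ρ π.1) := by
  have hmem : ∀ {i : Fin n} {U : Finset (Fin n)}, ρ i ∈ U.image ρ ↔ i ∈ U := fun {i U} => by
    rw [Finset.mem_image]
    exact ⟨fun ⟨j, hj, h⟩ => hρ.injective h ▸ hj, fun h => ⟨i, h, rfl⟩⟩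
  refine ⟨?_, fun x => ?_, ?_, ?_⟩
  · simp only [rankFamily, Finset.forall_mem_image, Finset.image_nonempty]
    exact fun U hU => π.1.nonempty_of_mem_parts hU
  · simp only [rankFamily, Finset.exists_mem_image, hρ.range]
    constructor
    · rintro ⟨i, rfl⟩
      obtain ⟨U, hU, hi⟩ := π.1.exists_mem (Finset.mem_univ i)
      exact ⟨U, hU, hmem.2 hi⟩
    · rintro ⟨U, -, hx⟩
      obtain ⟨i, -, hi⟩ := Finset.mem_image.1 hx
      exact ⟨i, hi⟩
  · simp only [rankFamily, Finset.forall_mem_image]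
    intro U hU V hV i hi hi'
    rw [π.1.eq_of_mem_parts hU hV hi (hmem.1 hi')]
  · simp only [rankFamily, Finset.forall_mem_image]
    intro U hU V hV a ha b hb c hc d hd h1 h2 h3
    simp only [← hρ.lt_iff] at h1 h2 h3
    rw [π.2 U hU V hV a ha b hb c hc d hd h1 h2 h3]

lemma image_rank_injective (hρ : IsRank χ ρ) :
    Function.Injective fun U : Finset (Fin n) => U.image ρ :=
  Finset.image_injective hρ.injective

lemma rankFamily_injective (hρ : IsRank χ ρ) :
    Function.Injective fun π : BNC χ => rankFamily ρ π.1 := fun _ _ h =>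
  Subtype.ext (Finpartition.ext (Finset.image_injective (image_rank_injective hρ) h))

lemma exists_rankFamily_eq (hρ : IsRank χ ρ) {σ : Finset (Finset ℕ)} (hσ : NonCrossing n σ) :
    ∃ π : BNC χ, rankFamily ρ π.1 = σ := by
  let pre : Finset ℕ → Finset (Fin n) := fun U => Finset.univ.filter fun i => ρ i ∈ U
  have hpre : ∀ U i, i ∈ pre U ↔ ρ i ∈ U := fun U i => by simp [pre]
  have himg : ∀ U ∈ σ, (pre U).image ρ = U := by
    intro U hU
    ext x
    simp only [Finset.mem_image, hpre]
    constructor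
    · rintro ⟨i, hi, rfl⟩
      exact hi
    · intro hx
      obtain ⟨i, rfl⟩ := (hρ.range x).1 ((hσ.cover x).2 ⟨U, hU, hx⟩)
      exact ⟨i, hx, rfl⟩
  let π : Finpartition (Finset.univ : Finset (Fin n)) := by
    refine Finpartition.ofExistsUnique (σ.image pre) (fun _ _ => Finset.subset_univ _)
      (fun a _ => ?_) ?_
    · obtain ⟨U, hU, ha⟩ := (hσ.cover (ρ a)).1 ((hρ.range _).2 ⟨a, rfl⟩)
      refine ⟨pre U, ⟨Finset.mem_image_of_mem _ hU, (hpre U a).2 ha⟩, ?_⟩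
      rintro V ⟨hV, haV⟩
      obtain ⟨W, hW, rfl⟩ := Finset.mem_image.1 hV
      rw [hσ.disjoint W hW U hU _ ((hpre W a).1 haV) ha]
    · intro h
      obtain ⟨U, hU, hU'⟩ := Finset.mem_image.1 h
      have := himg U hU
      rw [hU', Finset.image_empty] at this
      exact (hσ.nonempty U hU).ne_empty this.symm
  have hparts : π.parts = σ.image pre := rfl
  refine ⟨⟨π, ?_⟩, ?_⟩
  · intro U hU V hV a ha b hb c hc d hd h1 h2 h3
    rw [hρ.lt_iff] at h1 h2 h3
    rw [hparts] at hU hV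
    obtain ⟨U, hU', rfl⟩ := Finset.mem_image.1 hU
    obtain ⟨V, hV', rfl⟩ := Finset.mem_image.1 hV
    rw [hpre] at ha hb hc hd
    rw [hσ.noncrossing U hU' V hV' _ ha _ hb _ hc _ hd h1 h2 h3]
  · rw [rankFamily, hparts, Finset.image_image]
    refine (Finset.image_congr fun U hU => ?_).trans Finset.image_id
    exact himg U hU

/-- All positions of these insertions are free, so the content of compatibility is saturation: no
block of `τ` leaves the block of `π` that it meets. -/
lemma compat_blockList_iff (hρ : IsRank χ ρ) (π τ : BNC χ) :
    (∀ I ∈ insertionList χ ρ (blockList χ π.1), Insertion.Compat (rankFamily ρ τ.1) I) ↔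
      τ ≤ π := by
  have hmem : ∀ {i : Fin n} {U : Finset (Fin n)}, ρ i ∈ U.image ρ ↔ i ∈ U := fun {i U} => by
    rw [Finset.mem_image]
    exact ⟨fun ⟨j, hj, h⟩ => hρ.injective h ▸ hj, fun h => ⟨i, h, rfl⟩⟩
  -- Compatibility does not involve the target, so the targets may be forgotten.
  have hlist : ∀ Q : List (Finset (Fin n)), (∀ I ∈ insertionList χ ρ Q,
      Insertion.Compat (rankFamily ρ τ.1) I) ↔
      ∀ V ∈ Q, ∃ p, Insertion.Compat (rankFamily ρ τ.1) ⟨posList ρ V, [], p⟩ := by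
    have hp : ∀ V p p', Insertion.Compat (rankFamily ρ τ.1) ⟨posList ρ V, [], p⟩ →
        Insertion.Compat (rankFamily ρ τ.1) ⟨posList ρ V, [], p'⟩ :=
      fun V p p' h => ⟨h.block, h.saturated⟩
    intro Q
    induction Q with
    | nil => simp [insertionList]
    | cons V Q ih =>
      simp only [insertionList, List.forall_mem_cons, ih]
      exact and_congr_left fun _ => ⟨fun h => ⟨_, h⟩, fun ⟨p, h⟩ => hp _ _ _ h⟩
  rw [hlist]
  simp only [mem_blockList hρ]
  constructor
  · intro h U hU
    obtain ⟨i, hi⟩ := τ.1.nonempty_of_mem_parts hU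
    obtain ⟨V, hV, hiV⟩ := π.1.exists_mem (Finset.mem_univ i)
    obtain ⟨p, hc⟩ := h V hV
    refine ⟨V, hV, fun j hj => ?_⟩
    have h1 := hc.saturated _ (Finset.mem_image_of_mem _ hU) (ρ i) (hmem.2 hi)
      (by simpa [Insertion.carrier, mem_posList] using ⟨i, hiV, rfl⟩) (ρ j) (hmem.2 hj)
    simp only [Insertion.carrier, List.append_nil, mem_posList] at h1
    obtain ⟨k, hk, hkj⟩ := h1
    exact hρ.injective hkj ▸ hk
  · intro h V hV
    have hsat : ∀ U ∈ τ.1.parts, ∀ i ∈ U, i ∈ V → U ⊆ V := by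
      intro U hU i hi hiV
      obtain ⟨W, hW, hUW⟩ := h hU
      rwa [π.1.eq_of_mem_parts hV hW hiV (hUW hi)]
    refine ⟨0, ?_, ?_⟩
    · obtain ⟨k, hk, hmin⟩ := Finset.exists_min_image V ρ (π.1.nonempty_of_mem_parts hV)
      obtain ⟨U, hU, hkU⟩ := τ.1.exists_mem (Finset.mem_univ k)
      refine ⟨U.image ρ, Finset.mem_image_of_mem _ hU, by simp, ?_, ρ k, hmem.2 hkU, ?_⟩
      · simp only [Finset.forall_mem_image, Insertion.carrier, List.append_nil, mem_posList]
        exact fun i hi => ⟨i, hsat U hU k hkU hk hi, rfl⟩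
      · simp only [Insertion.carrier, List.append_nil, mem_posList]
        rintro _ ⟨v, hv, rfl⟩
        exact hmin v hv
    · simp only [rankFamily, Finset.forall_mem_image, Insertion.carrier, List.append_nil,
        mem_posList]
      rintro U hU i hi ⟨j, hj, hji⟩ l hl
      rw [hρ.injective hji] at hj
      exact ⟨l, hsat U hU i hi hj hl, rfl⟩

end Families

/-! ### Moments as sums of values of finer partitions, and Möbius inversion -/

section MomentCumulant

namespace Insertion

variable {B : Type*} [Ring B] {F q : List B → B}

lemma weight_free (hFq : ∀ l, l ≠ [] → F l = peelSum F q l []) {V : List ℕ} (hV : V ≠ [])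
    (p : ℕ) (b : ℕ → B) : (Insertion.mk V [] p).weight F q b = F (V.map b) := by
  rw [weight, hFq _ (by simpa using hV)]
  rfl

/-- A factor at the end of the last entry can be taken out on the right. -/
lemma run_update_mul (hFq : ∀ l, l ≠ [] → F l = peelSum F q l []) (hF : RightLinear F)
    {L : List Insertion} (hL : Valid L) (hl : ∀ I ∈ L, I.fixed = []) {p : ℕ}
    (hp : p = 0 ∨ Supp L p) (hmax : ∀ x, Supp L x → x ≤ p) (b : ℕ → B) (c : B) :
    run F q L (Function.update b p (b p * c)) 0 = run F q L b 0 * c := by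
  induction L generalizing b p with
  | nil =>
    have : p = 0 := by simpa using hp
    subst this
    simp [run]
  | cons I L ih =>
    obtain ⟨V, W, s⟩ := I
    have hW : W = [] := hl ⟨V, W, s⟩ (by simp)
    subst hW
    have hfit := hL.1
    have hc : (Insertion.mk V [] s).carrier = V := by simp [carrier]
    have hne : V ≠ [] := hc ▸ hfit.ne_nil
    have hlt : ∀ v ∈ V, s < v := by simpa only [hc] using hfit.pos_lt
    have hl' : ∀ I ∈ L, I.fixed = [] := fun I hI => hl I (List.mem_cons_of_mem _ hI)
    simp only [supp_cons, hc] at hp hmax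
    simp only [run, step, weight_free hFq hne]
    by_cases hpV : p ∈ V
    · have hps : s ≠ p := (hlt p hpV).ne
      have hs : V.Pairwise (· < ·) := by simpa only [hc] using hfit.sorted
      have hsmax : ∀ x, Supp L x → x ≤ s := fun x hx => by
        rcases hfit.convex x hx with h | h
        · exact h
        · rw [hc] at h
          have h1 := h p hpV
          have h2 := hmax x (Or.inr hx)
          omega
      rw [hF.map_update hs hpV fun v hv => hmax v (Or.inl hv), ← mul_assoc,
        Function.update_of_ne hps]
      have := ih hL.2 hl' hfit.pos_mem hsmax
        (Function.update b s (b s * F (V.map b)))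
      rw [Function.update_self, Function.update_idem] at this
      rw [← this]
      refine run_congr hL.2 fun x hx => ?_
      have hxp : x ≠ p := fun h => hfit.notMem hx (by rw [hc]; exact h ▸ hpV)
      by_cases hxs : x = s
      · subst hxs; simp
      · simp [hxs, hxp]
    · have hp' : p = 0 ∨ Supp L p := by tauto
      have hsp : s ≠ p := by
        rintro rfl
        obtain ⟨v, hv⟩ := List.exists_mem_of_ne_nil _ hne
        have h1 := hlt v hv
        have h2 := hmax v (Or.inl hv)
        omega
      have := ih hL.2 hl' hp' (fun x hx => hmax x (Or.inr hx))
        (Function.update b s (b s * F (V.map b)))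
      rw [Function.update_of_ne hsp.symm] at this
      rw [map_update_of_notMem hpV, Function.update_of_ne hsp, ← this,
        Function.update_comm hsp]

end Insertion

variable {B A : Type*} [Ring B] [Algebra ℂ B] [Ring A] [Algebra ℂ A] {P : BBSpace B A}
  {F q : List B → B} {n : ℕ} {χ : Fin n → Side} {ρ : Fin n → ℕ} {Z : (ℕ → B) → Fin n → A}

open Insertion

/-- The arguments `Z b`, where `b x` stands for the factor inserted at the position of rank `x`,
and the function `F` which computes their block moments. -/
structure IsModel (P : BBSpace B A) (χ : Fin n → Side) (ρ : Fin n → ℕ) (F : List B → B)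
    (Z : (ℕ → B) → Fin n → A) : Prop where
  moment_eq : ∀ V : Finset (Fin n), V.Nonempty → ∀ b,
    P.blockMoment V (Z b) = F ((posList ρ V).map b)
  insert_left : ∀ p, χ p = Side.left → ∀ b c,
    Function.update (Z b) p (Z b p * P.L c) = Z (Function.update b (ρ p) (b (ρ p) * c))
  insert_right : ∀ p, χ p = Side.right → ∀ b c,
    Function.update (Z b) p (P.R c * Z b p) = Z (Function.update b (ρ p) (b (ρ p) * c))

/-- All branches of `momentAux` become one operation, insertion after the preceding rank. A block
without predecessor is the last one and its value goes to position `0`; insertion into a left or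
right operator is what `IsModel` encodes; a block that nothing follows contributes a right factor,
which right linearity moves onto the last remaining entry. -/
lemma momentAux_eq_run (hρ : IsRank χ ρ) (hZ : IsModel P χ ρ F Z)
    (hFq : ∀ l, l ≠ [] → F l = peelSum F q l []) (hF : RightLinear F)
    {π : Finpartition (Finset.univ : Finset (Fin n))} (hπ : IsBiNonCrossing χ π)
    {Q : List (Finset (Fin n))} (hQ : MinDecreasing π ρ Q) (b : ℕ → B) (hb : b 0 = 1) :
    P.momentAux χ Q (Z b) = run F q (insertionList χ ρ Q) b 0 := by
  induction Q generalizing b with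
  | nil => simp [BBSpace.momentAux, insertionList, run, hb]
  | cons V Q ih =>
    have hV := π.nonempty_of_mem_parts (hQ.mem V (by simp))
    have hVne : posList ρ V ≠ [] := by
      obtain ⟨v, hv⟩ := hV
      exact List.ne_nil_of_mem (mem_posList.2 ⟨v, hv, rfl⟩)
    have hvalid := hQ.tail.valid hρ hπ
    rw [BBSpace.momentAux, insertionList, run, step, weight_free hFq hVne, hZ.moment_eq V hV]
    cases hp : predPos χ V Q with
    | none =>
      have := predPos_eq_none hρ hQ hp
      subst this
      simp [BBSpace.momentAux, insertionList, run, hb]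
    | some p =>
      obtain ⟨⟨W, hW, hpW⟩, hpV, hpmax⟩ := predPos_eq_some hρ hp
      have hp0 : (0 : ℕ) ≠ ρ p := by have := hρ.pos p; omega
      have hb' : Function.update b (ρ p) (b (ρ p) * F ((posList ρ V).map b)) 0 = 1 := by
        rw [Function.update_of_ne hp0, hb]
      simp only [Option.elim_some]
      split_ifs with hfol
      · cases hχ : χ p with
        | left => rw [← ih hQ.tail _ hb', ← hZ.insert_left p hχ]
        | right => rw [← ih hQ.tail _ hb', ← hZ.insert_right p hχ]
      -- Nothing follows `V`, so `p` has the largest rank among the remaining positions.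
      · rw [ih hQ.tail b hb, run_update_mul hFq hF hvalid]
        · clear * -
          induction Q with
          | nil => simp [insertionList]
          | cons V Q ih => simpa [insertionList] using ih
        · exact Or.inr ((supp_insertionList Q _).2 ⟨W, hW, p, hpW, rfl⟩)
        · intro x hx
          obtain ⟨U, hU, k, hk, rfl⟩ := (supp_insertionList Q _).1 hx
          rcases hQ.convex hρ hπ hU hk with h | h
          · exact hpmax U hU k hk h
          · refine absurd ⟨U, hU, k, hk, fun v hv => ?_⟩ hfol
            exact (hρ.lt_iff v k).2 (h v hv)

lemma Insertion.supp_blockList (hρ : IsRank χ ρ)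
    (π : Finpartition (Finset.univ : Finset (Fin n))) (x : ℕ) :
    x ∈ Finset.Icc 1 n ↔ Supp (insertionList χ ρ (blockList χ π)) x := by
  rw [supp_insertionList, hρ.range]
  simp only [mem_blockList hρ]
  constructor
  · rintro ⟨i, rfl⟩
    obtain ⟨V, hV, hi⟩ := π.exists_mem (Finset.mem_univ i)
    exact ⟨V, hV, i, hi, rfl⟩
  · rintro ⟨V, hV, v, hv, rfl⟩
    exact ⟨v, rfl⟩

open Classical in
/-- The moment function is the sum of the values of all finer non-crossing partitions. -/
lemma moment_eq_sum_leafValue (hρ : IsRank χ ρ) (hZ : IsModel P χ ρ F Z) (hF₀ : F [] = 1)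
    (hFq : ∀ l, l ≠ [] → F l = peelSum F q l []) (hF : RightLinear F)
    (hq : AdditiveInEntries q) (hq' : RightLinear q) (π : BNC χ) :
    P.moment χ π (Z fun _ => 1) =
      ∑ τ : BNC χ with τ ≤ π, leafValue F q (fun _ => 1) (rankFamily ρ τ.1) := by
  have hQ := minDecreasing_blockList (π := π.1) hρ
  rw [BBSpace.moment, momentAux_eq_run hρ hZ hFq hF π.2 hQ _ rfl,
    run_eq_sum_leafValue hF₀ hFq hq hq' (hQ.valid hρ π.2) (supp_blockList hρ π.1),
    Finset.sum_filter]
  symm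
  refine Finset.sum_bij (fun τ _ => rankFamily ρ τ.1)
    (fun τ _ => mem_ncFamilies.2 (nonCrossing_rankFamily hρ τ))
    (fun τ _ τ' _ h => rankFamily_injective hρ h) (fun σ hσ => ?_) (fun τ _ => ?_)
  · obtain ⟨τ, hτ⟩ := exists_rankFamily_eq hρ (mem_ncFamilies.1 hσ)
    exact ⟨τ, Finset.mem_univ _, hτ⟩
  · simp only [compat_blockList_iff hρ π τ]

lemma le_full (σ : BNC χ) : σ ≤ BNC.full χ := by
  change σ.1 ≤ ⊤
  exact le_top

/-- Every moment is the sum of `leafValue` over a lower set `{τ ≤ π}`, so Möbius inversion at the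
top leaves only the value of the full partition. -/
lemma cumulant_full_eq_leafValue (hρ : IsRank χ ρ) (hZ : IsModel P χ ρ F Z) (hF₀ : F [] = 1)
    (hFq : ∀ l, l ≠ [] → F l = peelSum F q l []) (hF : RightLinear F)
    (hq : AdditiveInEntries q) (hq' : RightLinear q) :
    P.cumulant χ (BNC.full χ) (Z fun _ => 1) =
      leafValue F q (fun _ => 1) (rankFamily ρ (BNC.full χ).1) := by
  classical
  rw [BBSpace.cumulant]
  simp only [moment_eq_sum_leafValue hρ hZ hF₀ hFq hF hq hq', Finset.smul_sum, Finset.sum_filter,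
    le_full, if_true]
  rw [Finset.sum_comm]
  have key : ∀ τ : BNC χ, ∑ σ : BNC χ, (if τ ≤ σ then muBNC χ σ (BNC.full χ) else 0) =
      if τ = BNC.full χ then 1 else 0 := fun τ => by
    have := IncidenceAlgebra.sum_Icc_mu_left (𝕜 := ℂ) τ (BNC.full χ)
    rw [← this, ← Finset.sum_filter]
    refine Finset.sum_congr ?_ fun σ _ => ?_
    · ext σ
      simp [le_full]
    · unfold muBNC
      congr!
  rw [Finset.sum_eq_single (BNC.full χ)]
  · have h1 := key (BNC.full χ)
    rw [if_pos rfl] at h1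
    calc _ = (∑ σ : BNC χ, (if BNC.full χ ≤ σ then muBNC χ σ (BNC.full χ) else 0)) •
          leafValue F q (fun _ => 1) (rankFamily ρ (BNC.full χ).1) := by
          rw [Finset.sum_smul]
          refine Finset.sum_congr rfl fun σ _ => ?_
          split_ifs <;> simp
      _ = _ := by rw [h1, one_smul]
  · intro τ _ hτ
    have h1 := key τ
    rw [if_neg hτ] at h1
    calc _ = (∑ σ : BNC χ, (if τ ≤ σ then muBNC χ σ (BNC.full χ) else 0)) •
          leafValue F q (fun _ => 1) (rankFamily ρ τ.1) := by
          rw [Finset.sum_smul]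
          refine Finset.sum_congr rfl fun σ _ => ?_
          split_ifs <;> simp
      _ = _ := by rw [h1, zero_smul]
  · simp

/-- The cumulant of the arguments without inserted factors is the value of `q`. -/
theorem cumulant_full_eq (hρ : IsRank χ ρ) (hZ : IsModel P χ ρ F Z) (hF₀ : F [] = 1)
    (hFq : ∀ l, l ≠ [] → F l = peelSum F q l []) (hF : RightLinear F)
    (hq : AdditiveInEntries q) (hq' : RightLinear q) (hn : 0 < n) :
    P.cumulant χ (BNC.full χ) (Z fun _ => 1) = q (List.replicate n 1) := by
  rw [cumulant_full_eq_leafValue hρ hZ hF₀ hFq hF hq hq']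
  have hparts : (BNC.full χ).1.parts = {Finset.univ} := by
    have h1 : (BNC.full χ).1.parts ⊆ {Finset.univ} := Finpartition.parts_top_subset _
    obtain ⟨U, hU, -⟩ := (BNC.full χ).1.exists_mem (Finset.mem_univ (⟨0, hn⟩ : Fin n))
    refine h1.antisymm ?_
    have h2 := h1 hU
    rw [Finset.mem_singleton] at h2
    rw [Finset.singleton_subset_iff]
    exact h2 ▸ hU
  -- The full partition is realised by one final block containing all ranks, with its value inserted
  -- at `0`.
  let I : Insertion := ⟨[], posList ρ Finset.univ, 0⟩
  have hmem : ∀ x, x ∈ I.carrier ↔ x ∈ Finset.Icc 1 n := fun x => by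
    simp [I, carrier_fixed, mem_posList, hρ.range]
  have hvalid : Valid [I] := by
    refine ⟨⟨?_, ?_, fun v hv => ?_, Or.inl rfl, by simp⟩, trivial⟩
    · exact List.ne_nil_of_mem ((hmem 1).2 (by simp; omega))
    · exact pairwise_posList (ρ := ρ) Finset.univ
    · exact (Finset.mem_Icc.1 ((hmem v).1 hv)).1
  have hset : blockSet [I] = rankFamily ρ (BNC.full χ).1 := by
    simp [blockSet, rankFamily, hparts, I, carrier_fixed, toFinset_posList]
  rw [← hset, leafValue_blockSet hq' hvalid (by simp [Leaf, I])]
  simp only [run, step, I, weight_fixed, Function.update_self, one_mul]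
  congr 1
  rw [List.map_const']
  congr 1
  rw [posList, Finset.length_sort, Finset.card_image_of_injective _ hρ.injective]
  simp

end MomentCumulant

/-! ### Sums over the compositions of a list -/

section SplitSums

variable {α β R : Type*}

/-- The sum of `h` over all ways of cutting a list into nonempty consecutive pieces. -/
def splitSum [AddCommMonoid R] (h : List (List α) → R) (l : List α) : R :=
  ∑ c : Composition l.length, h (l.splitWrtComposition c)

lemma splitSum_nil [AddCommMonoid R] (h : List (List α) → R) : splitSum h [] = h [] := by
  have h1 : ∀ c : Composition ([] : List α).length, c = Composition.ones 0 := fun c => by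
    have h2 := (Composition.blocks_eq_nil (c := c)).2 rfl
    ext1
    rw [h2]
    rfl
  exact Finset.sum_eq_single (Composition.ones 0) (fun c _ hc => absurd (h1 c) hc) (by simp)

lemma splitWrtCompositionAux_concat (l : List α) (ns : List ℕ) (n : ℕ) :
    l.splitWrtCompositionAux (ns ++ [n]) =
      (l.take ns.sum).splitWrtCompositionAux ns ++ [(l.drop ns.sum).take n] := by
  induction ns generalizing l with
  | nil => simp [List.splitWrtCompositionAux]
  | cons k ns ih =>
    rw [List.cons_append, List.splitWrtCompositionAux_cons, ih, List.splitWrtCompositionAux_cons,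
      List.sum_cons]
    simp [List.take_take, List.drop_take]

/-- Recursion on the first piece. -/
lemma splitSum_eq_sum_head [AddCommMonoid R] (h : List (List α) → R) {l : List α} (hl : l ≠ []) :
    splitSum h l = ∑ i ∈ Finset.range l.length,
      splitSum (fun L => h (l.take (i + 1) :: L)) (l.drop (i + 1)) := by
  rw [Finset.sum_range]
  simp only [splitSum]
  rw [Finset.sum_sigma']
  symm
  refine Finset.sum_bij
    (i := fun x _ => ⟨((x.1 : ℕ) + 1) :: x.2.blocks, fun {j} hj => ?_, ?_⟩) ?_ ?_ ?_ ?_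
  · rcases List.mem_cons.1 hj with rfl | hj
    · omega
    · exact x.2.blocks_pos hj
  · have := x.1.2
    rw [List.sum_cons, x.2.blocks_sum, List.length_drop]
    omega
  · simp
  · rintro ⟨i, c⟩ - ⟨j, d⟩ - hij
    simp only [Composition.mk.injEq, List.cons.injEq] at hij
    obtain ⟨h1, h2⟩ := hij
    have h3 : i = j := Fin.ext (by omega)
    subst h3
    rw [Composition.ext h2]
  · intro c _
    obtain ⟨k, ns, hk⟩ : ∃ k ns, c.blocks = k :: ns := by
      refine List.exists_cons_of_ne_nil fun h1 => hl ?_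
      exact List.length_eq_zero_iff.1 (c.blocks_eq_nil.1 h1)
    have hpos : 0 < k := c.blocks_pos (by simp [hk])
    have hsum : k + ns.sum = l.length := by rw [← List.sum_cons, ← hk, c.blocks_sum]
    refine ⟨⟨⟨k - 1, by omega⟩, ⟨ns, fun {j} hj => c.blocks_pos (by simp [hk, hj]), ?_⟩⟩,
      Finset.mem_univ _, ?_⟩
    · simp only [List.length_drop]
      omega
    · ext1
      simp only [hk]
      congr 1
      omega
  · rintro ⟨i, c⟩ -
    simp only [List.splitWrtComposition, List.splitWrtCompositionAux_cons]

/-- Recursion on the last piece. -/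
lemma splitSum_eq_sum_last [AddCommMonoid R] (h : List (List α) → R) {l : List α} (hl : l ≠ []) :
    splitSum h l = ∑ i ∈ Finset.range l.length,
      splitSum (fun L => h (L ++ [l.drop i])) (l.take i) := by
  rw [Finset.sum_range]
  simp only [splitSum]
  rw [Finset.sum_sigma']
  symm
  have hlen : ∀ i : Fin l.length, (l.take i).length = i := fun i => by
    rw [List.length_take]; omega
  refine Finset.sum_bij
    (i := fun x _ => ⟨x.2.blocks ++ [l.length - (x.1 : ℕ)], fun {j} hj => ?_, ?_⟩) ?_ ?_ ?_ ?_
  · rcases List.mem_append.1 hj with hj | hj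
    · exact x.2.blocks_pos hj
    · have := x.1.2
      rw [List.mem_singleton] at hj
      omega
  · have := x.1.2
    rw [List.sum_append, x.2.blocks_sum, hlen, List.sum_singleton]
    omega
  · simp
  · rintro ⟨i, c⟩ - ⟨j, d⟩ - hij
    simp only [Composition.mk.injEq] at hij
    obtain ⟨h1, h2⟩ := List.append_inj' hij rfl
    have h3 : i = j := Fin.ext (by
      have h4 := List.head_eq_of_cons_eq h2
      have := i.2; have := j.2
      omega)
    subst h3
    rw [Composition.ext h1]
  · intro c _
    obtain ⟨ns, k, hk⟩ : ∃ ns k, c.blocks = ns ++ [k] := by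
      have h1 : c.blocks ≠ [] := fun h1 => hl
        (List.length_eq_zero_iff.1 (c.blocks_eq_nil.1 h1))
      exact ⟨_, _, (List.dropLast_append_getLast h1).symm⟩
    have hpos : 0 < k := c.blocks_pos (by simp [hk])
    have hsum : ns.sum + k = l.length := by
      rw [← c.blocks_sum, hk, List.sum_append, List.sum_singleton]
    refine ⟨⟨⟨ns.sum, by omega⟩, ⟨ns, fun {j} hj => c.blocks_pos (by simp [hk, hj]), ?_⟩⟩,
      Finset.mem_univ _, ?_⟩
    · simp only [List.length_take]
      omega
    · ext1
      simp only [hk]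
      congr 2
      omega
  · rintro ⟨i, c⟩ -
    have h1 : c.blocks.sum = i := c.blocks_sum.trans (hlen i)
    simp only [List.splitWrtComposition, splitWrtCompositionAux_concat, h1]
    have h2 : (l.drop (i : ℕ)).take (l.length - i) = l.drop i :=
      List.take_of_length_le (by simp)
    rw [h2]

lemma splitWrtComposition_ones (l : List α) :
    l.splitWrtComposition (Composition.ones l.length) = l.map fun x => [x] := by
  rw [List.splitWrtComposition, Composition.ones_blocks]
  induction l with
  | nil => rfl
  | cons x l ih =>
    rw [List.length_cons, List.replicate_succ, List.splitWrtCompositionAux_cons]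
    simpa using ih

lemma mul_splitSum [NonUnitalNonAssocSemiring R] (a : R) (h : List (List α) → R) (l : List α) :
    a * splitSum h l = splitSum (fun L => a * h L) l := Finset.mul_sum _ _ _

end SplitSums

/-! ### Left and right recursions for a convolution inverse -/

section Convolution

variable {α R : Type*} [Semiring R]

/-- A function of lists which equals `1 + F * D` also equals `1 + D * F`, for the convolution
product of functions of lists. -/
lemma convolution_swap {F D : List α → R} (hF₀ : F [] = 1)
    (hF : ∀ l, l ≠ [] → F l = ∑ i ∈ Finset.range l.length, F (l.take i) * D (l.drop i))
    {l : List α} (hl : l ≠ []) :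
    F l = ∑ j ∈ Finset.range l.length, D (l.take (j + 1)) * F (l.drop (j + 1)) := by
  induction hn : l.length using Nat.strong_induction_on generalizing l with
  | _ n ih =>
    obtain ⟨n, rfl⟩ : ∃ k, n = k + 1 :=
      Nat.exists_eq_succ_of_ne_zero (by rw [← hn]; simpa using hl)
    rw [hF l hl, hn, Finset.sum_range_succ', Finset.sum_range_succ]
    have e1 : l.drop (n + 1) = [] := List.drop_of_length_le hn.le
    have e2 : l.take (n + 1) = l := List.take_of_length_le hn.le
    simp only [List.take_zero, List.drop_zero, hF₀, e1, e2, one_mul, mul_one]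
    congr 1
    -- Apart from the common term `D l`, both sides are the triple convolution `D * F * D`: the left
    -- side by induction on the prefix, the right side by `hF` on the suffix.
    have h1 : ∀ i ∈ Finset.range n, F (l.take (i + 1)) * D (l.drop (i + 1)) =
        ∑ j ∈ Finset.range (i + 1),
          D (l.take (j + 1)) * F ((l.drop (j + 1)).take (i - j)) * D (l.drop (i + 1)) := by
      intro i hi
      rw [Finset.mem_range] at hi
      have h2 : (l.take (i + 1)).length = i + 1 := by rw [List.length_take]; omega
      rw [ih (i + 1) (by omega) (List.length_pos_iff.1 (by omega)) h2, Finset.sum_mul]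
      refine Finset.sum_congr rfl fun j hj => ?_
      rw [Finset.mem_range] at hj
      rw [List.take_take, List.drop_take, Nat.min_eq_left (by omega)]
      congr 4
      omega
    rw [Finset.sum_congr rfl h1, Finset.sum_comm' (t' := Finset.range n)
      (s' := fun j => Finset.Ico j n)]
    · refine Finset.sum_congr rfl fun j hj => ?_
      rw [Finset.mem_range] at hj
      have h2 : (l.drop (j + 1)).length = n - j := by rw [List.length_drop]; omega
      rw [hF (l.drop (j + 1)) (List.length_pos_iff.1 (by omega)), h2, Finset.mul_sum,
        Finset.sum_Ico_eq_sum_range]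
      refine Finset.sum_congr rfl fun i _ => ?_
      rw [List.drop_drop, mul_assoc]
      congr 4 <;> omega
    · intro i j
      simp only [Finset.mem_range, Finset.mem_Ico]
      omega

end Convolution

/-! ### Formal multilinear series evaluated on lists -/

section EvalList

variable {𝕜 V W : Type*} [NontriviallyNormedField 𝕜] [NormedAddCommGroup V] [NormedSpace 𝕜 V]
  [NormedAddCommGroup W] [NormedSpace 𝕜 W]

namespace FormalMultilinearSeries

/-- The value of a formal multilinear series on a list of arguments. -/
def evalList (p : FormalMultilinearSeries 𝕜 V W) (l : List V) : W := p l.length l.get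

lemma evalList_ofFn (p : FormalMultilinearSeries 𝕜 V W) {n : ℕ} (v : Fin n → V) :
    p.evalList (List.ofFn v) = p n v :=
  p.congr (by simp) fun i h1 h2 => by simp

lemma evalList_replicate (p : FormalMultilinearSeries 𝕜 V W) (n : ℕ) (b : V) :
    p.evalList (List.replicate n b) = p n fun _ => b := by
  rw [← List.ofFn_const, evalList_ofFn]

lemma evalList_append_add (p : FormalMultilinearSeries 𝕜 V W) (l₁ l₂ : List V) (x y : V) :
    p.evalList (l₁ ++ (x + y) :: l₂) =
      p.evalList (l₁ ++ x :: l₂) + p.evalList (l₁ ++ y :: l₂) := by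
  have key : ∀ z : V, p.evalList (l₁ ++ z :: l₂) =
      p (l₁ ++ (0 : V) :: l₂).length
        (Function.update (l₁ ++ (0 : V) :: l₂).get ⟨l₁.length, by simp⟩ z) := fun z => by
    refine p.congr (by simp) fun i h1 h2 => ?_
    rw [Function.update_apply]
    split_ifs with h
    · simp only [Fin.mk.injEq] at h
      subst h
      simp
    · simp only [Fin.mk.injEq] at h
      simp only [List.get_eq_getElem, List.getElem_append]
      split_ifs with h3
      · rfl
      · simp only [List.getElem_cons]
        rw [dif_neg (by omega), dif_neg (by omega)]
  rw [key, key, key, ContinuousMultilinearMap.map_update_add]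

/-- The composition of formal multilinear series in terms of lists. -/
lemma evalList_comp {U : Type*} [NormedAddCommGroup U] [NormedSpace 𝕜 U]
    (q : FormalMultilinearSeries 𝕜 W U) (p : FormalMultilinearSeries 𝕜 V W) (l : List V) :
    (q.comp p).evalList l = splitSum (fun L => q.evalList (L.map p.evalList)) l := by
  rw [evalList, FormalMultilinearSeries.comp, sum_apply, splitSum]
  refine Finset.sum_congr rfl fun c _ => ?_
  rw [compAlongComposition_apply, ← evalList_ofFn]
  congr 1
  refine List.ext_getElem (by simp) fun i h1 h2 => ?_
  have hi : i < c.length := by simpa using h1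
  simp only [List.getElem_ofFn, List.getElem_map, List.getElem_splitWrtComposition]
  unfold applyComposition evalList
  refine p.congr ?_ fun j h3 h4 => ?_
  · have h5 := c.sizeUpTo_succ hi
    have h6 := c.sizeUpTo_le (i + 1)
    simp only [List.length_drop, List.length_take, Composition.blocksFun, List.get_eq_getElem]
    omega
  · simp

end FormalMultilinearSeries

end EvalList

/-! ### Moment and cumulant series -/

section SeriesInverse

variable {𝕜 U V W : Type*} [NontriviallyNormedField 𝕜]
  [NormedAddCommGroup U] [NormedSpace 𝕜 U]
  [NormedAddCommGroup V] [NormedSpace 𝕜 V]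
  [NormedAddCommGroup W] [NormedSpace 𝕜 W]

namespace FormalMultilinearSeries

lemma radius_pos_of_norm_le {p : FormalMultilinearSeries 𝕜 U V} {C r : ℝ} (hr : 0 ≤ r)
    (h : ∀ n, ‖p n‖ ≤ C * r ^ n) : 0 < p.radius := by
  have hC : 0 ≤ C := by simpa using (norm_nonneg _).trans (h 0)
  -- The shift by `1` keeps the radius finite when `r = 0`.
  let s : NNReal := ⟨(r + 1)⁻¹, by positivity⟩
  have hs : 0 < s := by
    change (0 : ℝ) < (r + 1)⁻¹
    positivity
  refine lt_of_lt_of_le (ENNReal.coe_pos.2 hs) (p.le_radius_of_bound C fun n => ?_)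
  have h1 : r * (s : ℝ) ≤ 1 := by
    change r * (r + 1)⁻¹ ≤ 1
    rw [← div_eq_mul_inv]
    exact div_le_one_of_le₀ (by linarith) (by linarith)
  calc ‖p n‖ * (s : ℝ) ^ n ≤ C * r ^ n * (s : ℝ) ^ n := by gcongr; exact h n
    _ = C * (r * s) ^ n := by rw [mul_pow, mul_assoc]
    _ ≤ C * 1 := by gcongr; exact pow_le_one₀ (by positivity) h1
    _ = C := mul_one C

lemma eventually_summable_norm {p : FormalMultilinearSeries 𝕜 V W} (hp : 0 < p.radius) :
    ∀ᶠ v in 𝓝 (0 : V), Summable fun n => ‖p n fun _ => v‖ := by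
  filter_upwards [Metric.eball_mem_nhds (0 : V) hp] with v hv using p.summable_norm_apply hv

variable [CompleteSpace V] [CompleteSpace W]

lemma sum_zero_of_coeff_zero {p : FormalMultilinearSeries 𝕜 U V} (hp : 0 < p.radius)
    (hp₀ : p 0 = 0) : p.sum 0 = 0 := by
  rw [← (p.hasFPowerSeriesOnBall hp).coeff_zero (fun _ => 0), hp₀]
  rfl

lemma hasFPowerSeriesAt_comp_sum {q : FormalMultilinearSeries 𝕜 V W}
    {p : FormalMultilinearSeries 𝕜 U V} (hq : 0 < q.radius) (hp : 0 < p.radius) (hp₀ : p 0 = 0) :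
    HasFPowerSeriesAt (q.sum ∘ p.sum) (q.comp p) 0 := by
  refine HasFPowerSeriesAt.comp ?_ (p.hasFPowerSeriesOnBall hp).hasFPowerSeriesAt
  rw [sum_zero_of_coeff_zero hp hp₀]
  exact (q.hasFPowerSeriesOnBall hq).hasFPowerSeriesAt

lemma eventually_sum_sum_eq {q : FormalMultilinearSeries 𝕜 V W}
    {p : FormalMultilinearSeries 𝕜 U V} (hq : 0 < q.radius) (hp : 0 < p.radius) (hp₀ : p 0 = 0)
    {f : U → W} (hf : HasFPowerSeriesAt f (q.comp p) 0) :
    ∀ᶠ v in 𝓝 (0 : U), q.sum (p.sum v) = f v := by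
  filter_upwards [(hasFPowerSeriesAt_comp_sum hq hp hp₀).eventually_hasSum,
    hf.eventually_hasSum] with v h1 h2
  simpa using h1.unique h2

/-- The sum of the inverse series is a local inverse of the sum of the series. -/
lemma eventually_rightInv {p : FormalMultilinearSeries 𝕜 V W} (hp : 0 < p.radius) (hp₀ : p 0 = 0)
    {i : V ≃L[𝕜] W} (hp₁ : p 1 = (continuousMultilinearCurryFin1 𝕜 V W).symm i) :
    (∀ᶠ w in 𝓝 (0 : W), p.sum ((p.rightInv i 0).sum w) = w) ∧
      ∀ᶠ v in 𝓝 (0 : V), (p.rightInv i 0).sum (p.sum v) = v := by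
  have hr : 0 < (p.rightInv i 0).radius := radius_rightInv_pos_of_radius_pos hp
  have hr₀ : p.rightInv i 0 0 = 0 := by rw [rightInv_coeff_zero]; rfl
  constructor
  · refine eventually_sum_sum_eq hp hr hr₀ ?_
    rw [comp_rightInv p i 0 hp₁, hp₀]
    exact (ContinuousLinearMap.id 𝕜 W).hasFPowerSeriesAt 0
  · refine eventually_sum_sum_eq hr hp hp₀ ?_
    rw [← leftInv_eq_rightInv p i 0 hp₁, leftInv_comp p i 0 hp₁]
    exact (ContinuousLinearMap.id 𝕜 V).hasFPowerSeriesAt 0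

end FormalMultilinearSeries

end SeriesInverse

/-! ### The series of `Ψ`, of `(1 + Ψ(b)) b` and of `Φ` -/

section MomentSeries

open FormalMultilinearSeries

variable {B A : Type*} [NormedRing B] [NormedAlgebra ℂ B] [NormedRing A] [NormedAlgebra ℂ A]
  (Λ : B →L[ℂ] A) (E : A →L[ℂ] B)

/-- The multilinear moments `E(Λ b₁ ⋯ Λ bₙ)`, with value `1` for `n = 0`. -/
noncomputable def momentSeries : FormalMultilinearSeries ℂ B B
  | 0 => ContinuousMultilinearMap.uncurry0 ℂ B 1
  | n + 1 => E.compContinuousMultilinearMap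
      ((ContinuousMultilinearMap.mkPiAlgebraFin ℂ (n + 1) A).compContinuousLinearMap fun _ => Λ)

/-- The series of `b ↦ (1 + Ψ(b)) b`, where `Ψ` is the sum of the moments of positive order. -/
noncomputable def subordinationSeries : FormalMultilinearSeries ℂ B B
  | 0 => 0
  | n + 1 => ((ContinuousLinearMap.mul ℂ B).compContinuousMultilinearMap
      (momentSeries Λ E n)).uncurryRight

/-- The series of `Φ`, determined by `Ψ(b) = Φ((1 + Ψ(b)) b)`. -/
noncomputable def cumulantSeries : FormalMultilinearSeries ℂ B B :=
  (momentSeries Λ E).removeZero.comp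
    ((subordinationSeries Λ E).rightInv (ContinuousLinearEquiv.refl ℂ B) 0)

variable {Λ E}

lemma evalList_momentSeries {l : List B} (hl : l ≠ []) :
    (momentSeries Λ E).evalList l = E (l.map Λ).prod := by
  rcases l with _ | ⟨x, l⟩
  · exact absurd rfl hl
  · change E ((ContinuousMultilinearMap.mkPiAlgebraFin ℂ (l.length + 1) A) _) = _
    rw [ContinuousMultilinearMap.mkPiAlgebraFin_apply]
    congr 2
    refine List.ext_getElem (by simp) fun i h1 h2 => ?_
    simp

lemma evalList_momentSeries_nil : (momentSeries Λ E).evalList [] = 1 := rfl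

lemma momentSeries_apply_const (n : ℕ) (b : B) :
    momentSeries Λ E (n + 1) (fun _ => b) = E (Λ b ^ (n + 1)) := by
  rw [← evalList_replicate, evalList_momentSeries (by simp), List.map_replicate,
    List.prod_replicate]

lemma evalList_subordinationSeries (l : List B) (y : B) :
    (subordinationSeries Λ E).evalList (l ++ [y]) = (momentSeries Λ E).evalList l * y := by
  have h1 : l ++ [y] = List.ofFn (Fin.snoc (α := fun _ => B) l.get y) := by
    rw [List.ofFn_succ']
    simp
  rw [h1, evalList_ofFn]
  change momentSeries Λ E l.length (Fin.init (Fin.snoc (α := fun _ => B) l.get y)) *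
    Fin.snoc (α := fun _ => B) l.get y (Fin.last _) = _
  rw [Fin.init_snoc, Fin.snoc_last]
  rfl

lemma subordinationSeries_one : subordinationSeries Λ E 1 =
    (continuousMultilinearCurryFin1 ℂ B B).symm (ContinuousLinearEquiv.refl ℂ B) := by
  ext v
  change (1 : B) * v 0 = v 0
  rw [one_mul]

lemma norm_momentSeries_le : ∃ C r : ℝ, 0 ≤ r ∧ ∀ n, ‖momentSeries Λ E n‖ ≤ C * r ^ n := by
  refine ⟨max ‖momentSeries Λ E 0‖ ‖E‖, ‖Λ‖, norm_nonneg _, fun n => ?_⟩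
  rcases n with _ | n
  · simp
  · calc ‖momentSeries Λ E (n + 1)‖ ≤ ‖E‖ *
          ‖(ContinuousMultilinearMap.mkPiAlgebraFin ℂ (n + 1) A).compContinuousLinearMap
            fun _ => Λ‖ := ContinuousLinearMap.norm_compContinuousMultilinearMap_le _ _
      _ ≤ ‖E‖ * (1 * ‖Λ‖ ^ (n + 1)) := by
        gcongr
        refine (ContinuousMultilinearMap.norm_compContinuousLinearMap_le _ _).trans ?_
        rw [Finset.prod_const, Finset.card_univ, Fintype.card_fin]
        gcongr
        exact ContinuousMultilinearMap.norm_mkPiAlgebraFin_succ_le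
      _ ≤ _ := by
        rw [one_mul]
        gcongr
        exact le_max_right _ _

lemma radius_momentSeries_pos : 0 < (momentSeries Λ E).removeZero.radius := by
  obtain ⟨C, r, hr, h⟩ := norm_momentSeries_le (Λ := Λ) (E := E)
  refine radius_pos_of_norm_le (C := C) hr fun n => ?_
  rcases n with _ | n
  · simpa using (norm_nonneg _).trans (h 0)
  · exact h (n + 1)

lemma radius_subordinationSeries_pos : 0 < (subordinationSeries Λ E).radius := by
  obtain ⟨C, r, hr, h⟩ := norm_momentSeries_le (Λ := Λ) (E := E)
  have hC : 0 ≤ C := by simpa using (norm_nonneg _).trans (h 0)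
  refine radius_pos_of_norm_le (C := C) (r := r + 1) (by positivity) fun n => ?_
  rcases n with _ | n
  · change ‖(0 : B [×0]→L[ℂ] B)‖ ≤ _
    simpa using hC
  · have h1 : ‖subordinationSeries Λ E (n + 1)‖ =
        ‖(ContinuousLinearMap.mul ℂ B).compContinuousMultilinearMap (momentSeries Λ E n)‖ :=
      ContinuousMultilinearMap.uncurryRight_norm (Ei := fun _ : Fin (n + 1) => B) _
    rw [h1]
    calc _ ≤ ‖ContinuousLinearMap.mul ℂ B‖ * ‖momentSeries Λ E n‖ :=
          ContinuousLinearMap.norm_compContinuousMultilinearMap_le _ _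
      _ ≤ 1 * (C * r ^ n) := by
          gcongr
          · exact ContinuousLinearMap.opNorm_mul_le ℂ B
          · exact h n
      _ ≤ C * (r + 1) ^ (n + 1) := by
          rw [one_mul]
          gcongr
          calc r ^ n ≤ (r + 1) ^ n := by gcongr; linarith
            _ ≤ (r + 1) ^ (n + 1) := pow_le_pow_right₀ (by linarith) (by omega)

/-- The formal right inverse is also a left inverse because the linear part is the identity, so it
cancels against `subordinationSeries`. -/
lemma cumulantSeries_comp :
    (cumulantSeries Λ E).comp (subordinationSeries Λ E) = (momentSeries Λ E).removeZero := by
  rw [cumulantSeries, comp_assoc, ← leftInv_eq_rightInv _ _ _ subordinationSeries_one,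
    leftInv_comp _ _ _ subordinationSeries_one, comp_id]

/-- The moments in terms of the cumulants. -/
lemma evalList_momentSeries_eq_splitSum {l : List B} (hl : l ≠ []) :
    (momentSeries Λ E).evalList l =
      splitSum (fun L => (cumulantSeries Λ E).evalList (L.map (subordinationSeries Λ E).evalList))
        l := by
  rw [← evalList_comp, cumulantSeries_comp]
  rcases l with _ | ⟨x, l⟩
  · exact absurd rfl hl
  · rfl

lemma evalList_momentSeries_mul (hΛ : ∀ c b Z, E (Λ (c * b) * Z) = c * E (Λ b * Z))
    (c x : B) (l : List B) :
    (momentSeries Λ E).evalList (c * x :: l) = c * (momentSeries Λ E).evalList (x :: l) := by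
  rw [evalList_momentSeries (by simp), evalList_momentSeries (by simp)]
  simp only [List.map_cons, List.prod_cons, hΛ]

lemma evalList_subordinationSeries_mul (hΛ : ∀ c b Z, E (Λ (c * b) * Z) = c * E (Λ b * Z))
    (c x : B) (l : List B) : (subordinationSeries Λ E).evalList (c * x :: l) =
      c * (subordinationSeries Λ E).evalList (x :: l) := by
  rcases List.eq_nil_or_concat' l with rfl | ⟨l, y, rfl⟩
  · have h := evalList_subordinationSeries (Λ := Λ) (E := E) []
    simp only [List.nil_append, evalList_momentSeries_nil, one_mul] at h
    rw [h, h]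
  · rw [← List.cons_append, ← List.cons_append, evalList_subordinationSeries,
      evalList_subordinationSeries, evalList_momentSeries_mul hΛ, mul_assoc]

lemma evalList_subordinationSeries_singleton (x : B) :
    (subordinationSeries Λ E).evalList [x] = x := by
  have h := evalList_subordinationSeries (Λ := Λ) (E := E) [] x
  rwa [List.nil_append, evalList_momentSeries_nil, one_mul] at h

/-- The cumulants are left linear in the first argument. -/
lemma evalList_cumulantSeries_mul (hΛ : ∀ c b Z, E (Λ (c * b) * Z) = c * E (Λ b * Z))
    (c x : B) (l : List B) : (cumulantSeries Λ E).evalList (c * x :: l) =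
      c * (cumulantSeries Λ E).evalList (x :: l) := by
  induction hn : l.length using Nat.strong_induction_on generalizing l x with
  | _ n ih =>
    -- The finest composition contributes the cumulant of the list itself, since the subordination
    -- series is the identity on singletons. All other terms contain cumulants of shorter lists,
    -- covered by induction, and the first piece passes `c` on by left linearity of the
    -- subordination series.
    have hM := evalList_momentSeries_mul (E := E) hΛ c x l
    rw [evalList_momentSeries_eq_splitSum (by simp), evalList_momentSeries_eq_splitSum (by simp),
      splitSum, splitSum,
      ← Finset.add_sum_erase _ _ (Finset.mem_univ (Composition.ones (c * x :: l).length)),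
      ← Finset.add_sum_erase _ _ (Finset.mem_univ (Composition.ones (x :: l).length)), mul_add,
      splitWrtComposition_ones, splitWrtComposition_ones, Finset.mul_sum] at hM
    have hmap : ∀ l : List B, (l.map fun x => [x]).map (subordinationSeries Λ E).evalList = l :=
      fun l => by
        rw [List.map_map]
        conv_rhs => rw [← List.map_id l]
        exact List.map_congr_left fun y _ => evalList_subordinationSeries_singleton y
    rw [hmap, hmap] at hM
    refine add_right_cancel (hM.trans (congrArg _ ?_))
    refine Finset.sum_congr rfl fun d hd => ?_
    replace hd : d ≠ Composition.ones _ := (Finset.mem_erase.1 hd).1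
    obtain ⟨k, ns, hk⟩ : ∃ k ns, d.blocks = k :: ns :=
      List.exists_cons_of_ne_nil fun h1 => absurd (d.blocks_eq_nil.1 h1) (by simp)
    obtain ⟨k, rfl⟩ : ∃ j, k = j + 1 :=
      Nat.exists_eq_succ_of_ne_zero (d.blocks_pos (by simp [hk])).ne'
    have hlen : ns.length < n := by
      have h1 : d.length ≠ (x :: l).length := fun h => hd (Composition.eq_ones_iff_length.2 h)
      have h2 : d.length ≤ (x :: l).length := d.length_le
      rw [← d.blocks_length, hk] at h1 h2
      simp only [List.length_cons] at h1 h2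
      omega
    have hs : ∀ y, (y :: l).splitWrtCompositionAux d.blocks =
        (y :: l.take k) :: (l.drop k).splitWrtCompositionAux ns := fun y => by
      rw [hk, List.splitWrtCompositionAux_cons]
      simp
    have h1 : (c * x :: l).splitWrtComposition d = _ := hs (c * x)
    have h2 : (x :: l).splitWrtComposition d = _ := hs x
    rw [h1, h2, List.map_cons, List.map_cons, evalList_subordinationSeries_mul hΛ]
    exact (ih _ hlen _ _ (by rw [List.length_map, List.length_splitWrtCompositionAux])).symm

end MomentSeries

/-! ### Germs of inverses and quotients -/

section Germs

variable {B : Type*} [NormedRing B]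

lemma IsCompInverse.eventually_comp {F G : B → B} (h : IsCompInverse F G) {p : B → Prop}
    (hp : ∀ᶠ b in 𝓝 (0 : B), p b) : ∀ᶠ b in 𝓝 (0 : B), p (G b) := by
  have h1 : Tendsto G (𝓝 0) (𝓝 0) := by
    have := h.2.1.tendsto
    rwa [h.1] at this
  exact h1.eventually hp

lemma IsCompInverse.congr {F F' G : B → B} (h : IsCompInverse F G)
    (hF : ∀ᶠ b in 𝓝 (0 : B), F' b = F b) : IsCompInverse F' G := by
  refine ⟨h.1, h.2.1, ?_, ?_⟩
  · filter_upwards [h.eventually_comp hF, h.2.2.1] with b h1 h2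
    rw [h1, h2]
  · filter_upwards [hF, h.2.2.2] with b h1 h2
    rw [h1, h2]

lemma IsCompInverse.unique {F G G' : B → B} (h : IsCompInverse F G) (h' : IsCompInverse F G') :
    ∀ᶠ b in 𝓝 (0 : B), G b = G' b := by
  filter_upwards [h.eventually_comp h'.2.2.2, h.2.2.1] with b h1 h2
  rw [← h1, h2]

variable [NormedAlgebra ℂ B]

/-- An analytic function which vanishes after multiplication by the variable vanishes. -/
lemma AnalyticAt.eventually_eq_zero_of_mul [CompleteSpace B] {f : B → B} (hf : AnalyticAt ℂ f 0)
    (h : ∀ᶠ b in 𝓝 (0 : B), b * f b = 0) : ∀ᶠ b in 𝓝 (0 : B), f b = 0 := by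
  obtain ⟨r, hr, hfr⟩ := hf.exists_ball_analyticOnNhd
  obtain ⟨s, hs, hs0⟩ := Metric.eventually_nhds_iff_ball.1 h
  have hball : Metric.ball (0 : B) (min r s) ∈ 𝓝 (0 : B) :=
    Metric.ball_mem_nhds _ (lt_min hr hs)
  -- The variable need not be cancellable near zero, but it is near a small nonzero scalar `t • 1`,
  -- where it is invertible. The identity theorem on the ball then spreads the vanishing back to
  -- zero.
  have htend : Tendsto (fun t : ℂ => t • (1 : B)) (𝓝[≠] 0) (𝓝 0) := by
    have h1 : Tendsto (fun t : ℂ => t • (1 : B)) (𝓝 0) (𝓝 ((0 : ℂ) • (1 : B))) :=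
      Continuous.tendsto (by fun_prop) 0
    rw [zero_smul] at h1
    exact h1.mono_left nhdsWithin_le_nhds
  obtain ⟨t, ht, ht0⟩ := ((htend.eventually hball).and self_mem_nhdsWithin).exists
  have hu : IsUnit (t • (1 : B)) := by
    rw [← Algebra.algebraMap_eq_smul_one]
    exact (IsUnit.mk0 t ht0).map _
  have hsub : Metric.ball (0 : B) (min r s) ⊆ Metric.ball 0 r :=
    Metric.ball_subset_ball (min_le_left _ _)
  have hzero : f =ᶠ[𝓝 (t • (1 : B))] 0 := by
    filter_upwards [Units.isOpen.mem_nhds hu, Metric.isOpen_ball.mem_nhds ht] with b hb hb'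
    have h1 := hs0 b (Metric.ball_subset_ball (min_le_right _ _) hb')
    exact (IsUnit.mul_right_eq_zero hb).1 h1
  filter_upwards [hball] with b hb
  exact (hfr.mono hsub).eqOn_zero_of_preconnected_of_eventuallyEq_zero
    (convex_ball _ _).isPreconnected ht hzero hb

/-- The two `S`-transforms agree as soon as the inverses do. -/
lemma eventually_quotient_eq [CompleteSpace B] {F F' G G' H H' S T : B → B}
    (hG : IsCompInverse F G) (hH : IsCompInverse F' H) (hGH : ∀ b, G b = (1 + b) * H b)
    (hG' : IsCompInverse F G') (hS : IsLeftQuotient G' S)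
    (hH' : IsCompInverse F' H') (hT : IsLeftQuotient H' T) :
    ∀ᶠ b in 𝓝 (0 : B), S b = (1 + b) * T b := by
  have h1 : AnalyticAt ℂ (fun b => S b - (1 + b) * T b) 0 :=
    hS.1.sub ((analyticAt_const.add analyticAt_id).mul hT.1)
  -- Multiplied on the left by `b`, the difference becomes `G b - (1 + b) * H b`, because `b`
  -- commutes with `1 + b`.
  have h2 := h1.eventually_eq_zero_of_mul (by
    filter_upwards [hG.unique hG', hH.unique hH', hS.2, hT.2] with b e1 e2 e3 e4
    have e5 : b * S b = (1 + b) * (b * T b) := by rw [← e3, ← e1, hGH, e2, e4]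
    rw [mul_sub, e5, sub_eq_zero]
    noncomm_ring)
  filter_upwards [h2] with b hb
  exact sub_eq_zero.1 hb

end Germs

/-! ### Analytic inverses of the moment and cumulant series -/

section Transforms

open FormalMultilinearSeries

variable {B A : Type*} [NormedRing B] [NormedAlgebra ℂ B]
  [NormedRing A] [NormedAlgebra ℂ A] {Λ : B →L[ℂ] A} {E : A →L[ℂ] B}

lemma cumulantSeries_zero : cumulantSeries Λ E 0 = 0 := by
  ext v
  rw [cumulantSeries, comp_coeff_zero _ _ v 0]
  rfl

/-- By left linearity the linear part of `Ψ` is right multiplication by `E (Λ 1)`; this is where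
invertibility of the mean enters. -/
lemma momentSeries_one_eq (hΛ : ∀ c b Z, E (Λ (c * b) * Z) = c * E (Λ b * Z)) (u : Bˣ)
    (hu : (u : B) = E (Λ 1)) : ∃ i : B ≃L[ℂ] B, (momentSeries Λ E).removeZero 1 =
      (continuousMultilinearCurryFin1 ℂ B B).symm i := by
  refine ⟨ContinuousLinearEquiv.equivOfInverse ((ContinuousLinearMap.mul ℂ B).flip u)
    ((ContinuousLinearMap.mul ℂ B).flip (u⁻¹ : Bˣ)) (fun b => by simp) (fun b => by simp), ?_⟩
  ext v
  have h1 : v = fun _ => v 0 := funext fun i => by rw [Subsingleton.elim i 0]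
  change momentSeries Λ E 1 v = v 0 * u
  have h2 := hΛ (v 0) 1 1
  rw [mul_one, mul_one, mul_one] at h2
  rw [h1, momentSeries_apply_const 0, zero_add, pow_one, h2, hu]

variable [CompleteSpace B]

lemma radius_cumulantSeries_pos : 0 < (cumulantSeries Λ E).radius :=
  (hasFPowerSeriesAt_comp_sum radius_momentSeries_pos
    (radius_rightInv_pos_of_radius_pos radius_subordinationSeries_pos)
    (by rw [rightInv_coeff_zero]; rfl)).radius_pos

/-- The sum of a series with vanishing constant term. -/
lemma eventually_tsum_succ_eq {p : FormalMultilinearSeries ℂ B B} (hp : 0 < p.radius)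
    (hp₀ : p 0 = 0) : ∀ᶠ b in 𝓝 (0 : B), ∑' n : ℕ, p (n + 1) (fun _ => b) = p.sum b := by
  filter_upwards [p.eventually_summable_norm hp] with b hb
  rw [FormalMultilinearSeries.sum, hb.of_norm.tsum_eq_zero_add, hp₀]
  simp

lemma eventually_sum_subordinationSeries : ∀ᶠ b in 𝓝 (0 : B),
    (subordinationSeries Λ E).sum b = (1 + (momentSeries Λ E).removeZero.sum b) * b := by
  filter_upwards [eventually_tsum_succ_eq (p := subordinationSeries Λ E) radius_subordinationSeries_pos rfl,
    eventually_summable_norm (radius_momentSeries_pos (Λ := Λ) (E := E))] with b h1 h2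
  have h3 : ∀ n, subordinationSeries Λ E (n + 1) (fun _ => b) =
      momentSeries Λ E n (fun _ => b) * b := fun n => rfl
  have h4 : Summable fun n => momentSeries Λ E n fun _ => b := by
    refine (summable_nat_add_iff 1).1 ?_
    exact (summable_nat_add_iff (f := fun n => (momentSeries Λ E).removeZero n fun _ => b) 1).2
      h2.of_norm
  have h5 : ∑' n, (momentSeries Λ E n fun _ => b) =
      1 + (momentSeries Λ E).removeZero.sum b := by
    rw [h4.tsum_eq_zero_add, FormalMultilinearSeries.sum, h2.of_norm.tsum_eq_zero_add,
      removeZero_coeff_zero]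
    simp only [removeZero_coeff_succ, _root_.zero_apply, zero_add]
    rfl
  rw [← h1, ← h5, ← h4.tsum_mul_right]
  simp only [h3]

/-- Summing the geometric series and pulling `b` out of the leading `Λ b = Λ (b * 1)` gives the
factorisation `Ψ(b) = b g(b)`, from which the analytic quotient of the inverse is obtained. -/
lemma eventually_sum_momentSeries [CompleteSpace A]
    (hΛ : ∀ c b Z, E (Λ (c * b) * Z) = c * E (Λ b * Z)) : ∀ᶠ b in 𝓝 (0 : B),
      (momentSeries Λ E).removeZero.sum b = b * E (Λ 1 * Ring.inverse (1 - Λ b)) := by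
  have hsmall : ∀ᶠ b in 𝓝 (0 : B), ‖Λ b‖ < 1 := by
    have h1 : Continuous fun b => ‖Λ b‖ := by fun_prop
    have h2 := h1.tendsto 0
    rw [map_zero, norm_zero] at h2
    exact h2.eventually_lt_const one_pos
  filter_upwards [eventually_tsum_succ_eq (p := (momentSeries Λ E).removeZero) radius_momentSeries_pos rfl,
    hsmall] with b h1 h2
  have h3 := summable_geometric_of_norm_lt_one h2
  rw [← h1]
  simp only [removeZero_coeff_succ, momentSeries_apply_const]
  simp only [pow_succ']
  rw [← E.map_tsum (h3.mul_left _), h3.tsum_mul_left, geom_series_eq_inverse _ h2, ← hΛ, mul_one]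

/-- The inverse of the moment series and the inverse of the cumulant series. -/
theorem exists_isCompInverse [CompleteSpace A]
    (hΛ : ∀ c b Z, E (Λ (c * b) * Z) = c * E (Λ b * Z)) (hu : IsUnit (E (Λ 1))) :
    ∃ H T : B → B, IsCompInverse (momentSeries Λ E).removeZero.sum H ∧ IsLeftQuotient H T ∧
      IsCompInverse (cumulantSeries Λ E).sum fun b => (1 + b) * H b := by
  obtain ⟨u, hu⟩ := hu
  obtain ⟨i, hi⟩ := momentSeries_one_eq hΛ u hu
  set ψ := (momentSeries Λ E).removeZero with hψ
  have hψr : 0 < ψ.radius := radius_momentSeries_pos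
  have hψ₀ : ψ 0 = 0 := rfl
  set H := (ψ.rightInv i 0).sum with hH
  have hHr : 0 < (ψ.rightInv i 0).radius := radius_rightInv_pos_of_radius_pos hψr
  have hH₀ : H 0 = 0 := sum_zero_of_coeff_zero hHr (by rw [rightInv_coeff_zero]; rfl)
  have hHa : AnalyticAt ℂ H 0 :=
    ((ψ.rightInv i 0).hasFPowerSeriesOnBall hHr).hasFPowerSeriesAt.analyticAt
  obtain ⟨h1, h2⟩ : (∀ᶠ b in 𝓝 (0 : B), ψ.sum (H b) = b) ∧ ∀ᶠ b in 𝓝 (0 : B), H (ψ.sum b) = b :=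
    eventually_rightInv hψr hψ₀ hi
  have hinv : IsCompInverse ψ.sum H := ⟨hH₀, hHa.continuousAt, h1, h2⟩
  let g : B → B := fun b => E (Λ 1 * Ring.inverse (1 - Λ b))
  have hΛa : AnalyticAt ℂ (fun b => 1 - Λ b) 0 := analyticAt_const.sub (Λ.analyticAt 0)
  have hga : AnalyticAt ℂ g 0 := by
    have h3 : AnalyticAt ℂ (fun b => Ring.inverse (1 - Λ b)) 0 := by
      refine AnalyticAt.fun_comp (g := Ring.inverse) ?_ hΛa
      simpa using analyticAt_inverse (𝕜 := ℂ) (1 : Aˣ)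
    exact (E.analyticAt _).fun_comp (analyticAt_const.mul h3)
  have hg₀ : g 0 = u := by simp [g, hu]
  have hgH : AnalyticAt ℂ (fun b => g (H b)) 0 := by
    refine AnalyticAt.fun_comp (g := g) ?_ hHa
    rwa [hH₀]
  have hT : AnalyticAt ℂ (fun b => Ring.inverse (g (H b))) 0 := by
    refine AnalyticAt.fun_comp (g := Ring.inverse) ?_ hgH
    rw [hH₀, hg₀]
    exact analyticAt_inverse u
  have hunit : ∀ᶠ b in 𝓝 (0 : B), IsUnit (g (H b)) := by
    refine hgH.continuousAt.eventually ?_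
    simp only [hH₀, hg₀]
    exact Units.nhds u
  refine ⟨H, fun b => Ring.inverse (g (H b)), hinv, ⟨hT, ?_⟩, ?_⟩
  · filter_upwards [hunit, h1, hinv.eventually_comp (eventually_sum_momentSeries hΛ)]
      with b e1 e2 e3
    -- Evaluating `Ψ(b) = b g(b)` at `H b` shows that the quotient of `H` by the variable is the
    -- inverse of `g (H b)`.
    have e4 : H b * g (H b) = b := by rw [← e3, e2]
    rw [← e4, mul_assoc, e4, Ring.mul_inverse_cancel _ e1, mul_one]
  · have hpr : 0 < (subordinationSeries Λ E).radius := radius_subordinationSeries_pos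
    obtain ⟨k1, k2⟩ := eventually_rightInv hpr rfl subordinationSeries_one
    set m := (subordinationSeries Λ E).sum
    set ω := ((subordinationSeries Λ E).rightInv (ContinuousLinearEquiv.refl ℂ B) 0).sum with hω
    have hωr : 0 < ((subordinationSeries Λ E).rightInv (ContinuousLinearEquiv.refl ℂ B) 0).radius :=
      radius_rightInv_pos_of_radius_pos hpr
    have hω0 : (subordinationSeries Λ E).rightInv (ContinuousLinearEquiv.refl ℂ B) 0 0 = 0 := by
      rw [rightInv_coeff_zero]; rfl
    have hω₀ : ω 0 = 0 := sum_zero_of_coeff_zero hωr hω0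
    have hωt : Tendsto ω (𝓝 0) (𝓝 0) := by
      have := ((FormalMultilinearSeries.hasFPowerSeriesOnBall _ hωr).hasFPowerSeriesAt.analyticAt
        (𝕜 := ℂ)).continuousAt.tendsto
      rwa [← hω, hω₀] at this
    -- Since `Φ = ψ ∘ ω` with `ω` inverse to `m`, its inverse is `m ∘ H`, and `m (H b) = (1 + b) * H
    -- b` because `ψ (H b) = b`.
    have hΦ : ∀ᶠ b in 𝓝 (0 : B), ψ.sum (ω b) = (cumulantSeries Λ E).sum b :=
      eventually_sum_sum_eq hψr hωr hω0
        ((cumulantSeries Λ E).hasFPowerSeriesOnBall radius_cumulantSeries_pos).hasFPowerSeriesAt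
    have hm : ∀ᶠ b in 𝓝 (0 : B), m b = (1 + ψ.sum b) * b := eventually_sum_subordinationSeries
    have hG : ∀ᶠ b in 𝓝 (0 : B), m (H b) = (1 + b) * H b := by
      filter_upwards [hinv.eventually_comp hm, h1] with b e1 e2
      rw [e1, e2]
    have hGc : ContinuousAt (fun b => (1 + b) * H b) 0 := by
      have := hHa.continuousAt
      fun_prop
    have hG₀ : (fun b => (1 + b) * H b) 0 = 0 := by simp [hH₀]
    have hGt : Tendsto (fun b => (1 + b) * H b) (𝓝 0) (𝓝 0) := by
      simpa only [hH₀, mul_zero] using hGc.tendsto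
    have hΨω : Tendsto (fun b => ψ.sum (ω b)) (𝓝 0) (𝓝 0) := by
      have h3 := ((ψ.hasFPowerSeriesOnBall hψr).hasFPowerSeriesAt.analyticAt).continuousAt.tendsto
      rw [sum_zero_of_coeff_zero hψr hψ₀] at h3
      exact h3.comp hωt
    refine ⟨hG₀, hGc, ?_, ?_⟩
    · filter_upwards [hGt.eventually hΦ, hG, hinv.eventually_comp k2, h1] with b e1 e2 e3 e4
      rw [← e1, ← e2, e3, e4]
    · filter_upwards [hΦ, hΨω.eventually hG, hωt.eventually h2, k1] with b e1 e2 e3 e4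
      rw [← e1, ← e2, e3, e4]

end Transforms

/-! ### Peeling identities for moments and cumulants -/

section Twist

open FormalMultilinearSeries Insertion

variable {B : Type*} [Ring B]

/-- The function `(b₁, …, bₖ) ↦ f(x, b₁ x, …, bₖ₋₁ x) bₖ`, with value `1` on the empty list. -/
def leftTwist (f : List B → B) (x : B) (l : List B) : B :=
  if h : l = [] then 1 else f (x :: l.dropLast.map (· * x)) * l.getLast h

lemma leftTwist_nil (f : List B → B) (x : B) : leftTwist f x [] = 1 := dif_pos rfl

lemma leftTwist_concat (f : List B → B) (x : B) (l : List B) (y : B) :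
    leftTwist f x (l ++ [y]) = f (x :: l.map (· * x)) * y := by
  rw [leftTwist, dif_neg (by simp)]
  simp

lemma rightLinear_leftTwist (f : List B → B) (x : B) : RightLinear (leftTwist f x) := by
  intro l y c
  rw [leftTwist_concat, leftTwist_concat, mul_assoc]

lemma additiveInEntries_leftTwist {f : List B → B} (hf : AdditiveInEntries f) (x : B) :
    AdditiveInEntries (leftTwist f x) := by
  intro l₁ y z l₂
  rcases List.eq_nil_or_concat' l₂ with rfl | ⟨l₂, w, rfl⟩
  · simp only [leftTwist_concat, mul_add]
  · simp only [← List.cons_append, ← List.append_assoc, leftTwist_concat]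
    simp only [List.map_append, List.map_cons, add_mul]
    have h1 := hf (x :: l₁.map (· * x)) (y * x) (z * x) (l₂.map (· * x))
    simp only [List.cons_append] at h1
    rw [h1, add_mul]

/-- The moments which can be obtained by summation from cumulants which are left linear in the
first argument. -/
structure MomentCumulantPair (M m K : List B → B) : Prop where
  moment_nil : M [] = 1
  sub_concat : ∀ l y, m (l ++ [y]) = M l * y
  moment_mul : ∀ c x l, M (c * x :: l) = c * M (x :: l)
  cumulant_mul : ∀ c x l, K (c * x :: l) = c * K (x :: l)
  moment_eq : ∀ l, l ≠ [] → M l = splitSum (fun L => K (L.map m)) l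

namespace MomentCumulantPair

variable {M m K : List B → B} (h : MomentCumulantPair M m K)
include h

/-- A piece of the composition is thus a chosen entry `b` followed by the value of its gap `w`, the
shape of a factor in `peelSum`. -/
lemma sub_twist (x b : B) (w : List B) :
    m ((b :: w).map (· * x)) = b * leftTwist M x w * x := by
  rcases List.eq_nil_or_concat' w with rfl | ⟨w, y, rfl⟩
  · have h1 := h.sub_concat [] (b * x)
    rw [h.moment_nil, one_mul] at h1
    rw [leftTwist_nil, mul_one]
    exact h1
  · rw [leftTwist_concat]
    have h1 := h.sub_concat ((b * x) :: w.map (· * x)) (y * x)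
    simp only [List.map_cons, List.map_append, List.map_nil]
    rw [← List.cons_append, h1, h.moment_mul]
    noncomm_ring

lemma sub_twist_one (x : B) (w : List B) :
    m (x :: w.map (· * x)) = leftTwist M x w * x := by
  simpa using h.sub_twist x 1 w

/-- Cutting `u` into pieces amounts to choosing the first entries of the pieces, the rest of each
piece being a gap. `peelSum` removes the last piece first, so the recursion on the last piece
matches it; `e` is the last chosen entry, which `leftTwist` keeps outside the cumulant. -/
lemma peelSum_twist (x : B) (u acc : List B) (e : B) :
    peelSum (leftTwist M x) (leftTwist K x) u (acc ++ [e]) =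
      splitSum (fun L => K (x :: (L.map m ++ acc.map (· * x)))) (u.map (· * x)) * e := by
  induction hn : u.length using Nat.strong_induction_on generalizing u acc with
  | _ n ih =>
    by_cases hu : u = []
    · subst hu
      simp [splitSum_nil, leftTwist_concat]
    · rw [peelSum_of_ne_nil _ _ hu, splitSum_eq_sum_last _ (by simpa using hu), List.length_map,
        Finset.sum_range, Finset.sum_mul]
      refine Finset.sum_congr rfl fun i _ => ?_
      have hi := i.2
      rw [← List.cons_append, ih i (by omega) _ _ (by rw [List.length_take]; omega),
        ← List.map_take]
      congr 2
      funext L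
      rw [← List.map_drop, List.drop_eq_getElem_cons hi, List.map_append,
        List.map_singleton, h.sub_twist, List.append_assoc]
      rfl

/-- The moments with one cumulant peeled off on the left. -/
theorem leftTwist_eq_peelSum (x : B) {l : List B} (hl : l ≠ []) :
    leftTwist M x l = peelSum (leftTwist M x) (leftTwist K x) l [] := by
  -- `D l` is the part of the moment on `l` in which the first and the last position belong to one
  -- cumulant.
  let D' : List B → B := fun u => splitSum (fun L => K (x :: L.map m)) (u.map (· * x))
  let D : List B → B := fun l => if hl : l = [] then 0 else D' l.dropLast * l.getLast hl
  have hD : ∀ u y, D (u ++ [y]) = D' u * y := fun u y => by simp [D]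
  -- The composition formula singles out the block of the last position. What precedes this block
  -- sits in the first piece and leaves the cumulant on the left by linearity.
  have hconv : ∀ l, l ≠ [] → leftTwist M x l =
      ∑ i ∈ Finset.range l.length, leftTwist M x (l.take i) * D (l.drop i) := by
    intro l hl
    obtain ⟨u, y, rfl⟩ := (List.eq_nil_or_concat' l).resolve_left hl
    rw [leftTwist_concat, h.moment_eq _ (by simp), splitSum_eq_sum_head _ (by simp),
      Finset.sum_mul]
    simp only [List.length_cons, List.length_map, List.length_append, List.length_nil, zero_add]
    refine Finset.sum_congr rfl fun i hi => ?_
    rw [Finset.mem_range] at hi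
    rw [List.take_append_of_le_length (by omega), List.drop_append_of_le_length (by omega), hD]
    simp only [List.take_succ_cons, List.drop_succ_cons, List.map_cons, ← List.map_take,
      ← List.map_drop, h.sub_twist_one, h.cumulant_mul]
    rw [← mul_splitSum, mul_assoc]
  -- The swap passes to the block of the first position, as required by `peelSum`, with the
  -- remaining moment on its right.
  rw [convolution_swap (leftTwist_nil M x) hconv hl, peelSum_of_ne_nil _ _ hl, Finset.sum_range]
  refine Finset.sum_congr rfl fun i _ => ?_
  have h1 := h.peelSum_twist x (l.take i) [] (l[i] * leftTwist M x (l.drop (i + 1)))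
  simp only [List.nil_append, List.map_nil, List.append_nil] at h1
  rw [h1, List.take_succ_eq_append_getElem i.2, hD, mul_assoc]
  rfl

end MomentCumulantPair

end Twist

/-! ### The cumulants as coefficients of the cumulant series -/

section RankLists

variable {n : ℕ} {ρ : Fin n → ℕ}

lemma posList_eq {V : Finset (Fin n)} {l : List ℕ} (hl : l.Pairwise (· < ·))
    (hmem : ∀ x, x ∈ l ↔ ∃ v ∈ V, ρ v = x) : posList ρ V = l :=
  (pairwise_posList V).eq_of_mem_iff hl fun x => by rw [mem_posList, hmem]

lemma pairwise_sort_lt (V : Finset (Fin n)) : (V.sort (· ≤ ·)).Pairwise (· < ·) :=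
  (Finset.sortedLT_sort _).pairwise

lemma posList_eq_map (hρ : StrictMono ρ) (V : Finset (Fin n)) :
    posList ρ V = (V.sort (· ≤ ·)).map ρ :=
  posList_eq (List.pairwise_map.2 ((pairwise_sort_lt V).imp fun h => hρ h)) (by simp)

lemma posList_eq_reverse (hρ : StrictAnti ρ) (V : Finset (Fin n)) :
    posList ρ V = ((V.sort (· ≤ ·)).map ρ).reverse :=
  posList_eq (List.pairwise_reverse.2
    (List.pairwise_map.2 ((pairwise_sort_lt V).imp fun h => hρ h))) (by simp)

lemma isRank_left (n : ℕ) : IsRank (fun _ : Fin n => Side.left) fun i => (i : ℕ) + 1 := by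
  have h1 : chiOrder (fun _ : Fin n => Side.left) = List.finRange n := by simp [chiOrder]
  refine ⟨fun i j h => Fin.ext (by simpa using h), fun x => ?_, fun i j => ?_, ?_, fun i => ?_⟩
  · rw [Finset.mem_Icc]
    constructor
    · intro hx
      exact ⟨⟨x - 1, by omega⟩, by simp only; omega⟩
    · rintro ⟨i, rfl⟩
      omega
  · simp [ChiLT]
  · rw [h1]
    exact (List.pairwise_lt_finRange n).imp fun h => by simpa using h
  · rw [h1]
    exact List.mem_finRange i

lemma isRank_right (n : ℕ) : IsRank (fun _ : Fin n => Side.right) fun i => n - (i : ℕ) := by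
  have h1 : chiOrder (fun _ : Fin n => Side.right) = (List.finRange n).reverse := by
    simp [chiOrder]
  refine ⟨fun i j h => Fin.ext (by
    have h' : n - (i : ℕ) = n - (j : ℕ) := h
    omega), fun x => ?_, fun i j => ?_, ?_,
    fun i => ?_⟩
  · rw [Finset.mem_Icc]
    constructor
    · intro hx
      exact ⟨⟨n - x, by omega⟩, by simp only; omega⟩
    · rintro ⟨i, rfl⟩
      omega
  · simp only [ChiLT, reduceCtorEq, false_and, true_and, false_or]
    rw [Fin.lt_def]
    omega
  · rw [h1, List.pairwise_reverse]
    exact (List.pairwise_lt_finRange n).imp fun {a b} h => by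
      rw [Fin.lt_def] at h
      omega
  · rw [h1, List.mem_reverse]
    exact List.mem_finRange i

end RankLists

/-! ### Algebra of `L`, `R` and `E` -/

namespace BBSpace

section Operators

variable {B A : Type*} [Ring B] [Algebra ℂ B] [Ring A] [Algebra ℂ A] (P : BBSpace B A)

lemma L_mul (b c : B) : P.L (b * c) = P.L b * P.L c := by
  rw [L, L, L, ← map_mul, Algebra.TensorProduct.tmul_mul_tmul, one_mul]

lemma R_mul (b c : B) : P.R (b * c) = P.R c * P.R b := by
  rw [R, R, R, ← map_mul, Algebra.TensorProduct.tmul_mul_tmul, one_mul, MulOpposite.op_mul]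

lemma L_one : P.L 1 = 1 := P.ε.map_one

lemma R_one : P.R 1 = 1 := P.ε.map_one

lemma R_mul_L (b c : B) : P.R c * P.L b = P.L b * P.R c := by
  rw [L, R, ← map_mul, ← map_mul, Algebra.TensorProduct.tmul_mul_tmul,
    Algebra.TensorProduct.tmul_mul_tmul]
  simp only [one_mul, mul_one]

lemma E_L_mul (b : B) (Z : A) : P.E (P.L b * Z) = b * P.E Z := by
  have h := P.E_ε_mul b 1 Z
  rwa [mul_one] at h

lemma E_R_mul (b : B) (Z : A) : P.E (P.R b * Z) = P.E Z * b := by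
  have h := P.E_ε_mul 1 b Z
  rwa [one_mul] at h

lemma E_mul_L (b : B) (Z : A) : P.E (Z * P.L b) = P.E (Z * P.R b) := P.E_mul_ε b Z

lemma R_mul_of_mem_leftAlg {X : A} (hX : X ∈ P.leftAlg) (c : B) : P.R c * X = X * P.R c :=
  Subalgebra.mem_centralizer_iff ℂ |>.1 hX _ ⟨c, rfl⟩

lemma L_mem_leftAlg (b : B) : P.L b ∈ P.leftAlg := by
  refine (Subalgebra.mem_centralizer_iff ℂ).2 ?_
  rintro _ ⟨c, rfl⟩
  exact P.R_mul_L b c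

/-- On the left algebra, `E` is linear over right multiplications by `L_b`. -/
lemma E_mul_L_of_mem_leftAlg {Z : A} (hZ : Z ∈ P.leftAlg) (b : B) :
    P.E (Z * P.L b) = P.E Z * b := by
  rw [E_mul_L, ← P.R_mul_of_mem_leftAlg hZ, E_R_mul]

end Operators

end BBSpace

section Cumulants

open FormalMultilinearSeries Insertion

variable {B A : Type*} [NormedRing B] [NormedAlgebra ℂ B] [NormedRing A] [NormedAlgebra ℂ A]

lemma momentCumulantPair {Λ : B →L[ℂ] A} {E : A →L[ℂ] B}
    (hΛ : ∀ c b Z, E (Λ (c * b) * Z) = c * E (Λ b * Z)) :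
    MomentCumulantPair (momentSeries Λ E).evalList (subordinationSeries Λ E).evalList
      (cumulantSeries Λ E).evalList where
  moment_nil := rfl
  sub_concat := evalList_subordinationSeries
  moment_mul := evalList_momentSeries_mul hΛ
  cumulant_mul := evalList_cumulantSeries_mul hΛ
  moment_eq _ := evalList_momentSeries_eq_splitSum

namespace BBSpace

variable (P : BBSpace B A)

/-- Each inserted `L_c` merges with the `L_x` of the next operator into `Λ (c * x)`. The factor
after the last operator leaves `E` on the right because the product lies in the left algebra. -/
lemma isModel_left {X : A} (hX : X ∈ P.leftAlg) {Λ : B →L[ℂ] A} {E : A →L[ℂ] B}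
    (hΛ : ∀ b, Λ b = P.L b * X) (hE : ∀ Z, E Z = P.E Z) (x : B) (n : ℕ) :
    IsModel P (fun _ : Fin n => Side.left) (fun i => (i : ℕ) + 1)
      (leftTwist (momentSeries Λ E).evalList x)
      (fun b i => P.L x * X * P.L (b ((i : ℕ) + 1))) := by
  refine ⟨fun V hV b => ?_, fun p _ b c => ?_, fun p hp => by simp at hp⟩
  · have hT : P.L x * X ∈ P.leftAlg := mul_mem (P.L_mem_leftAlg x) hX
    have hprod : ∀ u : List B, (u.map fun c => P.L x * X * P.L c).prod * (P.L x * X) =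
        ((x :: u.map (· * x)).map Λ).prod := by
      intro u
      rw [List.map_cons, List.prod_cons, hΛ]
      induction u with
      | nil => simp
      | cons c u ih =>
        simp only [List.map_cons, List.prod_cons]
        rw [mul_assoc, ih, hΛ, P.L_mul]
        noncomm_ring
    have hmem : ∀ u : List B, (u.map fun c => P.L x * X * P.L c).prod ∈ P.leftAlg := fun u =>
      list_prod_mem fun z hz => by
        obtain ⟨c, -, rfl⟩ := List.mem_map.1 hz
        exact mul_mem hT (P.L_mem_leftAlg c)
    have key : ∀ l : List B, l ≠ [] → P.E (l.map fun c => P.L x * X * P.L c).prod =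
        leftTwist (momentSeries Λ E).evalList x l := by
      intro l hl
      obtain ⟨u, y, rfl⟩ := (List.eq_nil_or_concat' l).resolve_left hl
      rw [leftTwist_concat, evalList_momentSeries (by simp), ← hprod, hE, List.map_append,
        List.prod_append, List.map_singleton, List.prod_singleton, ← mul_assoc,
        P.E_mul_L_of_mem_leftAlg (mul_mem (hmem u) hT)]
    have hne : V.sort (· ≤ ·) ≠ [] := by
      obtain ⟨v, hv⟩ := hV
      exact List.ne_nil_of_mem ((Finset.mem_sort _).2 hv)
    rw [posList_eq_map (fun i j h => by simpa using h), ← key _ (by simpa using hne),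
      blockMoment, List.map_map, List.map_map]
    rfl
  · funext i
    rw [Function.update_apply]
    split_ifs with h
    · subst h
      rw [Function.update_self, P.L_mul, mul_assoc]
    · rw [Function.update_of_ne (fun h' => h (Fin.ext (by simpa using h')))]

/-- The left cumulants are the values of the cumulant series. -/
theorem leftCumulantTerm_eq {X : A} (hX : X ∈ P.leftAlg) {Λ : B →L[ℂ] A} {E : A →L[ℂ] B}
    (hΛ : ∀ b, Λ b = P.L b * X) (hE : ∀ Z, E Z = P.E Z) (n : ℕ) (x : B) :
    P.leftCumulantTerm X (n + 1) x = cumulantSeries Λ E (n + 1) fun _ => x := by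
  have hΛE : ∀ c b Z, E (Λ (c * b) * Z) = c * E (Λ b * Z) := fun c b Z => by
    rw [hΛ, hΛ, hE, hE, P.L_mul, mul_assoc, mul_assoc, P.E_L_mul, mul_assoc]
  have h := cumulant_full_eq (isRank_left (n + 1)) (P.isModel_left hX hΛ hE x (n + 1))
    (leftTwist_nil _ x) (fun l hl => (momentCumulantPair hΛE).leftTwist_eq_peelSum x hl)
    (rightLinear_leftTwist _ x)
    (additiveInEntries_leftTwist (fun l₁ y z l₂ => evalList_append_add _ l₁ l₂ y z) x)
    (rightLinear_leftTwist _ x) n.succ_pos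
  simp only [P.L_one, mul_one] at h
  rw [leftCumulantTerm, h, List.replicate_succ', leftTwist_concat, List.map_replicate, one_mul,
    mul_one, ← List.replicate_succ, evalList_replicate]

end BBSpace

end Cumulants

/-! ### Block expansion for right operators, over the opposite algebra -/

section RightTwist

open MulOpposite Insertion FormalMultilinearSeries

variable {B : Type*} [Ring B]

/-- The function `(b₁, …, bₖ) ↦ f(d bₖ, …, d b₁)`. -/
def rightTwist (f : List Bᵐᵒᵖ → Bᵐᵒᵖ) (d : B) (l : List B) : B :=
  unop (f (l.reverse.map fun b => op (d * b)))

lemma rightTwist_concat (f : List Bᵐᵒᵖ → Bᵐᵒᵖ) (d : B) (l : List B) (y : B) :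
    rightTwist f d (l ++ [y]) =
      unop (f (op y * op d :: l.reverse.map fun b => op (d * b))) := by
  simp [rightTwist]

lemma rightLinear_rightTwist {f : List Bᵐᵒᵖ → Bᵐᵒᵖ} (hf : ∀ c x l, f (c * x :: l) = c * f (x :: l))
    (d : B) : RightLinear (rightTwist f d) := by
  intro l y c
  rw [rightTwist_concat, rightTwist_concat, op_mul, mul_assoc, hf, unop_mul, unop_op]

lemma additiveInEntries_rightTwist {f : List Bᵐᵒᵖ → Bᵐᵒᵖ} (hf : AdditiveInEntries f) (d : B) :
    AdditiveInEntries (rightTwist f d) := by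
  intro l₁ y z l₂
  simp only [rightTwist, List.reverse_append, List.reverse_cons, List.map_append, List.map_cons,
    List.append_assoc, List.singleton_append, mul_add, op_add]
  rw [hf, unop_add]

namespace MomentCumulantPair

variable {M m K : List Bᵐᵒᵖ → Bᵐᵒᵖ} (h : MomentCumulantPair M m K)
include h

/-- In the reversed list every piece ends with a chosen entry, preceded by its gap, and the last
piece ends at the first position. The composition formula thus already singles out the block wanted
by `peelSum`, and no convolution swap is needed; the last chosen position corresponds to the first
piece. -/
lemma peelSum_rightTwist (d : B) (l acc : List B) :
    peelSum (rightTwist M d) (rightTwist K d) l acc =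
      unop (splitSum (fun L => K ((acc.reverse.map fun b => op (d * b)) ++ L.map m))
        (l.reverse.map fun b => op (d * b))) := by
  induction hn : l.length using Nat.strong_induction_on generalizing l acc with
  | _ n ih =>
    by_cases hl : l = []
    · subst hl
      simp [splitSum_nil, rightTwist]
    · rw [peelSum_of_ne_nil _ _ hl, splitSum_eq_sum_head _ (by simpa using hl), List.length_map,
        List.length_reverse, ← Finset.sum_range_reflect, Finset.sum_range, Finset.unop_sum]
      refine Finset.sum_congr rfl fun i _ => ?_
      have hi := i.2
      have e1 : l.length - (l.length - 1 - (i : ℕ) + 1) = i := by omega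
      rw [ih i (by omega) _ _ (by rw [List.length_take]; omega)]
      simp only [← List.map_take, ← List.map_drop, List.take_reverse, List.drop_reverse, e1]
      congr 2
      funext L
      rw [List.drop_eq_getElem_cons hi, List.reverse_cons, List.reverse_cons, List.map_append,
        List.map_append, List.map_singleton, List.map_singleton, List.map_cons, h.sub_concat,
        List.append_assoc, op_mul, op_mul, op_mul, rightTwist, op_unop, mul_assoc]
      rfl

/-- The moments with one cumulant peeled off. -/
theorem rightTwist_eq_peelSum (d : B) {l : List B} (hl : l ≠ []) :
    rightTwist M d l = peelSum (rightTwist M d) (rightTwist K d) l [] := by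
  rw [h.peelSum_rightTwist, rightTwist, h.moment_eq _ (by simpa using hl)]
  simp

end MomentCumulantPair

end RightTwist

section Cumulants

open MulOpposite FormalMultilinearSeries Insertion

variable {B A : Type*} [NormedRing B] [NormedAlgebra ℂ B] [NormedRing A] [NormedAlgebra ℂ A]

namespace BBSpace

variable (P : BBSpace B A)

/-- Ranks decrease along the positions, so the reversal in `rightTwist` restores the order of the
product. Inserted factors stand before their operator and merge with it through `R_b R_d = R_{d b}`,
so no factor remains at the end. -/
lemma isModel_right {Y : A} {Λ : Bᵐᵒᵖ →L[ℂ] A} {E : A →L[ℂ] Bᵐᵒᵖ}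
    (hΛ : ∀ b, Λ b = P.R (unop b) * Y) (hE : ∀ Z, E Z = op (P.E Z)) (d : B) (n : ℕ) :
    IsModel P (fun _ : Fin n => Side.right) (fun i => n - (i : ℕ))
      (rightTwist (momentSeries Λ E).evalList d)
      (fun b i => P.R (b (n - (i : ℕ))) * (P.R d * Y)) := by
  refine ⟨fun V hV b => ?_, fun p hp => by simp at hp, fun p _ b c => ?_⟩
  · have hne : V.sort (· ≤ ·) ≠ [] := by
      obtain ⟨v, hv⟩ := hV
      exact List.ne_nil_of_mem ((Finset.mem_sort _).2 hv)
    rw [posList_eq_reverse (fun i j h => by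
        have := i.2
        rw [Fin.lt_def] at h
        change n - (j : ℕ) < n - (i : ℕ)
        omega), rightTwist,
      evalList_momentSeries (by simpa using hne), hE, unop_op, blockMoment]
    simp only [List.map_reverse, List.reverse_reverse, List.map_map]
    congr 3
    funext i
    simp only [Function.comp_apply, hΛ, unop_op, P.R_mul, mul_assoc]
  · funext i
    rw [Function.update_apply]
    split_ifs with h
    · subst h
      rw [Function.update_self, P.R_mul, mul_assoc]
    · rw [Function.update_of_ne (fun h' => h (Fin.ext (by omega)))]

/-- The right cumulants are the values of the cumulant series for the opposite algebra. -/
theorem rightCumulantTerm_eq {Y : A} {Λ : Bᵐᵒᵖ →L[ℂ] A} {E : A →L[ℂ] Bᵐᵒᵖ}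
    (hΛ : ∀ b, Λ b = P.R (unop b) * Y) (hE : ∀ Z, E Z = op (P.E Z)) (n : ℕ) (d : B) :
    P.rightCumulantTerm Y (n + 1) d = unop (cumulantSeries Λ E (n + 1) fun _ => op d) := by
  have hΛE : ∀ c b Z, E (Λ (c * b) * Z) = c * E (Λ b * Z) := fun c b Z => by
    rw [hΛ, hΛ, hE, hE, unop_mul, P.R_mul, mul_assoc, mul_assoc, P.E_R_mul, op_mul, op_unop,
      mul_assoc]
  have h := cumulant_full_eq (isRank_right (n + 1)) (P.isModel_right hΛ hE d (n + 1)) rfl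
    (fun l hl => (momentCumulantPair hΛE).rightTwist_eq_peelSum d hl)
    (rightLinear_rightTwist (momentCumulantPair hΛE).moment_mul d)
    (additiveInEntries_rightTwist (fun l₁ y z l₂ => evalList_append_add _ l₁ l₂ y z) d)
    (rightLinear_rightTwist (momentCumulantPair hΛE).cumulant_mul d) n.succ_pos
  simp only [P.R_one, one_mul] at h
  rw [rightCumulantTerm, h, rightTwist, List.reverse_replicate, List.map_replicate, mul_one,
    evalList_replicate]

end BBSpace

end Cumulants

/-! ### The `S`-transforms -/

section Main

open MulOpposite FormalMultilinearSeries

variable {B A : Type*} [NormedRing B] [NormedAlgebra ℂ B] [NormedRing A] [NormedAlgebra ℂ A]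

/-- Convergence of the two series, and the relation between their inverses. -/
theorem exists_isCompInverse_tsum [CompleteSpace B] [CompleteSpace A]
    {Λ : B →L[ℂ] A} {E : A →L[ℂ] B}
    (hΛ : ∀ c b Z, E (Λ (c * b) * Z) = c * E (Λ b * Z)) (hu : IsUnit (E (Λ 1)))
    {φ ψ : ℕ → B → B} (hφ : ∀ n b, φ n b = cumulantSeries Λ E (n + 1) fun _ => b)
    (hψ : ∀ n b, ψ n b = E (Λ b ^ (n + 1))) :
    (∀ᶠ b in 𝓝 (0 : B), Summable fun n => ‖φ n b‖) ∧
      (∀ᶠ b in 𝓝 (0 : B), Summable fun n => ‖ψ n b‖) ∧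
      ∃ H T : B → B, IsCompInverse (fun b => ∑' n, ψ n b) H ∧ IsLeftQuotient H T ∧
        IsCompInverse (fun b => ∑' n, φ n b) fun b => (1 + b) * H b := by
  have hψ' : ∀ n b, ψ n b = (momentSeries Λ E).removeZero (n + 1) fun _ => b := fun n b => by
    rw [hψ, removeZero_coeff_succ, momentSeries_apply_const]
  simp only [hφ, hψ']
  refine ⟨?_, ?_, ?_⟩
  · filter_upwards [eventually_summable_norm (radius_cumulantSeries_pos (Λ := Λ) (E := E))]
      with b hb
    exact (summable_nat_add_iff (f := fun n => ‖cumulantSeries Λ E n fun _ => b‖) 1).2 hb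
  · filter_upwards [eventually_summable_norm (radius_momentSeries_pos (Λ := Λ) (E := E))]
      with b hb
    exact (summable_nat_add_iff
      (f := fun n => ‖(momentSeries Λ E).removeZero n fun _ => b‖) 1).2 hb
  · obtain ⟨H, T, h1, h2, h3⟩ := exists_isCompInverse hΛ hu
    exact ⟨H, T, h1.congr (eventually_tsum_succ_eq radius_momentSeries_pos rfl), h2,
      h3.congr (eventually_tsum_succ_eq radius_cumulantSeries_pos cumulantSeries_zero)⟩

/-! ### Transfer of germs to the opposite algebra -/

section Opposite

variable {B : Type*} [NormedRing B]

lemma eventually_op {p : B → Prop} :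
    (∀ᶠ b in 𝓝 (0 : B), p b) ↔ ∀ᶠ b in 𝓝 (0 : Bᵐᵒᵖ), p (unop b) :=
  ⟨fun h => (continuous_unop.tendsto (0 : Bᵐᵒᵖ)).eventually h,
    fun h => (continuous_op.tendsto (0 : B)).eventually h⟩

lemma isCompInverse_op {F G : B → B} :
    IsCompInverse (fun b : Bᵐᵒᵖ => op (F (unop b))) (fun b => op (G (unop b))) ↔
      IsCompInverse F G := by
  have hc : ContinuousAt (fun b : Bᵐᵒᵖ => op (G (unop b))) 0 ↔ ContinuousAt G 0 := by
    constructor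
    · intro h
      have h1 : ContinuousAt (fun b : B => unop (op (G (unop (op b))))) 0 :=
        continuous_unop.continuousAt.comp
          (ContinuousAt.comp (f := op) (x := (0 : B)) h continuous_op.continuousAt)
      exact h1
    · intro h
      exact continuous_op.continuousAt.comp
        (ContinuousAt.comp (f := unop) (x := (0 : Bᵐᵒᵖ)) h continuous_unop.continuousAt)
  simp only [IsCompInverse, hc, eventually_op (B := B), unop_op, unop_zero, op_eq_zero_iff]
  refine and_congr_right fun _ => and_congr_right fun _ => and_congr ?_ ?_ <;>
  · refine eventually_congr (Eventually.of_forall fun b => ?_)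
    rw [← unop_inj, unop_op]

variable [NormedAlgebra ℂ B]

lemma isLeftQuotient_op {G θ : B → B} :
    IsLeftQuotient (fun b : Bᵐᵒᵖ => op (G (unop b))) (fun b => op (θ (unop b))) ↔
      IsRightQuotient G θ := by
  let e := opContinuousLinearEquiv ℂ (M := B)
  have ha : AnalyticAt ℂ (fun b : Bᵐᵒᵖ => op (θ (unop b))) 0 ↔ AnalyticAt ℂ θ 0 := by
    constructor
    · intro h
      have h1 : AnalyticAt ℂ (fun b : B => e.symm (op (θ (unop (e b))))) 0 :=
        (e.symm.analyticAt _).fun_comp (AnalyticAt.comp_of_eq (g := fun b => op (θ (unop b)))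
          h (e.analyticAt _) (map_zero e))
      exact h1
    · intro h
      exact (e.analyticAt _).fun_comp (AnalyticAt.comp_of_eq (g := θ) (f := e.symm)
        h (e.symm.analyticAt _) (map_zero e.symm))
  rw [IsLeftQuotient, IsRightQuotient, ha, eventually_op (B := B)]
  refine and_congr_right fun _ => eventually_congr (Eventually.of_forall fun b => ?_)
  rw [← unop_inj, unop_mul, unop_op, unop_op]

end Opposite

namespace BBSpace

variable {P : BBSpace B A}

lemma IsBanach.exists_E (hP : P.IsBanach) : ∃ E : A →L[ℂ] B, ∀ Z, E Z = P.E Z := by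
  obtain ⟨C, hC⟩ := hP.bounded_E
  exact ⟨P.E.mkContinuous C hC, fun _ => rfl⟩

lemma IsBanach.exists_left (hP : P.IsBanach) (X : A) :
    ∃ Λ : B →L[ℂ] A, ∀ b, Λ b = P.L b * X := by
  obtain ⟨C, hC⟩ := hP.bounded_L
  let L : B →ₗ[ℂ] A := P.ε.toLinearMap ∘ₗ (TensorProduct.mk ℂ B Bᵐᵒᵖ).flip 1
  exact ⟨(ContinuousLinearMap.mul ℂ A).flip X ∘L L.mkContinuous C hC, fun _ => rfl⟩

lemma IsBanach.exists_right (hP : P.IsBanach) (Y : A) :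
    ∃ Λ : Bᵐᵒᵖ →L[ℂ] A, ∀ b, Λ b = P.R (unop b) * Y := by
  obtain ⟨C, hC⟩ := hP.bounded_R
  let R : Bᵐᵒᵖ →ₗ[ℂ] A := P.ε.toLinearMap ∘ₗ TensorProduct.mk ℂ B Bᵐᵒᵖ 1
  exact ⟨(ContinuousLinearMap.mul ℂ A).flip Y ∘L R.mkContinuous C fun b => hC (unop b),
    fun _ => rfl⟩

/-- The series and inverses for a left operator. -/
theorem exists_left_inverses [CompleteSpace B] [CompleteSpace A] (hP : P.IsBanach) {X : A}
    (hX : X ∈ P.leftAlg) (hu : IsUnit (P.E X)) :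
    (∀ᶠ b in 𝓝 (0 : B), Summable fun n : ℕ => ‖P.leftCumulantTerm X (n + 1) b‖) ∧
      (∀ᶠ b in 𝓝 (0 : B), Summable fun n : ℕ => ‖P.E ((P.L b * X) ^ (n + 1))‖) ∧
      ∃ H T : B → B, IsCompInverse (P.leftPsi X) H ∧ IsLeftQuotient H T ∧
        IsCompInverse (P.leftPhi X) fun b => (1 + b) * H b := by
  obtain ⟨E, hE⟩ := hP.exists_E
  obtain ⟨Λ, hΛ⟩ := hP.exists_left X
  refine exists_isCompInverse_tsum (Λ := Λ) (E := E) (fun c b Z => ?_) ?_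
    (fun n b => P.leftCumulantTerm_eq hX hΛ hE n b) (fun n b => by rw [hE, hΛ])
  · rw [hΛ, hΛ, hE, hE, P.L_mul, mul_assoc, mul_assoc, P.E_L_mul, mul_assoc]
  · rwa [hE, hΛ, P.L_one, one_mul]

/-- The series and inverses for a right operator. -/
theorem exists_right_inverses [CompleteSpace B] [CompleteSpace A] (hP : P.IsBanach) {Y : A}
    (hu : IsUnit (P.E Y)) :
    (∀ᶠ d in 𝓝 (0 : B), Summable fun n : ℕ => ‖P.rightCumulantTerm Y (n + 1) d‖) ∧
      (∀ᶠ d in 𝓝 (0 : B), Summable fun n : ℕ => ‖P.E ((P.R d * Y) ^ (n + 1))‖) ∧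
      ∃ H T : B → B, IsCompInverse (P.rightPsi Y) H ∧ IsRightQuotient H T ∧
        IsCompInverse (P.rightPhi Y) fun d => H d * (1 + d) := by
  obtain ⟨E, hE⟩ := hP.exists_E
  obtain ⟨Λ, hΛ⟩ := hP.exists_right Y
  let E' : A →L[ℂ] Bᵐᵒᵖ := (opContinuousLinearEquiv ℂ : B ≃L[ℂ] Bᵐᵒᵖ) ∘L E
  have hE' : ∀ Z, E' Z = op (P.E Z) := fun Z => congrArg op (hE Z)
  obtain ⟨h1, h2, H, T, h3, h4, h5⟩ := exists_isCompInverse_tsum (Λ := Λ) (E := E')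
    (φ := fun n b => op (P.rightCumulantTerm Y (n + 1) (unop b)))
    (ψ := fun n b => op (P.E ((P.R (unop b) * Y) ^ (n + 1))))
    (fun c b Z => by
      rw [hΛ, hΛ, hE', hE', unop_mul, P.R_mul, mul_assoc, mul_assoc, P.E_R_mul, op_mul, op_unop,
        mul_assoc])
    (by
      rw [hE', hΛ, unop_one, P.R_one, one_mul]
      exact hu.op)
    (fun n b => by rw [P.rightCumulantTerm_eq hΛ hE', op_unop, op_unop])
    (fun n b => by rw [hE', hΛ])
  simp only [norm_op, tsum_op] at h1 h2 h3 h5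
  refine ⟨eventually_op.2 h1, eventually_op.2 h2, fun d => unop (H (op d)),
    fun d => unop (T (op d)), isCompInverse_op.1 h3, isLeftQuotient_op.1 h4, ?_⟩
  refine isCompInverse_op.1 ?_
  have h6 : IsCompInverse (fun b => op (P.rightPhi Y (unop b))) fun b => (1 + b) * H b := h5
  simpa only [op_mul, op_unop, op_add, op_one] using h6

end BBSpace

end Main

theorem mainTheorem8 {B A : Type*} [NormedRing B] [NormedAlgebra ℂ B] [CompleteSpace B]
    [NormedRing A] [NormedAlgebra ℂ A] [CompleteSpace A]
    (P : BBSpace B A) (hP : P.IsBanach) :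
    -- left operators
    (∀ X ∈ P.leftAlg, IsUnit (P.E X) →
      -- the series defining `Φ` and `Ψ` converge absolutely near zero
      (∀ᶠ b in 𝓝 (0 : B), Summable fun n : ℕ => ‖P.leftCumulantTerm X (n + 1) b‖) ∧
      (∀ᶠ b in 𝓝 (0 : B), Summable fun n : ℕ => ‖P.E ((P.L b * X) ^ (n + 1))‖) ∧
      -- both transforms exist, and they agree near zero
      (∃ S, P.IsLeftSTransform X S) ∧ (∃ S, P.IsDykemaLeftSTransform X S) ∧
      ∀ S S' : B → B, P.IsLeftSTransform X S → P.IsDykemaLeftSTransform X S' →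
        ∀ᶠ b in 𝓝 (0 : B), S b = S' b) ∧
    -- right operators
    (∀ Y ∈ P.rightAlg, IsUnit (P.E Y) →
      (∀ᶠ d in 𝓝 (0 : B), Summable fun n : ℕ => ‖P.rightCumulantTerm Y (n + 1) d‖) ∧
      (∀ᶠ d in 𝓝 (0 : B), Summable fun n : ℕ => ‖P.E ((P.R d * Y) ^ (n + 1))‖) ∧
      (∃ S, P.IsRightSTransform Y S) ∧ (∃ S, P.IsDykemaRightSTransform Y S) ∧
      ∀ S S' : B → B, P.IsRightSTransform Y S → P.IsDykemaRightSTransform Y S' →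
        ∀ᶠ d in 𝓝 (0 : B), S d = S' d) := by
  refine ⟨fun X hX hu => ?_, fun Y _ hu => ?_⟩
  · obtain ⟨h1, h2, H, T, h3, h4, h5⟩ := BBSpace.exists_left_inverses hP hX hu
    refine ⟨h1, h2, ⟨fun b => (1 + b) * T b, _, h5, ?_, ?_⟩,
      ⟨_, H, T, h3, h4, Eventually.of_forall fun _ => rfl⟩, ?_⟩
    · exact (analyticAt_const.add analyticAt_id).mul h4.1
    -- From `H b = b * T b`, the factor `b` moves to the left of `1 + b`, with which it commutes.
    · filter_upwards [h4.2] with b hb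
      rw [hb]
      noncomm_ring
    · rintro S S' ⟨G', hG', hS⟩ ⟨H', T', hH', hT', hS'⟩
      filter_upwards [eventually_quotient_eq h5 h3 (fun _ => rfl) hG' hS hH' hT', hS']
        with b e1 e2
      rw [e1, e2]
  · obtain ⟨h1, h2, H, T, h3, h4, h5⟩ := BBSpace.exists_right_inverses hP hu
    refine ⟨h1, h2, ⟨fun d => T d * (1 + d), _, h5, ?_, ?_⟩,
      ⟨_, H, T, h3, h4, Eventually.of_forall fun _ => rfl⟩, ?_⟩
    · exact h4.1.mul (analyticAt_const.add analyticAt_id)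
    · filter_upwards [h4.2] with d hd
      rw [hd]
      noncomm_ring
    · rintro S S' ⟨G', hG', hS⟩ ⟨H', T', hH', hT', hS'⟩
      -- Right quotients over `B` are left quotients over `Bᵐᵒᵖ`, so uniqueness is inherited from
      -- the left case.
      have h6 := eventually_quotient_eq (isCompInverse_op.2 h5) (isCompInverse_op.2 h3)
        (fun b => by rw [MulOpposite.op_mul, MulOpposite.op_add, MulOpposite.op_one,
          MulOpposite.op_unop]) (isCompInverse_op.2 hG') (isLeftQuotient_op.2 hS)
        (isCompInverse_op.2 hH') (isLeftQuotient_op.2 hT')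
      filter_upwards [eventually_op (p := fun d => S d = T' d * (1 + d)) |>.2 (by
        filter_upwards [h6] with b hb
        rw [← MulOpposite.op_inj, hb, MulOpposite.op_mul, MulOpposite.op_add, MulOpposite.op_one,
          MulOpposite.op_unop]), hS'] with d e1 e2
      rw [e1, e2]
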